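/- Let $k$ be a field of characteristic not $2$ and $A$ a Hopf algebra over $k$ with bijective antipode $S$, counit $\epsilon$ and $\Delta a=a_{(1)}\otimes a_{(2)}$; put $A^+=\ker\epsilon$ and $\pi(a)=a-\epsilon(a)$. A right $A$-crossed module is a right $A$-module ($\triangleleft$) and right $A$-comodule ($\Delta_R v=v_0\otimes v_1$) with $\Delta_R(v\triangleleft a)=v_0\triangleleft a_{(2)}\otimes S(a_{(1)})v_1a_{(3)}$; for such $V$ let $\Psi(v\otimes w)=w_0\otimes v\triangleleft w_1$ on $V\otimes V$, and $V\square A=\{\sum v_i\otimes b_i:\ \sum v_i\triangleleft a\otimes b_i=\sum v_i\otimes a_{(1)}b_iS(a_{(2)})\ \forall a\in A\}$. For a linear map $\Phi$ on $V\otimes V$, with $\Phi_i$ denoting $\Phi$ in the tensor factors $i,i+1$, the braided binomials on $V^{\otimes n}$ are defined by $\left[{n\atop r};\Phi\right]=\Phi_r\cdots\Phi_{n-1}\left(\left[{n-1\atop r-1};\Phi\right]\otimes{\rm id}\right)+\left[{n-1\atop r};\Phi\right]\otimes{\rm id}$, $\left[{n\atop 0};\Phi\right]={\rm id}$, $\left[{n\atop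 r};\Phi\right]=0$ for $r>n$. Further $[n,\Phi]=\left[{n\atop 1};\Phi\right]$, $[0,\Phi]!={\rm id}$ and $[n,\Phi]!=({\rm id}\otimes[n-1,\Phi]!)\,[n,\Phi]$. Let $B_-(V)=T(V)/\bigoplus_n\ker[n,-\Psi]!$, with the crossed module algebra structure induced from $V$ and the braided coproduct $\underline\Delta x=x^1\otimes x^2$ and counit $\underline\epsilon$ induced by $\underline\Delta(t)=\sum_{r=0}^n\left[{n\atop r};-\Psi\right](t)$ for $t\in V^{\otimes n}$ (the $r$-th term read in $V^{\otimes r}\otimes V^{\otimes(n-r)}$), and $\underline\epsilon(t)=0$ for $n\geq 1$. **Proposition.** Let $\Lambda^1$ be a right $A$-crossed module and let $\theta\in\Lambda^1$ satisfy $\Delta_R\theta-\theta\otimes1\in\Lambda^1\square A$. Suppose that for all $\eta\in\Lambda^1$ $$\Psi(\eta\otimes\theta)=\theta\otimes\eta,\qquad \{\Delta_R\theta-\theta\otimes 1,\ \Delta_R\eta\}=0,$$ where $\{x,y\}=xy+yx$ in the algebra $B_-(\Lambda^1)\otimes A$. Then the following hold. 1. The map $\omega:A^+\to\Lambda^1$,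 $\omega(a)=\theta\triangleleft a$, is a morphism of right crossed modules, where $A^+$ has the action by right multiplication and the coaction $a\mapsto a_{(2)}\otimes S(a_{(1)})a_{(3)}$. 2. $\bigoplus_n\ker[n,-\Psi]!$ is a two-sided ideal of $T(\Lambda^1)$, and the crossed module structure (making $B_-(\Lambda^1)$ an algebra in the category of right crossed modules), $\underline\Delta$ and $\underline\epsilon$ are well defined on $B_-(\Lambda^1)$. 3. Let $\Omega=A{\cdot\kern-.33em\triangleright\!\!\!<}B_-(\Lambda^1)$ be the super-bosonisation, that is $A\otimes B_-(\Lambda^1)$ with the grading of $B_-(\Lambda^1)$, unit $1\otimes1$, counit $\epsilon\otimes\underline\epsilon$ and $$(a\otimes x)(b\otimes y)=ab_{(1)}\otimes(x\triangleleft b_{(2)})y,\qquad \Delta(a\otimes x)=\bigl(a_{(1)}\otimes (x^1)_0\bigr)\otimes\bigl(a_{(2)}(x^1)_1\otimes x^2\bigr).$$ Let $\delta$ be given on $B_-(\Lambda^1)$ by $\delta\eta=[\theta,\eta\}=\theta\eta-(-1)^{|\eta|}\eta\theta$, and let $${\rm d}(a\otimes\eta)=a_{(1)}\otimes\omega(\pi(a_{(2)}))\,\eta+a\otimes\delta\eta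 .$$ Then $(\Omega,{\rm d})$ is an inner strongly bicovariant differential exterior algebra over $A=\Omega^0$. That is, $\Omega$ is a graded super-Hopf algebra (a graded algebra and graded coalgebra with antipode, whose coproduct and counit are algebra maps, for the product $(u\otimes v)(u'\otimes v')=(-1)^{|v||u'|}uu'\otimes vv'$ on $\Omega\otimes\Omega$) with $\Omega^0=A$ as Hopf algebras; ${\rm d}$ has degree $1$, ${\rm d}^2=0$ and ${\rm d}(uv)=({\rm d}u)v+(-1)^{|u|}u\,{\rm d}v$; $\Delta\circ{\rm d}=({\rm d}\otimes{\rm id}+(-1)^{|\ |}\otimes{\rm d})\circ\Delta$; and ${\rm d}w=\theta w-(-1)^{|w|}w\theta$ for all homogeneous $w\in\Omega$, with $\theta$ viewed as $1\otimes\theta\in\Omega^1$. -/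

import Mathlib

open scoped TensorProduct DirectSum

universe u v w

noncomputable section

/-! Sweedler notation in comments: `Δ a = a₁ ⊗ a₂`; for a right coaction, `v ↦ v₀ ⊗ v₁`. -/

section Convolution

variable {k A E : Type*} [CommRing k] [Ring A] [HopfAlgebra k A] [Ring E] [Algebra k E]

/-- Convolution product of linear maps out of a coalgebra: `a ↦ f(a₁) g(a₂)`. -/
def conv (f g : A →ₗ[k] E) : A →ₗ[k] E :=
  LinearMap.mul' k E ∘ₗ TensorProduct.map f g ∘ₗ Coalgebra.comul

/-- The left adjoint action `a ▷ b = a₁ b S(a₂)` of a Hopf algebra on itself. -/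
def leftAd (k A : Type*) [CommRing k] [Ring A] [HopfAlgebra k A] : A →ₗ[k] Module.End k A :=
  conv (LinearMap.mul k A) ((LinearMap.mul k A).flip ∘ₗ HopfAlgebra.antipode k)

/-- The right adjoint coaction `a ↦ a₂ ⊗ S(a₁) a₃` of a Hopf algebra on itself, computed in the
algebra `A ⊗ A` as `(1 ⊗ S a₁) (a₂ ⊗ 1) (1 ⊗ a₃)`. -/
def adCoact (k A : Type*) [CommRing k] [Ring A] [HopfAlgebra k A] : A →ₗ[k] A ⊗[k] A :=
  conv (TensorProduct.mk k A A 1 ∘ₗ HopfAlgebra.antipode k)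
    (conv ((TensorProduct.mk k A A).flip 1) (TensorProduct.mk k A A 1))

/-- The counit projection `π : A → A⁺ = ker ε`, `π a = a - ε(a)`. -/
def counitProj (k A : Type*) [CommRing k] [Ring A] [HopfAlgebra k A] :
    A →ₗ[k] LinearMap.ker (Coalgebra.counit : A →ₗ[k] k) :=
  LinearMap.codRestrict _
    (LinearMap.id - Algebra.linearMap k A ∘ₗ (Coalgebra.counit : A →ₗ[k] k))
    (fun a => by simp)

end Convolution

/-! ### Right crossed modules -/

/-- A right crossed (Drinfeld-Radford-Yetter) module over the Hopf algebra `A`: a right module and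
right comodule with `Δ_R(v ◁ a) = v₀ ◁ a₂ ⊗ S(a₁) v₁ a₃`. Here `act a v` is `v ◁ a`. -/
structure RightCrossedModule (k A V : Type*) [CommRing k] [Ring A] [HopfAlgebra k A]
    [AddCommGroup V] [Module k V] where
  act : A →ₗ[k] Module.End k V
  coact : V →ₗ[k] V ⊗[k] A
  act_one : ∀ v, act 1 v = v
  act_mul : ∀ a b v, act (a * b) v = act b (act a v)
  coact_coassoc : ∀ v,
    TensorProduct.assoc k V A A (TensorProduct.map coact LinearMap.id (coact v))
      = TensorProduct.map LinearMap.id Coalgebra.comul (coact v)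
  coact_counit : ∀ v,
    TensorProduct.rid k V (TensorProduct.map LinearMap.id Coalgebra.counit (coact v)) = v
  /-- The convolution takes place in `End(V ⊗ A)`; its value at `a` is the map
  `w ⊗ b ↦ w ◁ a₂ ⊗ S(a₁) b a₃`. -/
  coact_act : ∀ a v, coact (act a v)
    = conv (E := Module.End k (V ⊗[k] A))
        (LinearMap.lTensorHom V ∘ₗ LinearMap.mul k A ∘ₗ HopfAlgebra.antipode k)
        (conv (LinearMap.rTensorHom A ∘ₗ act) (LinearMap.lTensorHom V ∘ₗ (LinearMap.mul k A).flip))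
        a (coact v)

namespace RightCrossedModule

variable {k A V : Type*} [CommRing k] [Ring A] [HopfAlgebra k A] [AddCommGroup V] [Module k V]

/-- The braiding `Ψ(v ⊗ w) = w₀ ⊗ v ◁ w₁` on `V ⊗ V`. -/
def braiding (C : RightCrossedModule k A V) : V ⊗[k] V →ₗ[k] V ⊗[k] V :=
  TensorProduct.map LinearMap.id (TensorProduct.lift C.act.flip)
    ∘ₗ (TensorProduct.leftComm k V V A).toLinearMap
    ∘ₗ TensorProduct.map LinearMap.id C.coact

/-- `V □ A = {∑ vᵢ ⊗ bᵢ | ∑ vᵢ ◁ a ⊗ bᵢ = ∑ vᵢ ⊗ (a ▷ bᵢ) for all a}`, with `▷` the left adjoint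
action. -/
def box (C : RightCrossedModule k A V) : Submodule k (V ⊗[k] A) where
  carrier := {x | ∀ a, TensorProduct.map (C.act a) LinearMap.id x
    = TensorProduct.map LinearMap.id (leftAd k A a) x}
  add_mem' hx hy a := by rw [map_add, map_add, hx a, hy a]
  zero_mem' a := by rw [map_zero, map_zero]
  smul_mem' c x hx a := by rw [map_smul, map_smul, hx a]

/-- The map `ω : A⁺ → V`, `ω(a) = θ ◁ a`. -/
def omega (C : RightCrossedModule k A V) (θ : V) :
    LinearMap.ker (Coalgebra.counit : A →ₗ[k] k) →ₗ[k] V :=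
  C.act.flip θ ∘ₗ Submodule.subtype _

/-- `ω : A⁺ → V` is a morphism of right crossed modules, where `A⁺` has the right regular action and
the right adjoint coaction. -/
structure IsCrossedMorphism (C : RightCrossedModule k A V)
    (ω : LinearMap.ker (Coalgebra.counit : A →ₗ[k] k) →ₗ[k] V) : Prop where
  map_act : ∀ (a : LinearMap.ker (Coalgebra.counit : A →ₗ[k] k)) (b : A),
    ω (counitProj k A (a * b)) = C.act b (ω a)
  map_coact : ∀ a : LinearMap.ker (Coalgebra.counit : A →ₗ[k] k),
    C.coact (ω a)
      = TensorProduct.map (ω ∘ₗ counitProj k A) LinearMap.id (adCoact k A (a : A))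

end RightCrossedModule

/-! ### Braided integers, binomials and factorials

`Ψ` is any linear endomorphism of `V ⊗ V`; positions in `V^{⊗n}` are numbered from `1`. -/

namespace BraidedPower

variable {k V : Type*} [CommRing k] [AddCommGroup V] [Module k V]

/-- `f ⊗ id` on `V^{⊗(n+1)}`. -/
def tensId {n : ℕ} (f : Module.End k (⨂[k]^n V)) : Module.End k (⨂[k]^(n + 1) V) :=
  TensorPower.mulEquiv.toLinearMap ∘ₗ TensorProduct.map f LinearMap.id
    ∘ₗ (TensorPower.mulEquiv (n := n) (m := 1)).symm.toLinearMap

/-- `id ⊗ f` on `V^{⊗(1+n)} = V^{⊗(n+1)}`. -/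
def idTens {n : ℕ} (f : Module.End k (⨂[k]^n V)) : Module.End k (⨂[k]^(n + 1) V) :=
  (TensorPower.cast k V (Nat.add_comm 1 n)).toLinearMap
    ∘ₗ TensorPower.mulEquiv.toLinearMap ∘ₗ TensorProduct.map LinearMap.id f
    ∘ₗ (TensorPower.mulEquiv (n := 1) (m := n)).symm.toLinearMap
    ∘ₗ (TensorPower.cast k V (Nat.add_comm n 1)).toLinearMap

/-- The identification `V ⊗ V ≃ V^{⊗2}`, `v ⊗ w ↦ v ⊗ w`. -/
def squareEquiv (k V : Type*) [CommRing k] [AddCommGroup V] [Module k V] :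
    V ⊗[k] V ≃ₗ[k] ⨂[k]^2 V :=
  (TensorProduct.congr (PiTensorProduct.subsingletonEquiv (R := k) (s := fun _ : Fin 1 => V) 0).symm
    (PiTensorProduct.subsingletonEquiv (R := k) (s := fun _ : Fin 1 => V) 0).symm).trans
    (TensorPower.mulEquiv (n := 1) (m := 1))

/-- `Ψᵢ`: the map `Ψ` acting in the tensor factors `i, i+1` of `V^{⊗n}`, for `1 ≤ i < n`
(by convention the identity for other values of `i`, which never occur below). -/
def braidAt (Ψ : Module.End k (V ⊗[k] V)) : (n : ℕ) → ℕ → Module.End k (⨂[k]^n V)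
  | 0, _ => 1
  | 1, _ => 1
  | n + 2, i =>
    if i = n + 1 then
      (TensorPower.mulEquiv (n := n) (m := 2)).toLinearMap
        ∘ₗ TensorProduct.map LinearMap.id
          ((squareEquiv k V).toLinearMap ∘ₗ Ψ ∘ₗ (squareEquiv k V).symm.toLinearMap)
        ∘ₗ (TensorPower.mulEquiv (n := n) (m := 2)).symm.toLinearMap
    else tensId (braidAt Ψ (n + 1) i)

/-- The composite `Ψ_r Ψ_{r+1} ⋯ Ψ_{n-1}` on `V^{⊗n}`; the identity if `r = n`. -/
def braidChain (Ψ : Module.End k (V ⊗[k] V)) (n r : ℕ) : Module.End k (⨂[k]^n V) :=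
  ((List.range' r (n - r)).map (braidAt Ψ n)).prod

/-- The braided binomials:
`[n, r; Ψ] = Ψ_r ⋯ Ψ_{n-1} ([n-1, r-1; Ψ] ⊗ id) + [n-1, r; Ψ] ⊗ id`,
with `[n, 0; Ψ] = id` and `[n, r; Ψ] = 0` for `r > n`. -/
def binom (Ψ : Module.End k (V ⊗[k] V)) : (n : ℕ) → ℕ → Module.End k (⨂[k]^n V)
  | _, 0 => 1
  | 0, _ + 1 => 0
  | n + 1, r + 1 =>
    braidChain Ψ (n + 1) (r + 1) * tensId (binom Ψ n r) + tensId (binom Ψ n (r + 1))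

/-- The braided factorials: `[n, Ψ]! = (id ⊗ [n-1, Ψ]!) [n, Ψ]`, where `[n, Ψ] = [n, 1; Ψ]`. -/
def factorial (Ψ : Module.End k (V ⊗[k] V)) : (n : ℕ) → Module.End k (⨂[k]^n V)
  | 0 => 1
  | n + 1 => idTens (factorial Ψ n) * binom Ψ (n + 1) 1

/-- `γ_{r,n-r} : V^{⊗n} → V^{⊗r} ⊗ V^{⊗(n-r)}` for `r ≤ n`. -/
def split (k V : Type*) [CommRing k] [AddCommGroup V] [Module k V] (n r : ℕ) (h : r ≤ n) :
    ⨂[k]^n V →ₗ[k] (⨂[k]^r V) ⊗[k] (⨂[k]^(n - r) V) :=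
  (TensorPower.mulEquiv (n := r) (m := n - r)).symm.toLinearMap
    ∘ₗ (TensorPower.cast k V (Nat.add_sub_of_le h).symm).toLinearMap

end BraidedPower

/-! ### The braided-antisymmetric algebra -/

section BMinus

variable {k A V : Type*} [CommRing k] [Ring A] [HopfAlgebra k A] [AddCommGroup V] [Module k V]

/-- The relations `t = 0` for `t ∈ V^{⊗n}` in the kernel of the braided factorial `[n, -Ψ]!`. -/
def BMinusRel (C : RightCrossedModule k A V) (x y : TensorAlgebra k V) : Prop :=
  ∃ (n : ℕ) (t : ⨂[k]^n V), BraidedPower.factorial (-C.braiding) n t = 0 ∧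
    x = TensorPower.toTensorAlgebra t ∧ y = 0

/-- `B₋(V)`: the quotient algebra of the tensor algebra by the relations `⊕ₙ ker [n, -Ψ]!`. -/
abbrev BMinus (C : RightCrossedModule k A V) : Type _ := RingQuot (BMinusRel C)

namespace BMinus

variable (C : RightCrossedModule k A V)

/-- The quotient map `T(V) → B₋(V)`. -/
def mk : TensorAlgebra k V →ₐ[k] BMinus C := RingQuot.mkAlgHom k (BMinusRel C)

/-- The generators `V → B₋(V)`. -/
def ι : V →ₗ[k] BMinus C := (mk C).toLinearMap ∘ₗ TensorAlgebra.ι k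

/-- The component `V^{⊗n} → B₋(V)` of the quotient map. -/
def ofPower (n : ℕ) : ⨂[k]^n V →ₗ[k] BMinus C :=
  (mk C).toLinearMap ∘ₗ TensorPower.toTensorAlgebra

/-- The degree `n` part of `B₋(V)`. -/
def deg (n : ℕ) : Submodule k (BMinus C) := LinearMap.range (ofPower C n)

/-- `CB` is the crossed module structure on `B₋(V)` induced from `V`: it extends that of `V` and makes
`B₋(V)` an algebra in the category of right crossed modules. -/
structure IsCrossedAlgebra (CB : RightCrossedModule k A (BMinus C)) : Prop where
  act_ι : ∀ a v, CB.act a (ι C v) = ι C (C.act a v)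
  coact_ι : ∀ v, CB.coact (ι C v) = TensorProduct.map (ι C) LinearMap.id (C.coact v)
  act_one : ∀ a, CB.act a 1 = algebraMap k _ (Coalgebra.counit a)
  /-- `(x y) ◁ a = (x ◁ a₁) (y ◁ a₂)` -/
  act_mul : ∀ a x y, CB.act a (x * y) = conv (CB.act.flip x) (CB.act.flip y) a
  coact_one : CB.coact 1 = 1 ⊗ₜ[k] 1
  /-- `Δ_R(x y) = x₀ y₀ ⊗ x₁ y₁` -/
  coact_mul : ∀ x y, CB.coact (x * y) = CB.coact x * CB.coact y

/-- `ΔB` and `εB` are the braided coproduct and counit of `B₋(V)`, the ones induced by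
`Δ(v₁ ⊗ ⋯ ⊗ vₙ) = ∑_r γ_{r,n-r} [n, r; -Ψ] (v₁ ⊗ ⋯ ⊗ vₙ)`, and `ε = 0` in positive degree. -/
structure IsBraidedCoproduct (ΔB : BMinus C →ₗ[k] BMinus C ⊗[k] BMinus C)
    (εB : BMinus C →ₗ[k] k) : Prop where
  comul_ofPower : ∀ (n : ℕ) (t : ⨂[k]^n V), ΔB (ofPower C n t)
    = ∑ r : Fin (n + 1), TensorProduct.map (ofPower C r) (ofPower C (n - r))
        (BraidedPower.split k V n r (Nat.le_of_lt_succ r.2)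
          (BraidedPower.binom (-C.braiding) n r t))
  counit_one : εB 1 = 1
  counit_ofPower : ∀ (n : ℕ) (t : ⨂[k]^n V), n ≠ 0 → εB (ofPower C n t) = 0

end BMinus

end BMinus

/-! ### Super-Hopf algebras and strongly bicovariant differential exterior algebras -/

section Super

variable {k : Type*} [CommRing k] {Ω : Type*} [Ring Ω] [Algebra k Ω]

/-- The parity operator `w ↦ (-1)^{|w|} w` of a graded algebra. -/
def gradeSign (𝒜 : ℕ → Submodule k Ω) [GradedAlgebra 𝒜] : Ω →ₗ[k] Ω :=
  DirectSum.toModule k ℕ Ω (fun n => ((-1 : k) ^ n) • (𝒜 n).subtype)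
    ∘ₗ (DirectSum.decomposeLinearEquiv 𝒜).toLinearMap

/-- A graded super-Hopf algebra: a graded algebra with a graded coalgebra structure whose coproduct
`Ω → Ω ⊗ Ω` and counit are algebra maps, where `Ω ⊗ Ω` has the super tensor product
`(a ⊗ b)(c ⊗ d) = (-1)^{|b||c|} ac ⊗ bd`, and with an antipode. -/
structure IsGradedSuperHopf [Coalgebra k Ω] (𝒜 : ℕ → Submodule k Ω) [GradedAlgebra 𝒜] :
    Prop where
  comul_deg : ∀ n, ∀ x ∈ 𝒜 n, (Coalgebra.comul x : Ω ⊗[k] Ω) ∈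
    ⨆ p ∈ Finset.HasAntidiagonal.antidiagonal n,
      LinearMap.range (TensorProduct.map (𝒜 p.1).subtype (𝒜 p.2).subtype)
  counit_deg : ∀ n, n ≠ 0 → ∀ x ∈ 𝒜 n, (Coalgebra.counit x : k) = 0
  comul_one : (Coalgebra.comul 1 : Ω ⊗[k] Ω) = 1 ⊗ₜ[k] 1
  comul_mul : ∀ x y : Ω, GradedTensorProduct.of k 𝒜 𝒜 (Coalgebra.comul (x * y))
    = GradedTensorProduct.of k 𝒜 𝒜 (Coalgebra.comul x)
      * GradedTensorProduct.of k 𝒜 𝒜 (Coalgebra.comul y)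
  counit_one : (Coalgebra.counit (1 : Ω) : k) = 1
  counit_mul : ∀ x y : Ω, (Coalgebra.counit (x * y) : k)
    = Coalgebra.counit x * Coalgebra.counit y
  exists_antipode : ∃ S : Ω →ₗ[k] Ω, (∀ n, ∀ x ∈ 𝒜 n, S x ∈ 𝒜 n) ∧
    (∀ x, LinearMap.mul' k Ω (TensorProduct.map S LinearMap.id (Coalgebra.comul x))
      = algebraMap k Ω (Coalgebra.counit x)) ∧
    (∀ x, LinearMap.mul' k Ω (TensorProduct.map LinearMap.id S (Coalgebra.comul x))
      = algebraMap k Ω (Coalgebra.counit x))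

/-- A differential exterior algebra: `d` is a degree `1` super-derivation with `d² = 0`. -/
structure IsDifferentialExterior (𝒜 : ℕ → Submodule k Ω) [GradedAlgebra 𝒜] (d : Ω →ₗ[k] Ω) :
    Prop where
  d_deg : ∀ n, ∀ x ∈ 𝒜 n, d x ∈ 𝒜 (n + 1)
  d_mul : ∀ n, ∀ x ∈ 𝒜 n, ∀ y, d (x * y) = d x * y + (-1) ^ n * (x * d y)
  d_d : ∀ x, d (d x) = 0

/-- A strongly bicovariant differential exterior algebra over the Hopf algebra `A`, identified
with the degree `0` part through `j`. -/
structure IsStronglyBicovariant {A : Type*} [Ring A] [HopfAlgebra k A] [Coalgebra k Ω]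
    (j : A →ₐ[k] Ω) (𝒜 : ℕ → Submodule k Ω) [GradedAlgebra 𝒜] (d : Ω →ₗ[k] Ω) : Prop where
  superHopf : IsGradedSuperHopf 𝒜
  differential : IsDifferentialExterior 𝒜 d
  j_injective : Function.Injective j
  range_j : LinearMap.range j.toLinearMap = 𝒜 0
  j_comul : ∀ a, Coalgebra.comul (j a)
    = TensorProduct.map j.toLinearMap j.toLinearMap (Coalgebra.comul a)
  j_counit : ∀ a, (Coalgebra.counit (j a) : k) = Coalgebra.counit a
  /-- The super-coderivation property `Δ d = (d ⊗ id + (-1)^{| |} ⊗ d) Δ`. -/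
  comul_d : ∀ w, (Coalgebra.comul (d w) : Ω ⊗[k] Ω)
    = TensorProduct.map d LinearMap.id (Coalgebra.comul w)
      + TensorProduct.map (gradeSign 𝒜) d (Coalgebra.comul w)

end Super

/-! ### Super-bosonisation -/

section Bosonisation

variable {k A B : Type*} [CommRing k] [Ring A] [HopfAlgebra k A] [Ring B] [Algebra k B]

/-- The bosonisation coproduct on `A ⊗ B`:
`a ⊗ x ↦ (a₁ ⊗ (x¹)₀) ⊗ (a₂ (x¹)₁ ⊗ x²)`, where `ΔB x = x¹ ⊗ x²`. -/
def bosonisationComul (CB : RightCrossedModule k A B) (ΔB : B →ₗ[k] B ⊗[k] B) :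
    A ⊗[k] B →ₗ[k] (A ⊗[k] B) ⊗[k] (A ⊗[k] B) :=
  TensorProduct.map LinearMap.id
      (TensorProduct.map (LinearMap.mul' k A) LinearMap.id
        ∘ₗ (TensorProduct.assoc k A A B).symm.toLinearMap)
    ∘ₗ (TensorProduct.tensorTensorTensorComm k A A B (A ⊗[k] B)).toLinearMap
    ∘ₗ TensorProduct.map Coalgebra.comul
      ((TensorProduct.assoc k B A B).toLinearMap
        ∘ₗ TensorProduct.map CB.coact LinearMap.id ∘ₗ ΔB)

/-- `Ω` with its grading `𝒜` is the super-bosonisation of `B` by `A`, through the linear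
identification `e : A ⊗ B ≃ Ω`: the smash product algebra
`(a ⊗ x)(b ⊗ y) = a b₁ ⊗ (x ◁ b₂) y`, the cross coproduct `bosonisationComul`, the tensor product
counit, and the grading of `B`. -/
structure IsSuperBosonisation {Ω : Type*} [Ring Ω] [Algebra k Ω] [Coalgebra k Ω]
    (CB : RightCrossedModule k A B) (ΔB : B →ₗ[k] B ⊗[k] B) (εB : B →ₗ[k] k)
    (ℬ : ℕ → Submodule k B) (e : A ⊗[k] B ≃ₗ[k] Ω) (𝒜 : ℕ → Submodule k Ω) : Prop where
  one_eq : e (1 ⊗ₜ[k] 1) = 1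
  mul_eq : ∀ a x b y, e (a ⊗ₜ[k] x) * e (b ⊗ₜ[k] y)
    = e (TensorProduct.map (LinearMap.mulLeft k a) (LinearMap.mulRight k y ∘ₗ CB.act.flip x)
        (Coalgebra.comul b))
  comul_eq : ∀ z, Coalgebra.comul (e z)
    = TensorProduct.map e.toLinearMap e.toLinearMap (bosonisationComul CB ΔB z)
  counit_eq : ∀ a x, (Coalgebra.counit (e (a ⊗ₜ[k] x)) : k) = Coalgebra.counit a * εB x
  deg_eq : ∀ n, 𝒜 n
    = (LinearMap.range (LinearMap.lTensor A (ℬ n).subtype)).map e.toLinearMap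

end Bosonisation

end

/-! The signs are removed by enlarging the Hopf algebra. Let `H = A[±1]` be `A` with a central
group-like element `Γ` of order two adjoined; let `Γ` act on `V` by `-1` and multiply the coaction
by `Γ`. This makes `V` a crossed module over `H` whose braiding is `-Ψ`
(`IsSuperExtension.braiding`). Hence `B₋(V)` is an ordinary Nichols algebra over `H`, and the
super-bosonisation `Ω` of `B₋(V)` by `A` lies in the ordinary bosonisation `Ω'` over `H`: one has
`Ω' = Ω + ΓΩ`, and conjugation by `Γ` is the parity operator of `Ω` (`isSuperCover`).

In the ordinary setting, let `B` be an algebra generated by a crossed module. By the crossed module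
condition, `v ↦ v₀ ⊗ v₁ + 1 ⊗ v` is compatible with the coproduct of `H` (`crossRel_primComul`), so
together they define a coproduct of the smash product. The braided coproduct of `B` is its
projection to `B ⊗ B`, and determines it (`untwist_bcomul`). On `T(V)` the components of the braided
coproduct are the braided binomials, because both satisfy the same recursion when a vector is
appended (`tensorComul_toTensorAlgebra`).

The ideal `⊕ₙ ker [n, -Ψ]!` is the radical: the largest subspace of the augmentation ideal stable
under the skew derivatives, which are the contractions of the component `T(V) → V ⊗ T(V)` of the
coproduct. The skew Leibniz rule, equivariance and coassociativity make the radical a two-sided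
ideal, a crossed submodule and a coideal (`mul_mem_radical_left`, `mul_mem_radical_right`,
`act_mem_radical`, `coact_mem_radical`, `map_bcomul_eq_zero`). On `V^{⊗(n+1)}` this component is the
braided integer, so that membership in the radical obeys the recursion of the braided factorials
(`tensorRadical_eq`).

To return to super objects, `p ⊗ q ↦ p ⊗ Γ^{|p|} q` embeds the super tensor square of `Ω`, as an
algebra, into the ordinary tensor square of `Ω'`. The coproduct of `Ω'` carries `Ω` into the image
(`comulHom_smashIncl_mem`), and the super-bialgebra axioms are pulled back. The antipode comes from
that of `A` by a geometric series in the convolution algebra (`exists_antipode`).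

Finally `d = [θ, ·}` is a super-derivation whose square is the commutator with `θ²`, and `θ² = 0`
since `Ψ(θ ⊗ θ) = θ ⊗ θ` is killed by `[2, -Ψ]`. In `Ω' ⊗ Ω'` one has `Δθ = (θ ⊗ Γ + 1 ⊗ θ) + (Γ ⊗
Γ)u`. The graded commutator with the bracket is `d ⊗ id + (-1)^{| |} ⊗ d`; the rest contributes
nothing provided that `u` commutes with `Δ(Ω)` (`comul_innerDiff`). Each hypothesis gives one part
of this: membership in `V □ A` for `A`, the condition on `Ψ` for `1 ⊗ η`, and the anticommutator for
`η₀ ⊗ Γη₁`, where a factor `Γ` in `u` turns anticommutation into commutation (`supercentral_mul`).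
Membership in `V □ A` also yields the morphism `ω`, through `diagAct_of_mem_box`. -/

noncomputable section

open WithConv Coalgebra

section ShortcutInstances

variable {R M N : Type*} [CommSemiring R] [AddCommMonoid M] [AddCommMonoid N] [Module R M]
  [Module R N]

instance LinearMap.zeroHomClass : ZeroHomClass (M →ₗ[R] N) M N where
  map_zero f := f.map_zero

instance LinearMap.addHomClass : AddHomClass (M →ₗ[R] N) M N where
  map_add f := f.map_add

instance LinearEquiv.zeroHomClass : ZeroHomClass (M ≃ₗ[R] N) M N where
  map_zero f := f.map_zero

instance LinearEquiv.addHomClass : AddHomClass (M ≃ₗ[R] N) M N where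
  map_add f := f.map_add

end ShortcutInstances

/-! ### Convolution algebras of linear maps out of a Hopf algebra. -/

namespace Convolution

variable {k H E E' : Type*} [CommRing k] [Ring H] [HopfAlgebra k H] [Ring E] [Algebra k E]
  [Ring E'] [Algebra k E']

theorem conv_eq (f g : H →ₗ[k] E) : conv f g = (toConv f * toConv g).ofConv := rfl

/-- The constant elements `a ↦ ε(a) e` of a convolution algebra. -/
def const (k H E : Type*) [CommRing k] [Ring H] [HopfAlgebra k H] [Ring E] [Algebra k E] :
    E →ₐ[k] WithConv (H →ₗ[k] E) :=
  AlgHom.ofLinearMap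
    { toFun := fun e => toConv ((counit : H →ₗ[k] k).smulRight e)
      map_add' := fun x y => by ext; simp
      map_smul' := fun c x => by
        ext a
        exact smul_comm (counit (R := k) a) c x }
    (by ext; simp [Algebra.algebraMap_eq_smul_one])
    (fun x y => by
      ext a
      simp only [LinearMap.coe_mk, AddHom.coe_mk, LinearMap.coe_smulRight]
      rw [(ℛ k a).convMul_apply]
      simp only [LinearMap.coe_smulRight, smul_mul_smul_comm, ← Finset.sum_smul]
      congr 1
      conv_lhs => rw [← sum_counit_smul (ℛ k a)]
      simp)

theorem const_apply (e : E) (a : H) : const k H E e a = counit (R := k) a • e := rfl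

/-- By the counit axiom a constant factor acts by plain multiplication. Commutation rules between a
fixed element and all values of a map thus become identities in a convolution algebra. -/
theorem const_mul_apply (e : E) (f : WithConv (H →ₗ[k] E)) (a : H) :
    (const k H E e * f) a = e * f a := by
  rw [(ℛ k a).convMul_apply]
  simp only [const_apply, smul_mul_assoc, ← mul_smul_comm, ← map_smul, ← Finset.mul_sum, ← map_sum]
  rw [sum_counit_smul]

theorem mul_const_apply (e : E) (f : WithConv (H →ₗ[k] E)) (a : H) :
    (f * const k H E e) a = f a * e := by
  rw [(ℛ k a).convMul_apply]
  simp only [const_apply, mul_smul_comm, ← smul_mul_assoc, ← map_smul, ← Finset.sum_mul, ← map_sum]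
  congr 2
  have h := congrArg (TensorProduct.rid k H) (sum_tmul_counit_eq (ℛ k a))
  simpa only [map_sum, TensorProduct.rid_tmul, one_smul] using h

/-- Postcomposition with an algebra map, as a map of convolution algebras. -/
def postcomp (H : Type*) [Ring H] [HopfAlgebra k H] (f : E →ₐ[k] E') :
    WithConv (H →ₗ[k] E) →ₐ[k] WithConv (H →ₗ[k] E') :=
  AlgHom.ofLinearMap
    { toFun := fun g => toConv (f.toLinearMap ∘ₗ g.ofConv)
      map_add' := fun x y => by ext; simp
      map_smul' := fun c x => by ext; simp }
    (by ext; simp)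
    (fun x y => by
      ext a
      simp [(ℛ k a).convMul_apply])

theorem postcomp_apply (f : E →ₐ[k] E') (g : WithConv (H →ₗ[k] E)) (a : H) :
    postcomp H f g a = f (g a) := rfl

/-- The antipode axiom pushed through `f`: composing an algebra map with the antipode gives its
convolution inverse. -/
theorem algHom_mul_antipode (f : H →ₐ[k] E) :
    toConv f.toLinearMap * toConv (f.toLinearMap ∘ₗ HopfAlgebra.antipode k) = 1 := by
  ext a
  rw [(ℛ k a).convMul_apply]
  simp [← map_mul, ← map_sum, HopfAlgebra.sum_mul_antipode_eq_algebraMap_counit]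

theorem antipode_mul_algHom (f : H →ₐ[k] E) :
    toConv (f.toLinearMap ∘ₗ HopfAlgebra.antipode k) * toConv f.toLinearMap = 1 := by
  ext a
  rw [(ℛ k a).convMul_apply]
  simp [← map_mul, ← map_sum, HopfAlgebra.sum_antipode_mul_eq_algebraMap_counit]

/-- Evaluation of the convolution product on a tensor. -/
theorem mul_apply (f g : WithConv (H →ₗ[k] E)) (a : H) :
    (f * g) a = LinearMap.mul' k E (TensorProduct.map f.ofConv g.ofConv (comul a)) := rfl

end Convolution

/-! ### Crossed module algebras and their smash products. -/

/-- `CB` makes `B` an algebra in the category of right crossed modules. -/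
structure IsCrossedAlg {k H B : Type*} [CommRing k] [Ring H] [HopfAlgebra k H] [Ring B]
    [Algebra k B] (CB : RightCrossedModule k H B) : Prop where
  act_one : ∀ a, CB.act a 1 = algebraMap k B (counit a)
  act_mul : ∀ a x y, CB.act a (x * y) = conv (CB.act.flip x) (CB.act.flip y) a
  coact_one : CB.coact 1 = 1 ⊗ₜ[k] 1
  coact_mul : ∀ x y, CB.coact (x * y) = CB.coact x * CB.coact y

/-- The underlying space of the smash product algebra of `H` and a crossed module algebra `B`. -/
def Smash {k H B : Type*} [CommRing k] [Ring H] [HopfAlgebra k H] [Ring B]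
    [Algebra k B] {CB : RightCrossedModule k H B} (_hB : IsCrossedAlg CB) : Type _ := H ⊗[k] B

namespace Smash

variable {k H B E : Type*} [CommRing k] [Ring H] [HopfAlgebra k H] [Ring B]
    [Algebra k B] [Ring E] [Algebra k E] {CB : RightCrossedModule k H B} (hB : IsCrossedAlg CB)

instance : AddCommGroup (Smash hB) := inferInstanceAs (AddCommGroup (H ⊗[k] B))
instance : Module k (Smash hB) := inferInstanceAs (Module k (H ⊗[k] B))

/-- The identification of the smash product with the tensor product. -/
def of : H ⊗[k] B ≃ₗ[k] Smash hB := LinearEquiv.refl k _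

/-- Right multiplication by `a : H` on the smash product: `(b ⊗ y) a = b a₁ ⊗ y ◁ a₂`. -/
def mulH (CB : RightCrossedModule k H B) : H →ₗ[k] Module.End k (H ⊗[k] B) :=
  (TensorProduct.map₂ (LinearMap.mul k H) CB.act.flip).flip ∘ₗ comul

theorem mulH_tmul (a b : H) (x : B) :
    mulH CB a (b ⊗ₜ x) = TensorProduct.map (LinearMap.mulLeft k b) (CB.act.flip x) (comul a) := rfl

/-- Right multiplication by `x : B` on the smash product. -/
def mulB (k H B : Type*) [CommRing k] [Ring H] [HopfAlgebra k H] [Ring B] [Algebra k B] :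
    B →ₗ[k] Module.End k (H ⊗[k] B) :=
  LinearMap.lTensorHom H ∘ₗ (LinearMap.mul k B).flip

theorem mulB_tmul (x y : B) (b : H) : mulB k H B x (b ⊗ₜ y) = b ⊗ₜ (y * x) := rfl

/-- Right multiplication operators of the smash product. -/
def mulR (CB : RightCrossedModule k H B) : H ⊗[k] B →ₗ[k] Module.End k (H ⊗[k] B) :=
  TensorProduct.lift
    ((LinearMap.mul k (Module.End k (H ⊗[k] B))).flip.compl₁₂ (mulH CB) (mulB k H B))

theorem mulR_tmul (a : H) (x : B) (z : H ⊗[k] B) :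
    mulR CB (a ⊗ₜ x) z = mulB k H B x (mulH CB a z) := rfl

/-- All of `H ⊗ H` already acts on `H ⊗ B` from the right, one leg on each factor; it remains to use
that the coproduct is multiplicative. -/
theorem mulH_mul (a b : H) (z : H ⊗[k] B) : mulH CB (a * b) z = mulH CB b (mulH CB a z) := by
  have key : ∀ (p q : H ⊗[k] H), TensorProduct.map₂ (LinearMap.mul k H) CB.act.flip z (p * q)
      = TensorProduct.map₂ (LinearMap.mul k H) CB.act.flip
        (TensorProduct.map₂ (LinearMap.mul k H) CB.act.flip z p) q := by
    intro p q
    induction z with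
    | zero => simp
    | add z w hz hw => simp only [map_add, LinearMap.add_apply, hz, hw]
    | tmul c y =>
      induction p with
      | zero => simp
      | add p p' hp hp' => simp only [add_mul, map_add, LinearMap.add_apply, hp, hp']
      | tmul a a' =>
        induction q with
        | zero => simp
        | add q q' hq hq' => simp only [mul_add, map_add, hq, hq']
        | tmul b b' => simp [mul_assoc, CB.act_mul]
  simp only [mulH, LinearMap.comp_apply, LinearMap.flip_apply, Bialgebra.comul_mul, key]

theorem mulH_one (z : H ⊗[k] B) : mulH CB 1 z = z := by
  induction z with
  | zero => simp
  | add z w hz hw => rw [map_add, hz, hw]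
  | tmul c y => simp [mulH_tmul, Algebra.TensorProduct.one_def, CB.act_one]

include hB in
theorem mulH_mulB (a : H) (y : B) (z : H ⊗[k] B) :
    mulH CB a (mulB k H B y z) = mulR CB (mulH CB a ((1 : H) ⊗ₜ[k] y)) z := by
  induction z with
  | zero => simp
  | add z w hz hw => simp only [map_add, hz, hw]
  | tmul c z =>
    -- `G` is `x₁ ⊗ x₂ ⊗ x₃ ↦ c x₁ ⊗ (z ◁ x₂)(y ◁ x₃)`. The two sides are its values at the two
    -- bracketings of the iterated coproduct of `a`.
    let G : H ⊗[k] (H ⊗[k] H) →ₗ[k] H ⊗[k] B :=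
      TensorProduct.map (LinearMap.mulLeft k c)
        (LinearMap.mul' k B ∘ₗ TensorProduct.map (CB.act.flip z) (CB.act.flip y))
    have h1 : ∀ t : H ⊗[k] H, TensorProduct.map (LinearMap.mulLeft k c) (CB.act.flip (z * y)) t
        = G (TensorProduct.map LinearMap.id comul t) := by
      intro t
      induction t with
      | zero => simp
      | add s t hs ht => simp only [map_add, hs, ht]
      | tmul a b => simp [G, hB.act_mul, conv]
    have h2 : ∀ t : H ⊗[k] H, mulR CB (TensorProduct.map (LinearMap.mulLeft k (1 : H))
        (CB.act.flip y) t) (c ⊗ₜ[k] z)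
          = G (TensorProduct.assoc k H H H (TensorProduct.map comul LinearMap.id t)) := by
      intro t
      induction t with
      | zero => simp
      | add s t hs ht => simp only [map_add, LinearMap.add_apply, hs, ht]
      | tmul a b =>
        simp only [TensorProduct.map_tmul, mulR_tmul, mulH_tmul, LinearMap.mulLeft_apply,
          one_mul, LinearMap.id_apply]
        induction (comul a : H ⊗[k] H) with
        | zero => simp
        | add s t hs ht => simp only [map_add, TensorProduct.add_tmul, hs, ht]
        | tmul a a' => simp [G, mulB_tmul]
    rw [mulB_tmul, mulH_tmul, mulH_tmul, h1, h2]
    congr 1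
    exact (coassoc_apply a).symm

/-- Every right multiplication is a composite of one by an element of `H` and one by an element of
`B`, so associativity is checked against each kind separately. For `B` it is associativity of `B`;
for `H` it is `mulH_mulB`. -/
theorem mulR_mulR (hB : IsCrossedAlg CB) (x y z : H ⊗[k] B) :
    mulR CB z (mulR CB y x) = mulR CB (mulR CB z y) x := by
  induction z with
  | zero => simp
  | add z w hz hw => simp only [map_add, LinearMap.add_apply, hz, hw]
  | tmul a u =>
    have hBm : ∀ (w z : H ⊗[k] B), mulR CB (mulB k H B u w) z = mulB k H B u (mulR CB w z) := by
      intro w z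
      induction w with
      | zero => simp
      | add z w hz hw => simp only [map_add, LinearMap.add_apply, hz, hw]
      | tmul b y =>
        simp only [mulB_tmul, mulR_tmul]
        induction mulH CB b z with
        | zero => simp
        | add z w hz hw => simp only [map_add, hz, hw]
        | tmul b y => simp [mulB_tmul, mul_assoc]
    have hHm : ∀ (w z : H ⊗[k] B), mulR CB (mulH CB a w) z = mulH CB a (mulR CB w z) := by
      intro w z
      induction w with
      | zero => simp
      | add z w hz hw => simp only [map_add, LinearMap.add_apply, hz, hw]
      | tmul b y =>
        rw [mulR_tmul, mulH_mulB hB, mulH_tmul, mulH_tmul]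
        have : ∀ t : H ⊗[k] H, mulR CB (TensorProduct.map (LinearMap.mulLeft k b)
            (CB.act.flip y) t) z = mulR CB (TensorProduct.map (LinearMap.mulLeft k 1)
            (CB.act.flip y) t) (mulH CB b z) := by
          intro t
          induction t with
          | zero => simp
          | add z w hz hw => simp only [map_add, LinearMap.add_apply, hz, hw]
          | tmul c d => simp [mulR_tmul, mulH_mul]
        exact this _
    rw [mulR_tmul, mulR_tmul, hBm, hHm]

theorem mulR_one (hB : IsCrossedAlg CB) (z : H ⊗[k] B) : mulR CB z (1 ⊗ₜ 1) = z := by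
  induction z with
  | zero => simp
  | add z w hz hw => simp only [map_add, LinearMap.add_apply, hz, hw]
  | tmul a x =>
    rw [mulR_tmul, mulH_tmul]
    have : ∀ t : H ⊗[k] H, TensorProduct.map (LinearMap.mulLeft k (1 : H)) (CB.act.flip 1) t
        = (TensorProduct.rid k H (TensorProduct.map LinearMap.id counit t)) ⊗ₜ 1 := by
      intro t
      induction t with
      | zero => simp
      | add s t hs ht => simp only [map_add, TensorProduct.add_tmul, hs, ht]
      | tmul c d => simp [hB.act_one, Algebra.algebraMap_eq_smul_one, TensorProduct.smul_tmul]
    rw [this]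
    have h2 := lTensor_counit_comul (R := k) a
    rw [LinearMap.lTensor] at h2
    simp [h2, mulB_tmul]

theorem one_mulR (x : H ⊗[k] B) : mulR CB (1 ⊗ₜ 1) x = x := by
  rw [mulR_tmul, mulH_one]
  induction x with
  | zero => simp
  | add z w hz hw => simp only [map_add, hz, hw]
  | tmul a x => simp [mulB_tmul]

instance : Ring (Smash hB) where
  mul x y := mulR CB y x
  one := (1 : H) ⊗ₜ[k] (1 : B)
  left_distrib x y z := LinearMap.congr_fun (map_add (mulR CB) y z) x
  right_distrib x y z := map_add (mulR CB z) x y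
  zero_mul x := map_zero (mulR CB x)
  mul_zero x := LinearMap.congr_fun (map_zero (mulR CB)) x
  mul_assoc x y z := mulR_mulR hB x y z
  one_mul x := mulR_one hB x
  mul_one x := one_mulR x
  zsmul := zsmulRec
  neg_add_cancel x := neg_add_cancel x

theorem mul_def (x y : H ⊗[k] B) : of hB x * of hB y = of hB (mulR CB y x) := rfl

theorem one_def : (1 : Smash hB) = of hB (1 ⊗ₜ 1) := rfl

instance : Algebra k (Smash hB) := Algebra.ofModule
  (fun r x y => map_smul (mulR CB y) r x)
  (fun r x y => LinearMap.congr_fun (map_smul (mulR CB) r y) x)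

theorem tmul_mul_tmul (a b : H) (x y : B) : of hB (a ⊗ₜ x) * of hB (b ⊗ₜ y)
    = of hB (TensorProduct.map (LinearMap.mulLeft k a) (LinearMap.mulRight k y ∘ₗ CB.act.flip x)
        (comul b)) := by
  rw [mul_def, mulR_tmul, mulH_tmul]
  congr 1
  induction (comul b : H ⊗[k] H) with
  | zero => simp
  | add z w hz hw => simp only [map_add, hz, hw]
  | tmul a x => simp [mulB_tmul]

/-- The inclusion of `H`. -/
def inH : H →ₐ[k] Smash hB := AlgHom.ofLinearMap
  ((of hB).toLinearMap ∘ₗ (TensorProduct.mk k H B).flip 1) rfl (fun a b => by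
    simp only [LinearMap.comp_apply, LinearMap.flip_apply, TensorProduct.mk_apply,
      LinearEquiv.coe_coe, mul_def, mulR_tmul, EmbeddingLike.apply_eq_iff_eq]
    rw [← mulR_one hB (a ⊗ₜ 1), mulR_tmul, ← mulR_one hB ((a * b) ⊗ₜ 1), mulR_tmul, mulH_mul]
    have : ∀ z : H ⊗[k] B, mulB k H B 1 z = z := by
      intro z
      induction z with
      | zero => simp
      | add z w hz hw => simp only [map_add, hz, hw]
      | tmul a x => simp [mulB_tmul]
    rw [this, this, this])

/-- The inclusion of `B`. -/
def inB : B →ₐ[k] Smash hB := AlgHom.ofLinearMap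
  ((of hB).toLinearMap ∘ₗ TensorProduct.mk k H B 1) rfl (fun x y => by
    simp only [LinearMap.comp_apply, TensorProduct.mk_apply,
      LinearEquiv.coe_coe, mul_def, mulR_tmul, mulH_one, mulB_tmul])

theorem inH_apply (a : H) : inH hB a = of hB (a ⊗ₜ 1) := rfl
theorem inB_apply (x : B) : inB hB x = of hB (1 ⊗ₜ x) := rfl

theorem inH_mul_inB (a : H) (x : B) : inH hB a * inB hB x = of hB (a ⊗ₜ x) := by
  rw [inH_apply, inB_apply, mul_def, mulR_tmul, mulH_one, mulB_tmul, one_mul]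

theorem inH_mul_of (a b : H) (x : B) : inH hB a * of hB (b ⊗ₜ x) = of hB ((a * b) ⊗ₜ x) := by
  rw [← inH_mul_inB, ← mul_assoc, ← map_mul, inH_mul_inB]

/-- The cross relation `x a = a₁ (x ◁ a₂)` between maps on `B` and on `H`. -/
def CrossRel (CB : RightCrossedModule k H B) (f : H →ₗ[k] E) (g : B →ₗ[k] E) (x : B) : Prop :=
  ∀ a, g x * f a = LinearMap.mul' k E (TensorProduct.map f (g ∘ₗ CB.act.flip x) (comul a))

theorem crossRel_inB (x : B) :
    CrossRel CB (inH hB).toLinearMap (inB hB).toLinearMap x := by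
  intro a
  simp only [AlgHom.toLinearMap_apply, inB_apply, inH_apply]
  rw [tmul_mul_tmul]
  induction (comul a : H ⊗[k] H) with
  | zero => simp
  | add z w hz hw => simp only [map_add, hz, hw]
  | tmul a x => simp [inH_mul_inB]

/-- The universal property of the smash product. -/
def lift (f : H →ₐ[k] E) (g : B →ₐ[k] E)
    (h : ∀ x, CrossRel CB f.toLinearMap g.toLinearMap x) : Smash hB →ₐ[k] E :=
  AlgHom.ofLinearMap
    (LinearMap.mul' k E ∘ₗ TensorProduct.map f.toLinearMap g.toLinearMap ∘ₗ
      (of hB).symm.toLinearMap)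
    (by simp [one_def])
    (fun x y => by
      obtain ⟨x, rfl⟩ := (of hB).surjective x
      obtain ⟨y, rfl⟩ := (of hB).surjective y
      induction x with
      | zero => simp
      | add x x' hx hx' => simp only [map_add, add_mul, hx, hx']
      | tmul a x =>
        induction y with
        | zero => simp
        | add x x' hx hx' => simp only [map_add, mul_add, hx, hx']
        | tmul b y =>
          have h1 := h x b
          simp only [AlgHom.toLinearMap_apply] at h1
          rw [tmul_mul_tmul]
          simp only [LinearMap.comp_apply, LinearEquiv.coe_coe, LinearEquiv.symm_apply_apply,
            TensorProduct.map_tmul, LinearMap.mul'_apply, AlgHom.toLinearMap_apply]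
          rw [mul_assoc, ← mul_assoc (g x), h1]
          induction (comul b : H ⊗[k] H) with
          | zero => simp
          | add z w hz hw => simp only [map_add, add_mul, mul_add, hz, hw]
          | tmul a x => simp [mul_assoc])

@[simp] theorem lift_of (f : H →ₐ[k] E) (g : B →ₐ[k] E)
    (h : ∀ x, CrossRel CB f.toLinearMap g.toLinearMap x) (a : H) (x : B) :
    lift hB f g h (of hB (a ⊗ₜ x)) = f a * g x := rfl

@[simp] theorem lift_inH (f : H →ₐ[k] E) (g : B →ₐ[k] E)
    (h : ∀ x, CrossRel CB f.toLinearMap g.toLinearMap x) (a : H) :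
    lift hB f g h (inH hB a) = f a := by
  simp [inH_apply]

@[simp] theorem lift_inB (f : H →ₐ[k] E) (g : B →ₐ[k] E)
    (h : ∀ x, CrossRel CB f.toLinearMap g.toLinearMap x) (x : B) :
    lift hB f g h (inB hB x) = g x := by
  simp [inB_apply]

variable {hB} in
theorem algHom_ext {f g : Smash hB →ₐ[k] E} (h1 : f.comp (inH hB) = g.comp (inH hB))
    (h2 : f.comp (inB hB) = g.comp (inB hB)) : f = g := by
  ext x
  obtain ⟨x, rfl⟩ := (of hB).surjective x
  induction x with
  | zero => simp
  | add x x' hx hx' => simp only [map_add, hx, hx']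
  | tmul a x =>
    have e1 := AlgHom.congr_fun h1 a
    have e2 := AlgHom.congr_fun h2 x
    simp only [AlgHom.comp_apply] at e1 e2
    rw [← inH_mul_inB, map_mul, map_mul, e1, e2]

/-- Written in the convolution algebra, the cross relation says that `f` intertwines two maps of the
variable `x`; in this form it passes to products. -/
theorem crossRel_iff (f : H →ₗ[k] E) (g : B →ₗ[k] E) (x : B) : CrossRel CB f g x ↔
    Convolution.const k H E (g x) * toConv f = toConv f * toConv (g ∘ₗ CB.act.flip x) := by
  constructor
  · intro h
    ext a
    rw [Convolution.const_mul_apply]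
    exact h a
  · intro h a
    have := congrArg (fun F : WithConv (H →ₗ[k] E) => F a) h
    rwa [Convolution.const_mul_apply] at this

include hB in
/-- The cross relation only has to be checked on algebra generators. -/
theorem crossRel_of_generators {V : Type*} [AddCommGroup V] [Module k V] (ι : V →ₗ[k] B)
    (hgen : Algebra.adjoin k (Set.range ι) = ⊤) (f : H →ₐ[k] E) (g : B →ₐ[k] E)
    (h : ∀ v, CrossRel CB f.toLinearMap g.toLinearMap (ι v)) (x : B) :
    CrossRel CB f.toLinearMap g.toLinearMap x := by
  have hx : x ∈ Algebra.adjoin k (Set.range ι) := by rw [hgen]; trivial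
  have hone : toConv (g.toLinearMap ∘ₗ CB.act.flip 1) = 1 := by
    ext a
    simp [hB.act_one]
  induction hx using Algebra.adjoin_induction with
  | mem x hx =>
    obtain ⟨v, rfl⟩ := hx
    exact h v
  | algebraMap r =>
    rw [crossRel_iff, AlgHom.toLinearMap_apply, Algebra.algebraMap_eq_smul_one, map_smul, map_smul,
      map_one, map_one,
      map_smul, LinearMap.comp_smul, toConv_smul, hone, smul_mul_assoc, one_mul, mul_smul_comm,
      mul_one]
  | add x y _ _ hx hy =>
    rw [crossRel_iff] at *
    rw [map_add, map_add, add_mul, hx, hy, map_add, LinearMap.comp_add, toConv_add, mul_add]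
  | mul x y _ _ hx hy =>
    rw [crossRel_iff] at *
    -- Since `B` is a module algebra, `x ↦ (a ↦ g(x ◁ a))` is multiplicative for convolution, and
    -- the relations for `x` and `y` compose.
    have : toConv (g.toLinearMap ∘ₗ CB.act.flip (x * y))
        = toConv (g.toLinearMap ∘ₗ CB.act.flip x) * toConv (g.toLinearMap ∘ₗ CB.act.flip y) := by
      ext a
      simp [hB.act_mul, Convolution.conv_eq, (ℛ k a).convMul_apply]
    simp only [AlgHom.toLinearMap_apply] at *
    rw [this, map_mul, map_mul, mul_assoc, hy, ← mul_assoc, hx, mul_assoc]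

end Smash

/-! ### The convolution algebra of `End W` acting on maps with values in `W`. -/

namespace Convolution

variable {k H W : Type*} [CommRing k] [Ring H] [HopfAlgebra k H] [AddCommGroup W] [Module k W]

/-- The action `(f • g)(a) = f(a₁)(g(a₂))` of the convolution algebra of maps `H → End W` on maps
`H → W`. -/
def endAct (f : H →ₗ[k] Module.End k W) (g : H →ₗ[k] W) : H →ₗ[k] W :=
  TensorProduct.lift LinearMap.id ∘ₗ TensorProduct.map f g ∘ₗ comul

/-- Coassociativity, as for associativity of convolution itself. -/
theorem endAct_conv (f f' : H →ₗ[k] Module.End k W) (g : H →ₗ[k] W) :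
    endAct (conv f f') g = endAct f (endAct f' g) := by
  ext a
  let G : H ⊗[k] (H ⊗[k] H) →ₗ[k] W := TensorProduct.lift LinearMap.id ∘ₗ
    TensorProduct.map f (TensorProduct.lift LinearMap.id ∘ₗ TensorProduct.map f' g)
  have h1 : ∀ t : H ⊗[k] H, TensorProduct.lift LinearMap.id (TensorProduct.map f (endAct f' g) t)
        = G (TensorProduct.map LinearMap.id comul t) := by
    intro t
    induction t with
    | zero => simp
    | add s t hs ht => simp only [map_add, hs, ht]
    | tmul a b => simp [G, endAct]
  have h2 : ∀ t : H ⊗[k] H, TensorProduct.lift LinearMap.id (TensorProduct.map (conv f f') g t)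
        = G (TensorProduct.assoc k H H H (TensorProduct.map comul LinearMap.id t)) := by
    intro t
    induction t with
    | zero => simp
    | add s t hs ht => simp only [map_add, hs, ht]
    | tmul a b =>
      simp only [TensorProduct.map_tmul, conv, LinearMap.comp_apply, TensorProduct.lift.tmul,
        LinearMap.id_apply]
      induction (comul a : H ⊗[k] H) with
      | zero => simp
      | add s t hs ht => simp only [map_add, TensorProduct.add_tmul, LinearMap.add_apply, hs, ht]
      | tmul a a' => simp [G]
  have e1 : endAct (conv f f') g a
      = TensorProduct.lift LinearMap.id (TensorProduct.map (conv f f') g (comul a)) := rfl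
  have e2 : endAct f (endAct f' g) a
      = TensorProduct.lift LinearMap.id (TensorProduct.map f (endAct f' g) (comul a)) := rfl
  rw [e1, e2, h1, h2]
  congr 1
  exact coassoc_apply a

theorem one_endAct (g : H →ₗ[k] W) :
    endAct (1 : WithConv (H →ₗ[k] Module.End k W)).ofConv g = g := by
  ext a
  have h : ∀ t : H ⊗[k] H, TensorProduct.lift LinearMap.id (TensorProduct.map
      (1 : WithConv (H →ₗ[k] Module.End k W)).ofConv g t)
      = g (TensorProduct.lid k H (TensorProduct.map counit LinearMap.id t)) := by
    intro t
    induction t with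
    | zero => simp
    | add s t hs ht => simp only [map_add, hs, ht]
    | tmul a b => simp
  have h2 := rTensor_counit_comul (R := k) a
  rw [LinearMap.rTensor] at h2
  have e : endAct (1 : WithConv (H →ₗ[k] Module.End k W)).ofConv g a
    = TensorProduct.lift LinearMap.id (TensorProduct.map
      (1 : WithConv (H →ₗ[k] Module.End k W)).ofConv g (comul a)) := rfl
  rw [e, h, h2, TensorProduct.lid_tmul, one_smul]

end Convolution

/-! ### The crossed module condition in antipode-free form. -/

namespace RightCrossedModule

variable {k H V : Type*} [CommRing k] [Ring H] [HopfAlgebra k H] [AddCommGroup V] [Module k V]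

/-- Left multiplication of `H` on `V ⊗ H`. -/
def leftMul (k H V : Type*) [CommRing k] [Ring H] [HopfAlgebra k H] [AddCommGroup V] [Module k V] :
    H →ₐ[k] Module.End k (V ⊗[k] H) :=
  AlgHom.ofLinearMap (LinearMap.lTensorHom V ∘ₗ LinearMap.mul k H)
    (by ext; simp) (fun a b => by ext; simp [mul_assoc])

/-- The right action `(v ⊗ b) a = v ◁ a₁ ⊗ b a₂` on `V ⊗ H`, for any linear right action. -/
def diagAct (act : H →ₗ[k] Module.End k V) (w : V ⊗[k] H) : H →ₗ[k] V ⊗[k] H :=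
  TensorProduct.map₂ act.flip (LinearMap.mul k H) w ∘ₗ comul

theorem conv_tensorHom_apply (act : H →ₗ[k] Module.End k V) (a : H) (w : V ⊗[k] H) :
    conv (E := Module.End k (V ⊗[k] H)) (LinearMap.rTensorHom H ∘ₗ act)
      (LinearMap.lTensorHom V ∘ₗ (LinearMap.mul k H).flip) a w = diagAct act w a := by
  simp only [conv, diagAct, LinearMap.comp_apply]
  induction (comul a : H ⊗[k] H) with
  | zero => simp
  | add s t hs ht => simp only [map_add, LinearMap.add_apply, hs, ht]
  | tmul a b =>
    induction w with
    | zero => simp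
    | add s t hs ht =>
      rw [map_add, map_add, LinearMap.add_apply, hs, ht]
    | tmul v c => simp

theorem conv_apply_eq_endAct {W : Type*} [AddCommGroup W] [Module k W]
    (f g : H →ₗ[k] Module.End k W) (a : H) (w : W) :
    conv f g a w = Convolution.endAct f (LinearMap.applyₗ w ∘ₗ g) a := by
  simp only [conv, Convolution.endAct, LinearMap.comp_apply]
  induction (comul a : H ⊗[k] H) with
  | zero => simp
  | add s t hs ht => simp only [map_add, LinearMap.add_apply, hs, ht]
  | tmul a b => simp

/-- The crossed module condition is equivalent to `a₁ (v ◁ a₂)₁ ⊗ (v ◁ a₂)₀ = v₁ a₂ ⊗ v₀ ◁ a₁`. -/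
theorem crossed_iff (act : H →ₗ[k] Module.End k V) (coact : V →ₗ[k] V ⊗[k] H) (v : V) :
    (∀ a, coact (act a v)
      = conv (E := Module.End k (V ⊗[k] H))
        (LinearMap.lTensorHom V ∘ₗ LinearMap.mul k H ∘ₗ HopfAlgebra.antipode k)
        (conv (LinearMap.rTensorHom H ∘ₗ act) (LinearMap.lTensorHom V ∘ₗ (LinearMap.mul k H).flip))
        a (coact v)) ↔
    Convolution.endAct (leftMul k H V).toLinearMap (coact ∘ₗ act.flip v) = diagAct act (coact v)
      := by
  have hs : (LinearMap.lTensorHom V ∘ₗ LinearMap.mul k H ∘ₗ HopfAlgebra.antipode k)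
    = (leftMul k H V).toLinearMap ∘ₗ HopfAlgebra.antipode k := rfl
  have hX : LinearMap.applyₗ (coact v) ∘ₗ (conv (LinearMap.rTensorHom H ∘ₗ act)
      (LinearMap.lTensorHom V ∘ₗ (LinearMap.mul k H).flip)) = diagAct act (coact v) := by
    ext a
    exact conv_tensorHom_apply act a (coact v)
  have hL : (∀ a, coact (act a v)
      = conv (E := Module.End k (V ⊗[k] H))
        (LinearMap.lTensorHom V ∘ₗ LinearMap.mul k H ∘ₗ HopfAlgebra.antipode k)
        (conv (LinearMap.rTensorHom H ∘ₗ act) (LinearMap.lTensorHom V ∘ₗ (LinearMap.mul k H).flip))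
        a (coact v)) ↔ coact ∘ₗ act.flip v
        = Convolution.endAct ((leftMul k H V).toLinearMap ∘ₗ HopfAlgebra.antipode k)
          (diagAct act (coact v)) := by
    rw [LinearMap.ext_iff]
    refine forall_congr' fun a => ?_
    rw [conv_apply_eq_endAct, hX, hs]
    rfl
  rw [hL]
  -- Left multiplication is an algebra map on `H`, so its composite with the antipode is its
  -- convolution inverse; acting with one or the other moves the factor `S(a₁)` across the equation.
  constructor
  · intro h
    rw [h, ← Convolution.endAct_conv, Convolution.conv_eq, Convolution.algHom_mul_antipode,
      Convolution.one_endAct]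
  · intro h
    rw [← h, ← Convolution.endAct_conv, Convolution.conv_eq, Convolution.antipode_mul_algHom,
      Convolution.one_endAct]

theorem leftMul_endAct (C : RightCrossedModule k H V) (v : V) :
    Convolution.endAct (leftMul k H V).toLinearMap (C.coact ∘ₗ C.act.flip v)
      = diagAct C.act (C.coact v) :=
  (crossed_iff C.act C.coact v).1 fun a => C.coact_act a v

/-! ### Crossed module structures determined on algebra generators. -/

section OfGenerators

open Convolution

variable {B : Type*} [Ring B] [Algebra k B] (C : RightCrossedModule k H V) (ι : V →ₗ[k] B)
  (hgen : Algebra.adjoin k (Set.range ι) = ⊤) (α : B →ₐ[k] WithConv (H →ₗ[k] B))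
  (hα : ∀ v a, α (ι v) a = ι (C.act a v)) (β : B →ₐ[k] B ⊗[k] H)
  (hβ : ∀ v, β (ι v) = TensorProduct.map ι LinearMap.id (C.coact v))

/-- The linear action underlying an algebra map to a convolution algebra. -/
def actOfConv : H →ₗ[k] Module.End k B :=
  LinearMap.flip
    { toFun := fun x => (α x).ofConv
      map_add' := fun x y => by rw [map_add]; rfl
      map_smul' := fun c x => by rw [map_smul]; rfl }

theorem actOfConv_apply (a : H) (x : B) : actOfConv α a x = α x a := rfl

/-- The algebra map `x ⊗ b ↦ (a ↦ (x ◁ a) ⊗ b)`. -/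
def rightConv : B ⊗[k] H →ₐ[k] WithConv (H →ₗ[k] B ⊗[k] H) :=
  Algebra.TensorProduct.lift
    ((postcomp H Algebra.TensorProduct.includeLeft).comp α)
    ((const k H (B ⊗[k] H)).comp Algebra.TensorProduct.includeRight)
    (fun x b => by
      change _ = _
      ext a
      simp only [AlgHom.comp_apply]
      rw [mul_const_apply, const_mul_apply]
      simp [postcomp_apply])

theorem rightConv_mul (w : B ⊗[k] H) :
    (rightConv α w * toConv (Algebra.TensorProduct.includeRight : H →ₐ[k] B ⊗[k] H).toLinearMap)
      = toConv (diagAct (actOfConv α) w) := by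
  ext a
  simp only [mul_apply, diagAct, LinearMap.comp_apply]
  induction (comul a : H ⊗[k] H) with
  | zero => simp
  | add s t hs ht => simp only [map_add, hs, ht]
  | tmul a b =>
    induction w with
    | zero => simp
    | add s t hs ht =>
      simp only [TensorProduct.map_tmul, LinearMap.mul'_apply] at hs ht ⊢
      simp only [map_add, WithConv.ofConv_add, LinearMap.add_apply, add_mul, hs, ht]
    | tmul v c =>
      simp only [rightConv, Algebra.TensorProduct.lift_tmul, AlgHom.comp_apply]
      simp only [TensorProduct.map_tmul, LinearMap.mul'_apply, mul_const_apply, postcomp_apply]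
      simp [actOfConv_apply]

theorem mul_postcomp (x : B) :
    (toConv (Algebra.TensorProduct.includeRight : H →ₐ[k] B ⊗[k] H).toLinearMap
        * postcomp H β (α x))
      = toConv (endAct (leftMul k H B).toLinearMap (β.toLinearMap ∘ₗ (actOfConv α).flip x)) := by
  ext a
  simp only [mul_apply, endAct, LinearMap.comp_apply]
  induction (comul a : H ⊗[k] H) with
  | zero => simp
  | add s t hs ht => simp only [map_add, hs, ht]
  | tmul a b =>
    have : ∀ z : B ⊗[k] H, (1 : B) ⊗ₜ[k] a * z = leftMul k H B a z := by
      intro z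
      induction z with
      | zero => simp
      | add s t hs ht => simp only [mul_add, map_add, hs, ht]
      | tmul c d => simp [leftMul]
    simp [postcomp_apply, actOfConv_apply, this]

include hα hβ hgen in
theorem mul_postcomp_eq (x : B) :
    toConv (Algebra.TensorProduct.includeRight : H →ₐ[k] B ⊗[k] H).toLinearMap
        * postcomp H β (α x)
      = rightConv α (β x)
        * toConv (Algebra.TensorProduct.includeRight : H →ₐ[k] B ⊗[k] H).toLinearMap := by
  have hx : x ∈ Algebra.adjoin k (Set.range ι) := by rw [hgen]; trivial
  induction hx using Algebra.adjoin_induction with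
  | mem x hx =>
    obtain ⟨v, rfl⟩ := hx
    have h := C.leftMul_endAct v
    rw [mul_postcomp, rightConv_mul]
    congr 1
    have h1 : endAct (leftMul k H B).toLinearMap (β.toLinearMap ∘ₗ (actOfConv α).flip (ι v))
        = TensorProduct.map ι LinearMap.id
          ∘ₗ endAct (leftMul k H V).toLinearMap (C.coact ∘ₗ C.act.flip v) := by
      ext a
      simp only [endAct, LinearMap.comp_apply]
      induction (comul a : H ⊗[k] H) with
      | zero => simp
      | add s t hs ht => simp only [map_add, hs, ht]
      | tmul a b =>
        simp only [TensorProduct.map_tmul, TensorProduct.lift.tmul, LinearMap.id_apply,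
          LinearMap.comp_apply, LinearMap.flip_apply, actOfConv_apply, hα, AlgHom.toLinearMap_apply,
          hβ]
        induction C.coact (C.act b v) with
        | zero => simp
        | add s t hs ht => simp only [map_add, hs, ht]
        | tmul c d => simp [leftMul]
    have h2 : diagAct (actOfConv α) (β (ι v))
        = TensorProduct.map ι LinearMap.id ∘ₗ diagAct C.act (C.coact v) := by
      ext a
      simp only [diagAct, LinearMap.comp_apply, hβ]
      induction (comul a : H ⊗[k] H) with
      | zero => simp
      | add s t hs ht => simp only [map_add, hs, ht]
      | tmul a b =>
        induction C.coact v with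
        | zero => simp
        | add s t hs ht => simp only [map_add, LinearMap.add_apply, hs, ht]
        | tmul c d => simp [actOfConv_apply, hα]
    rw [h1, h2, h]
  | algebraMap r => simp only [AlgHom.commutes, Algebra.commutes]
  | add x y _ _ hx hy => simp only [map_add, mul_add, add_mul, hx, hy]
  | mul x y _ _ hx hy =>
    simp only [map_mul]
    rw [← mul_assoc, hx, mul_assoc, hy, mul_assoc]

/-- A crossed module structure on an algebra from its values on algebra generators. -/
def ofGenerators : RightCrossedModule k H B where
  act := actOfConv α
  coact := β.toLinearMap
  act_one x := by
    rw [actOfConv_apply]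
    have hx : x ∈ Algebra.adjoin k (Set.range ι) := by rw [hgen]; trivial
    induction hx using Algebra.adjoin_induction with
    | mem x hx =>
      obtain ⟨v, rfl⟩ := hx
      rw [hα, C.act_one]
    | algebraMap r => simp [Algebra.algebraMap_eq_smul_one]
    | add x y _ _ hx hy => rw [map_add, WithConv.ofConv_add, LinearMap.add_apply, hx, hy]
    | mul x y _ _ hx hy =>
      rw [map_mul, mul_apply, Bialgebra.comul_one, Algebra.TensorProduct.one_def,
        TensorProduct.map_tmul, LinearMap.mul'_apply, hx, hy]
  act_mul a b x := by
    simp only [actOfConv_apply]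
    have hx : x ∈ Algebra.adjoin k (Set.range ι) := by rw [hgen]; trivial
    -- A product is acted on by the legs of `Δa` and `Δb`, so the induction hypothesis is needed for
    -- all `a` and `b`.
    induction hx using Algebra.adjoin_induction generalizing a b with
    | mem x hx =>
      obtain ⟨v, rfl⟩ := hx
      rw [hα, hα, hα, C.act_mul]
    | algebraMap r => simp [Algebra.algebraMap_eq_smul_one, mul_smul]
    | add x y _ _ hx hy => simp only [map_add, WithConv.ofConv_add, LinearMap.add_apply, hx, hy]
    | mul x y _ _ hx hy =>
      simp only [map_mul, mul_apply, Bialgebra.comul_mul]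
      induction (comul a : H ⊗[k] H) with
      | zero => simp
      | add s t hs ht =>
        simp only [map_add, add_mul, hs, ht, WithConv.ofConv_add, LinearMap.add_apply]
      | tmul a a' =>
        simp only [TensorProduct.map_tmul, LinearMap.mul'_apply, map_mul, mul_apply]
        induction (comul b : H ⊗[k] H) with
        | zero => simp
        | add s t hs ht => simp only [map_add, mul_add, hs, ht]
        | tmul b b' => simp [hx, hy]
  coact_coassoc x := by
    have : ((Algebra.TensorProduct.assoc k k k B H H).toAlgHom.comp
        (Algebra.TensorProduct.map β (AlgHom.id k H))).comp β
      = (Algebra.TensorProduct.map (AlgHom.id k B) (Bialgebra.comulAlgHom k H)).comp β := by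
      refine AlgHom.ext_of_adjoin_eq_top hgen ?_
      rintro _ ⟨v, rfl⟩
      simp only [AlgHom.comp_apply, hβ]
      have h1 : ∀ z : V ⊗[k] H, (Algebra.TensorProduct.map (AlgHom.id k B)
          (Bialgebra.comulAlgHom k H)) (TensorProduct.map ι LinearMap.id z)
          = TensorProduct.map ι LinearMap.id (TensorProduct.map LinearMap.id comul z) := by
        intro z
        induction z with
        | zero => simp
        | add s t hs ht => simp only [map_add, hs, ht]
        | tmul c d => simp
      rw [h1, ← C.coact_coassoc]
      induction C.coact v with
      | zero => simp
      | add s t hs ht => simp only [map_add, hs, ht]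
      | tmul c d =>
        simp only [TensorProduct.map_tmul, Algebra.TensorProduct.map_tmul, hβ, LinearMap.id_apply]
        induction C.coact c with
        | zero => simp
        | add s t hs ht => simp only [map_add, TensorProduct.add_tmul, hs, ht]
        | tmul c d => simp
    exact AlgHom.congr_fun this x
  coact_counit x := by
    have : ((Algebra.TensorProduct.rid k k B).toAlgHom.comp
        (Algebra.TensorProduct.map (AlgHom.id k B) (Bialgebra.counitAlgHom k H))).comp β
      = AlgHom.id k B := by
      refine AlgHom.ext_of_adjoin_eq_top hgen ?_
      rintro _ ⟨v, rfl⟩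
      simp only [AlgHom.comp_apply, hβ, AlgHom.id_apply]
      conv_rhs => rw [← C.coact_counit v]
      induction C.coact v with
      | zero => simp
      | add s t hs ht => simp only [map_add, hs, ht]
      | tmul c d => simp
    exact AlgHom.congr_fun this x
  coact_act a x := by
    revert a
    rw [crossed_iff]
    apply WithConv.toConv_injective
    rw [← mul_postcomp]
    refine (mul_postcomp_eq C ι hgen α hα β hβ x).trans ?_
    exact rightConv_mul α _

theorem isCrossedAlg_ofGenerators : IsCrossedAlg (ofGenerators C ι hgen α hα β hβ) where
  act_one a := by
    change α 1 a = _
    rw [map_one, LinearMap.convOne_apply]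
  act_mul a x y := by
    change α (x * y) a = _
    rw [map_mul]
    rfl
  coact_one := map_one β
  coact_mul := map_mul β

end OfGenerators

end RightCrossedModule

namespace Smash

open Convolution RightCrossedModule

variable {k H B : Type*} [CommRing k] [Ring H] [HopfAlgebra k H] [Ring B]
    [Algebra k B] {CB : RightCrossedModule k H B} (hB : IsCrossedAlg CB)

/-! ### The right action of the smash product on `B` -/

/-- The right action of the smash product on `B`, `b (h ⊗ x) = (b ◁ h) x`. -/
def actHom : Smash hB →ₐ[k] (Module.End k B)ᵐᵒᵖ :=
  lift hB
    (AlgHom.ofLinearMap ((MulOpposite.opLinearEquiv k).toLinearMap ∘ₗ CB.act)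
      (by
        apply MulOpposite.unop_injective
        ext x
        exact CB.act_one x)
      (fun a b => by
        apply MulOpposite.unop_injective
        ext x
        exact CB.act_mul a b x))
    (AlgHom.ofLinearMap ((MulOpposite.opLinearEquiv k).toLinearMap ∘ₗ (LinearMap.mul k B).flip)
      (by
        apply MulOpposite.unop_injective
        ext x
        exact mul_one x)
      (fun a b => by
        apply MulOpposite.unop_injective
        ext x
        exact (mul_assoc x a b).symm))
    (fun x a => by
      apply MulOpposite.unop_injective
      ext y
      refine (hB.act_mul a y x).trans ?_
      simp only [conv, LinearMap.comp_apply]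
      induction (comul a : H ⊗[k] H) with
      | zero => simp
      | add s t hs ht => simp only [map_add, hs, ht, MulOpposite.unop_add, LinearMap.add_apply]
      | tmul a a' => simp)

/-- The right action of the smash product on `B`. -/
def ract : B →ₗ[k] Smash hB →ₗ[k] B :=
  ((MulOpposite.opLinearEquiv k).symm.toLinearMap ∘ₗ (actHom hB).toLinearMap).flip

theorem ract_of (b : B) (h : H) (x : B) : ract hB b (of hB (h ⊗ₜ x)) = CB.act h b * x := rfl

theorem ract_mul (b : B) (w w' : Smash hB) : ract hB b (w * w') = ract hB (ract hB b w) w' := by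
  simp [ract]

theorem ract_one (b : B) : ract hB b 1 = b := by
  simp [ract]

theorem ract_inB (b x : B) : ract hB b (inB hB x) = b * x := by
  rw [inB_apply, ract_of, CB.act_one]

theorem ract_inH (b : B) (a : H) : ract hB b (inH hB a) = CB.act a b := by
  rw [inH_apply, ract_of, mul_one]

/-- The projection `h ⊗ x ↦ ε(h) x`. -/
def proj : Smash hB →ₗ[k] B := ract hB 1

theorem proj_of (h : H) (x : B) : proj hB (of hB (h ⊗ₜ x)) = counit (R := k) h • x := by
  rw [proj, ract_of, hB.act_one, Algebra.smul_def]

theorem proj_mul (w w' : Smash hB) : proj hB (w * w') = ract hB (proj hB w) w' :=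
  ract_mul hB 1 w w'

theorem proj_inB (x : B) : proj hB (inB hB x) = x := by rw [proj, ract_inB, one_mul]

theorem proj_inH_mul (a : H) (w : Smash hB) :
    proj hB (inH hB a * w) = counit (R := k) a • proj hB w := by
  rw [proj_mul, proj, ract_inH, hB.act_one, Algebra.algebraMap_eq_smul_one, map_smul]
  rfl

/-- The right action of the tensor square of the smash product on `B ⊗ B`. -/
def ract₂ : B ⊗[k] B →ₗ[k] (Smash hB ⊗[k] Smash hB) →ₗ[k] B ⊗[k] B :=
  TensorProduct.map₂ (ract hB) (ract hB)

theorem ract₂_mul (z : B ⊗[k] B) (w w' : Smash hB ⊗[k] Smash hB) :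
    ract₂ hB z (w * w') = ract₂ hB (ract₂ hB z w) w' := by
  induction z with
  | zero => simp
  | add z z' hz hz' => simp only [map_add, LinearMap.add_apply, hz, hz']
  | tmul p q =>
    induction w with
    | zero => simp
    | add z z' hz hz' => simp only [map_add, LinearMap.add_apply, add_mul, hz, hz']
    | tmul x y =>
      induction w' with
      | zero => simp
      | add z z' hz hz' => simp only [map_add, mul_add, hz, hz']
      | tmul x' y' => simp [ract₂, ract_mul]

theorem map_proj (w : Smash hB ⊗[k] Smash hB) :
    TensorProduct.map (proj hB) (proj hB) w = ract₂ hB (1 ⊗ₜ 1) w := rfl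

theorem map_proj_mul (w w' : Smash hB ⊗[k] Smash hB) :
    TensorProduct.map (proj hB) (proj hB) (w * w')
      = ract₂ hB (TensorProduct.map (proj hB) (proj hB) w) w' := by
  rw [map_proj, map_proj, ract₂_mul]

/-! ### The coproduct -/

/-- The coproduct of the smash product on `H`. -/
def comulH : H →ₐ[k] Smash hB ⊗[k] Smash hB :=
  (Algebra.TensorProduct.map (inH hB) (inH hB)).comp (Bialgebra.comulAlgHom k H)

/-- The coproduct of the smash product on a braided primitive element,
`x ↦ x₀ ⊗ x₁ + 1 ⊗ x`. -/
def primComul (x : B) : Smash hB ⊗[k] Smash hB :=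
  TensorProduct.map (inB hB).toLinearMap (inH hB).toLinearMap (CB.coact x) + 1 ⊗ₜ inB hB x

section CrossRelation

local notation "Ω₂" => Smash hB ⊗[k] Smash hB

/-- Splitting `a₁ ⊗ a₂` into a convolution product of the two leg embeddings lets an element be
moved past one leg at a time. -/
theorem comulH_conv : toConv (comulH hB).toLinearMap
    = toConv ((Algebra.TensorProduct.includeLeft : Smash hB →ₐ[k] Ω₂).comp (inH hB)).toLinearMap
      * toConv ((Algebra.TensorProduct.includeRight : Smash hB →ₐ[k] Ω₂).comp
        (inH hB)).toLinearMap := by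
  ext a
  rw [mul_apply]
  simp only [comulH, AlgHom.toLinearMap_apply, AlgHom.comp_apply, Bialgebra.comulAlgHom_apply]
  induction (comul a : H ⊗[k] H) with
  | zero => simp
  | add s t hs ht => simp only [map_add, hs, ht]
  | tmul a a' => simp

theorem const_mul_left (y : B) :
    const k H Ω₂ (inB hB y ⊗ₜ 1)
      * toConv ((Algebra.TensorProduct.includeLeft : Smash hB →ₐ[k] Ω₂).comp (inH hB)).toLinearMap
    = toConv ((Algebra.TensorProduct.includeLeft : Smash hB →ₐ[k] Ω₂).comp (inH hB)).toLinearMap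
      * toConv ((Algebra.TensorProduct.includeLeft : Smash hB →ₐ[k] Ω₂).toLinearMap
        ∘ₗ (inB hB).toLinearMap ∘ₗ CB.act.flip y) := by
  have h := congrArg (postcomp H (Algebra.TensorProduct.includeLeft : Smash hB →ₐ[k] Ω₂))
    ((crossRel_iff _ _ _).1 (crossRel_inB hB y))
  rw [map_mul, map_mul] at h
  convert h using 2
  · ext a
    simp [postcomp_apply, const_apply, TensorProduct.smul_tmul']
  all_goals rfl

theorem const_mul_right (y : B) :
    const k H Ω₂ (1 ⊗ₜ inB hB y)
      * toConv ((Algebra.TensorProduct.includeRight : Smash hB →ₐ[k] Ω₂).comp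
          (inH hB)).toLinearMap
    = toConv ((Algebra.TensorProduct.includeRight : Smash hB →ₐ[k] Ω₂).comp (inH hB)).toLinearMap
      * toConv ((Algebra.TensorProduct.includeRight : Smash hB →ₐ[k] Ω₂).toLinearMap
        ∘ₗ (inB hB).toLinearMap ∘ₗ CB.act.flip y) := by
  have h := congrArg (postcomp H (Algebra.TensorProduct.includeRight : Smash hB →ₐ[k] Ω₂))
    ((crossRel_iff _ _ _).1 (crossRel_inB hB y))
  rw [map_mul, map_mul] at h
  convert h using 2
  · ext a
    simp [postcomp_apply, const_apply]
  all_goals rfl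

theorem const_right_comm (w : Smash hB) (f : H →ₗ[k] Smash hB) :
    const k H Ω₂ (1 ⊗ₜ w)
      * toConv ((Algebra.TensorProduct.includeLeft : Smash hB →ₐ[k] Ω₂).toLinearMap ∘ₗ f)
    = toConv ((Algebra.TensorProduct.includeLeft : Smash hB →ₐ[k] Ω₂).toLinearMap ∘ₗ f)
      * const k H Ω₂ (1 ⊗ₜ w) := by
  ext a
  rw [const_mul_apply, mul_const_apply]
  simp

/-- In Sweedler notation, `(y ⊗ b)(a₁ ⊗ a₂) = a₁(y ◁ a₂) ⊗ b a₃`: the leg `b` does not meet the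
first leg of `Δa`, and `y` crosses it by the cross relation. -/
theorem const_coact_mul (z : B ⊗[k] H) :
    const k H Ω₂ (TensorProduct.map (inB hB).toLinearMap (inH hB).toLinearMap z)
      * toConv (comulH hB).toLinearMap
    = toConv ((Algebra.TensorProduct.includeLeft : Smash hB →ₐ[k] Ω₂).comp (inH hB)).toLinearMap
      * toConv (TensorProduct.map (inB hB).toLinearMap (inH hB).toLinearMap
        ∘ₗ diagAct CB.act z) := by
  induction z with
  | zero => simp [diagAct]
  | add s t hs ht =>
    have : diagAct CB.act (s + t) = diagAct CB.act s + diagAct CB.act t := by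
      ext a
      simp [diagAct]
    rw [map_add, map_add, add_mul, hs, ht, this, LinearMap.comp_add, toConv_add, mul_add]
  | tmul y b =>
    have h1 : TensorProduct.map (inB hB).toLinearMap (inH hB).toLinearMap (y ⊗ₜ b)
        = (inB hB y ⊗ₜ[k] (1 : Smash hB)) * ((1 : Smash hB) ⊗ₜ[k] inH hB b) := by simp
    rw [h1, map_mul, comulH_conv, ← mul_assoc, mul_assoc (const k H Ω₂ _)]
    have h2 := const_right_comm hB (inH hB b) (inH hB).toLinearMap
    rw [AlgHom.comp_toLinearMap, h2, ← mul_assoc, ← AlgHom.comp_toLinearMap, const_mul_left,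
      mul_assoc, mul_assoc]
    congr 1
    ext a
    rw [mul_apply]
    simp only [diagAct, LinearMap.comp_apply]
    induction (comul a : H ⊗[k] H) with
    | zero => simp
    | add s t hs ht => simp only [map_add, hs, ht]
    | tmul c d =>
      rw [TensorProduct.map_tmul, LinearMap.mul'_apply, const_mul_apply]
      simp

/-- This is where the crossed module condition makes the coproduct multiplicative. Moving `Δa` past
`x₀ ⊗ x₁` produces `a₁(x₀ ◁ a₂) ⊗ x₁a₃`, and `leftMul_endAct` rewrites it as `a₁(x ◁ a₃)₀ ⊗ a₂(x ◁
a₃)₁`. The summand `1 ⊗ x` only crosses the second leg. -/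
theorem crossRel_primComul (g : B →ₗ[k] Ω₂) (x : B) (hx : g x = primComul hB x)
    (hxa : ∀ a, g (CB.act a x) = primComul hB (CB.act a x)) :
    CrossRel CB (comulH hB).toLinearMap g x := by
  rw [crossRel_iff, hx]
  have h0 : g ∘ₗ CB.act.flip x
      = TensorProduct.map (inB hB).toLinearMap (inH hB).toLinearMap ∘ₗ CB.coact ∘ₗ CB.act.flip x
        + (Algebra.TensorProduct.includeRight : Smash hB →ₐ[k] Ω₂).toLinearMap
        ∘ₗ (inB hB).toLinearMap ∘ₗ CB.act.flip x := by
    ext a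
    simp [hxa, primComul]
  rw [h0, primComul, map_add, add_mul, const_coact_mul, toConv_add, mul_add]
  congr 1
  · rw [comulH_conv, mul_assoc]
    congr 1
    rw [← CB.leftMul_endAct x]
    ext a
    rw [mul_apply]
    simp only [endAct, LinearMap.comp_apply]
    induction (comul a : H ⊗[k] H) with
    | zero => simp
    | add s t hs ht => simp only [map_add, hs, ht]
    | tmul c d =>
      simp only [TensorProduct.map_tmul, TensorProduct.lift.tmul, LinearMap.comp_apply,
        LinearMap.id_apply, LinearMap.mul'_apply]
      induction CB.coact (CB.act.flip x d) with
      | zero => simp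
      | add s t hs ht => simp only [map_add, mul_add, hs, ht]
      | tmul e f => simp [leftMul]
  · rw [comulH_conv, ← mul_assoc, AlgHom.comp_toLinearMap, const_right_comm,
      ← AlgHom.comp_toLinearMap, mul_assoc, const_mul_right, ← mul_assoc]

end CrossRelation

end Smash

/-! ### Smash product bialgebras of primitively generated algebras. -/

namespace Smash

open Convolution RightCrossedModule

/-- `B` is generated as an algebra by the crossed module `V`, on which `g` is the primitive coproduct
into the tensor square of the smash product, and `ε` vanishes. -/
structure PrimGen {k H B V : Type*} [CommRing k] [Ring H] [HopfAlgebra k H] [Ring B]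
    [Algebra k B] [AddCommGroup V] [Module k V] {CB : RightCrossedModule k H B}
    (hB : IsCrossedAlg CB) (C : RightCrossedModule k H V) (ι : V →ₗ[k] B)
    (g : B →ₐ[k] Smash hB ⊗[k] Smash hB) (ε : B →ₐ[k] k) : Prop where
  adjoin : Algebra.adjoin k (Set.range ι) = ⊤
  act_ι : ∀ a v, CB.act a (ι v) = ι (C.act a v)
  coact_ι : ∀ v, CB.coact (ι v) = TensorProduct.map ι LinearMap.id (C.coact v)
  g_ι : ∀ v, g (ι v) = primComul hB (ι v)
  ε_ι : ∀ v, ε (ι v) = 0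

namespace PrimGen

variable {k H B V : Type*} [CommRing k] [Ring H] [HopfAlgebra k H] [Ring B]
    [Algebra k B] [AddCommGroup V] [Module k V] {CB : RightCrossedModule k H B}
    {hB : IsCrossedAlg CB} {C : RightCrossedModule k H V} {ι : V →ₗ[k] B}
    {g : B →ₐ[k] Smash hB ⊗[k] Smash hB} {ε : B →ₐ[k] k} (P : PrimGen hB C ι g ε)

include P

theorem g_ι' (v : V) : g (ι v) = TensorProduct.map ((inB hB).toLinearMap ∘ₗ ι)
    (inH hB).toLinearMap (C.coact v) + 1 ⊗ₜ inB hB (ι v) := by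
  rw [P.g_ι, primComul, P.coact_ι]
  congr 1
  induction C.coact v with
  | zero => simp
  | add s t hs ht => simp only [map_add, hs, ht]
  | tmul a b => simp

theorem crossRel_g (x : B) : CrossRel CB (comulH hB).toLinearMap g.toLinearMap x := by
  refine crossRel_of_generators hB ι P.adjoin _ g (fun v => ?_) x
  refine crossRel_primComul hB g.toLinearMap (ι v) (P.g_ι v) (fun a => ?_)
  rw [P.act_ι]
  exact P.g_ι _

theorem crossRel_ε (x : B) :
    CrossRel CB (Bialgebra.counitAlgHom k H).toLinearMap ε.toLinearMap x := by
  refine crossRel_of_generators hB ι P.adjoin _ ε (fun v a => ?_) x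
  have : ε.toLinearMap ∘ₗ CB.act.flip (ι v) = 0 := by
    ext a
    simp [P.act_ι, P.ε_ι]
  rw [this]
  simp [P.ε_ι]

theorem crossRel_projH (x : B) :
    CrossRel CB (AlgHom.id k H).toLinearMap ((Algebra.ofId k H).comp ε).toLinearMap x := by
  refine crossRel_of_generators hB ι P.adjoin _ _ (fun v a => ?_) x
  have : ((Algebra.ofId k H).comp ε).toLinearMap ∘ₗ CB.act.flip (ι v) = 0 := by
    ext a
    simp [P.act_ι, P.ε_ι]
  rw [this]
  simp [P.ε_ι]

/-- The coproduct of the smash product. -/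
def comulHom : Smash hB →ₐ[k] Smash hB ⊗[k] Smash hB := lift hB (comulH hB) g P.crossRel_g

/-- The counit of the smash product. -/
def counitHom : Smash hB →ₐ[k] k := lift hB (Bialgebra.counitAlgHom k H) ε P.crossRel_ε

/-- The projection `id ⊗ ε` of the smash product onto `H`. -/
def projH : Smash hB →ₐ[k] H :=
  lift hB (AlgHom.id k H) ((Algebra.ofId k H).comp ε) P.crossRel_projH

theorem comulHom_inH (a : H) : P.comulHom (inH hB a) = comulH hB a := lift_inH ..
theorem comulHom_inB (x : B) : P.comulHom (inB hB x) = g x := lift_inB ..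
theorem counitHom_inH (a : H) : P.counitHom (inH hB a) = counit (R := k) a := lift_inH ..
theorem counitHom_inB (x : B) : P.counitHom (inB hB x) = ε x := lift_inB ..
theorem projH_inH (a : H) : P.projH (inH hB a) = a := lift_inH ..
theorem projH_inB (x : B) : P.projH (inB hB x) = algebraMap k H (ε x) := lift_inB ..

theorem algHom_ext {E : Type*} [Ring E] [Algebra k E] {f f' : Smash hB →ₐ[k] E}
    (h1 : ∀ a, f (inH hB a) = f' (inH hB a)) (h2 : ∀ v, f (inB hB (ι v)) = f' (inB hB (ι v))) :
    f = f' := by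
  apply Smash.algHom_ext
  · ext a
    exact h1 a
  · refine AlgHom.ext_of_adjoin_eq_top P.adjoin ?_
    rintro _ ⟨v, rfl⟩
    exact h2 v

/-- Both sides are algebra maps. On `H` the identity is coassociativity of `H`, and on the
generators `V` it is coassociativity of the coaction. -/
theorem coassoc :
    ((Algebra.TensorProduct.assoc k k k (Smash hB) (Smash hB) (Smash hB)).toAlgHom.comp
      (Algebra.TensorProduct.map P.comulHom (AlgHom.id k _))).comp P.comulHom
      = (Algebra.TensorProduct.map (AlgHom.id k _) P.comulHom).comp P.comulHom := by
  apply P.algHom_ext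
  · intro a
    simp only [AlgHom.comp_apply, comulHom_inH, comulH, Bialgebra.comulAlgHom_apply]
    let F : H ⊗[k] (H ⊗[k] H) →ₗ[k] Smash hB ⊗[k] (Smash hB ⊗[k] Smash hB) :=
      TensorProduct.map (inH hB).toLinearMap
        (TensorProduct.map (inH hB).toLinearMap (inH hB).toLinearMap)
    have h1 : ∀ t : H ⊗[k] H, (Algebra.TensorProduct.map (AlgHom.id k _) P.comulHom)
        (Algebra.TensorProduct.map (inH hB) (inH hB) t)
        = F (TensorProduct.map LinearMap.id comul t) := by
      intro t
      induction t with
      | zero => simp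
      | add s t hs ht => simp only [map_add, hs, ht]
      | tmul a b =>
        simp only [Algebra.TensorProduct.map_tmul, AlgHom.id_apply, comulHom_inH, comulH, F,
          TensorProduct.map_tmul, AlgHom.comp_apply, LinearMap.id_apply]
        rfl
    have h2 : ∀ t : H ⊗[k] H, (Algebra.TensorProduct.assoc k k k _ _ _).toAlgHom
        ((Algebra.TensorProduct.map P.comulHom (AlgHom.id k _))
        (Algebra.TensorProduct.map (inH hB) (inH hB) t))
        = F (TensorProduct.assoc k H H H (TensorProduct.map comul LinearMap.id t)) := by
      intro t
      induction t with
      | zero => simp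
      | add s t hs ht => simp only [map_add, hs, ht]
      | tmul a b =>
        simp only [Algebra.TensorProduct.map_tmul, AlgHom.id_apply, comulHom_inH, comulH, F,
          TensorProduct.map_tmul, AlgHom.comp_apply, LinearMap.id_apply,
          Bialgebra.comulAlgHom_apply]
        induction (comul a : H ⊗[k] H) with
        | zero => simp
        | add s t hs ht => simp only [map_add, TensorProduct.add_tmul, hs, ht]
        | tmul a b => simp
    rw [h1, h2]
    congr 1
    exact coassoc_apply a
  · intro v
    simp only [AlgHom.comp_apply, comulHom_inB, P.g_ι']
    let F : V ⊗[k] (H ⊗[k] H) →ₗ[k] Smash hB ⊗[k] (Smash hB ⊗[k] Smash hB) :=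
      TensorProduct.map ((inB hB).toLinearMap ∘ₗ ι)
        (TensorProduct.map (inH hB).toLinearMap (inH hB).toLinearMap)
    have h1 : ∀ t : V ⊗[k] H, (Algebra.TensorProduct.map (AlgHom.id k _) P.comulHom)
        (TensorProduct.map ((inB hB).toLinearMap ∘ₗ ι) (inH hB).toLinearMap t)
        = F (TensorProduct.map LinearMap.id comul t) := by
      intro t
      induction t with
      | zero => simp
      | add s t hs ht => simp only [map_add, hs, ht]
      | tmul a b =>
        simp only [Algebra.TensorProduct.map_tmul, AlgHom.id_apply, comulHom_inH, comulH, F,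
          TensorProduct.map_tmul, AlgHom.comp_apply, LinearMap.id_apply, AlgHom.toLinearMap_apply]
        rfl
    have h2 : ∀ t : V ⊗[k] H, (Algebra.TensorProduct.assoc k k k _ _ _).toAlgHom
        ((Algebra.TensorProduct.map P.comulHom (AlgHom.id k _))
        (TensorProduct.map ((inB hB).toLinearMap ∘ₗ ι) (inH hB).toLinearMap t))
        = F (TensorProduct.assoc k V H H (TensorProduct.map C.coact LinearMap.id t))
          + 1 ⊗ₜ TensorProduct.map ((inB hB).toLinearMap ∘ₗ ι) (inH hB).toLinearMap t := by
      intro t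
      induction t with
      | zero => simp
      | add s t hs ht => simp only [map_add, TensorProduct.tmul_add, hs, ht]; abel
      | tmul a b =>
        simp only [Algebra.TensorProduct.map_tmul, AlgHom.id_apply, comulHom_inB, P.g_ι', F,
          TensorProduct.map_tmul, LinearMap.comp_apply, LinearMap.id_apply, TensorProduct.add_tmul,
          map_add, AlgHom.toLinearMap_apply]
        congr 1
        induction C.coact a with
        | zero => simp
        | add s t hs ht => simp only [map_add, TensorProduct.add_tmul, hs, ht]
        | tmul a b => simp
    rw [map_add, map_add, map_add, h1, h2, C.coact_coassoc]
    simp only [Algebra.TensorProduct.map_tmul, AlgHom.id_apply, comulHom_inB, P.g_ι', map_one,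
      TensorProduct.tmul_add, Algebra.TensorProduct.one_def]
    simp [add_assoc]

theorem counit_left : ((Algebra.TensorProduct.lid k (Smash hB)).toAlgHom.comp
    (Algebra.TensorProduct.map P.counitHom (AlgHom.id k _))).comp P.comulHom = AlgHom.id k _ := by
  apply P.algHom_ext
  · intro a
    simp only [AlgHom.comp_apply, comulHom_inH, comulH, Bialgebra.comulAlgHom_apply,
      AlgHom.id_apply]
    have h : ∀ t : H ⊗[k] H, (Algebra.TensorProduct.lid k (Smash hB)).toAlgHom
        ((Algebra.TensorProduct.map P.counitHom (AlgHom.id k _))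
        (Algebra.TensorProduct.map (inH hB) (inH hB) t))
        = inH hB (TensorProduct.lid k H (TensorProduct.map counit LinearMap.id t)) := by
      intro t
      induction t with
      | zero => simp
      | add s t hs ht => simp only [map_add, hs, ht]
      | tmul a b => simp [counitHom_inH]
    rw [h]
    have h2 := rTensor_counit_comul (R := k) a
    rw [LinearMap.rTensor] at h2
    rw [h2, TensorProduct.lid_tmul, one_smul]
  · intro v
    simp only [AlgHom.comp_apply, comulHom_inB, P.g_ι', AlgHom.id_apply, map_add]
    have h : ∀ t : V ⊗[k] H, (Algebra.TensorProduct.lid k (Smash hB)).toAlgHom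
        ((Algebra.TensorProduct.map P.counitHom (AlgHom.id k _))
        (TensorProduct.map ((inB hB).toLinearMap ∘ₗ ι) (inH hB).toLinearMap t)) = 0 := by
      intro t
      induction t with
      | zero => simp
      | add s t hs ht => simp only [map_add, hs, ht, add_zero]
      | tmul a b => simp [counitHom_inB, P.ε_ι]
    rw [h]
    simp

theorem counit_right : ((Algebra.TensorProduct.rid k k (Smash hB)).toAlgHom.comp
    (Algebra.TensorProduct.map (AlgHom.id k _) P.counitHom)).comp P.comulHom = AlgHom.id k _ := by
  apply P.algHom_ext
  · intro a
    simp only [AlgHom.comp_apply, comulHom_inH, comulH, Bialgebra.comulAlgHom_apply,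
      AlgHom.id_apply]
    have h : ∀ t : H ⊗[k] H, (Algebra.TensorProduct.rid k k (Smash hB)).toAlgHom
        ((Algebra.TensorProduct.map (AlgHom.id k _) P.counitHom)
        (Algebra.TensorProduct.map (inH hB) (inH hB) t))
        = inH hB (TensorProduct.rid k H (TensorProduct.map LinearMap.id counit t)) := by
      intro t
      induction t with
      | zero => simp
      | add s t hs ht => simp only [map_add, hs, ht]
      | tmul a b => simp [counitHom_inH]
    rw [h]
    have h2 := lTensor_counit_comul (R := k) a
    rw [LinearMap.lTensor] at h2
    rw [h2, TensorProduct.rid_tmul, one_smul]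
  · intro v
    simp only [AlgHom.comp_apply, comulHom_inB, P.g_ι', AlgHom.id_apply, map_add]
    have h : ∀ t : V ⊗[k] H, (Algebra.TensorProduct.rid k k (Smash hB)).toAlgHom
        ((Algebra.TensorProduct.map (AlgHom.id k _) P.counitHom)
        (TensorProduct.map ((inB hB).toLinearMap ∘ₗ ι) (inH hB).toLinearMap t))
        = inB hB (ι (TensorProduct.rid k V (TensorProduct.map LinearMap.id counit t))) := by
      intro t
      induction t with
      | zero => simp
      | add s t hs ht => simp only [map_add, hs, ht]
      | tmul a b => simp [counitHom_inH]
    rw [h, C.coact_counit]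
    simp [counitHom_inB, P.ε_ι]

/-! ### The braided coproduct of `B` -/

omit P in
/-- The braided coproduct of `B`. -/
def bcomul (g : B →ₐ[k] Smash hB ⊗[k] Smash hB) : B →ₗ[k] B ⊗[k] B :=
  TensorProduct.map (proj hB) (proj hB) ∘ₗ g.toLinearMap

omit P in
theorem bcomul_one : bcomul g 1 = 1 ⊗ₜ 1 := by
  simp [bcomul, Algebra.TensorProduct.one_def, proj, ract_one]

omit P in
theorem bcomul_eq (x : B) : bcomul g x = ract₂ hB (1 ⊗ₜ 1) (g x) := rfl

omit P in
-- This is the multiplicativity of the braided coproduct. The braided tensor product algebra need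
-- not be constructed: its multiplication by `Δy` is the right action of `g y` on `B ⊗ B`.
theorem bcomul_mul (x y : B) : bcomul g (x * y) = ract₂ hB (bcomul g x) (g y) := by
  rw [bcomul_eq, bcomul_eq, map_mul, ract₂_mul]

/-- The projection applies the counit to the factor from `H`, and the counit on both legs of `Δh` is
`ε(h)`. Coassociativity and counit axioms of the smash product thereby descend to `B`. -/
theorem bcomul_proj (w : Smash hB) :
    bcomul g (proj hB w) = TensorProduct.map (proj hB) (proj hB) (P.comulHom w) := by
  obtain ⟨w, rfl⟩ := (of hB).surjective w
  induction w with
  | zero => simp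
  | add s t hs ht => simp only [map_add, hs, ht]
  | tmul h x =>
    rw [proj_of, map_smul, ← inH_mul_inB, map_mul, comulHom_inH, comulHom_inB]
    have h1 : ∀ (t : H ⊗[k] H) (z : Smash hB ⊗[k] Smash hB),
        TensorProduct.map (proj hB) (proj hB) (Algebra.TensorProduct.map (inH hB) (inH hB) t * z)
        = (TensorProduct.lid k k (TensorProduct.map counit counit t))
          • TensorProduct.map (proj hB) (proj hB) z := by
      intro t z
      induction t with
      | zero => simp
      | add s t hs ht => simp only [map_add, add_mul, add_smul, hs, ht]
      | tmul a b =>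
        induction z with
        | zero => simp
        | add s t hs ht => simp only [map_add, mul_add, smul_add, hs, ht]
        | tmul c d => simp [proj_inH_mul, TensorProduct.smul_tmul', smul_smul, mul_comm]
    have h2 : ∀ t : H ⊗[k] H, (TensorProduct.lid k k (TensorProduct.map counit counit t))
        = counit (R := k) (TensorProduct.lid k H (TensorProduct.map counit LinearMap.id t)) := by
      intro t
      induction t with
      | zero => simp
      | add s t hs ht => simp only [map_add, hs, ht]
      | tmul a b => simp
    have h3 := rTensor_counit_comul (R := k) h
    rw [LinearMap.rTensor] at h3
    rw [comulH, AlgHom.comp_apply, h1, h2, Bialgebra.comulAlgHom_apply, h3, TensorProduct.lid_tmul,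
      one_smul]
    rfl

theorem bcomul_coassoc (x : B) : TensorProduct.assoc k B B B
    (TensorProduct.map (bcomul g) LinearMap.id (bcomul g x))
      = TensorProduct.map LinearMap.id (bcomul g) (bcomul g x) := by
  have h := congrArg (TensorProduct.map (proj hB) (TensorProduct.map (proj hB) (proj hB)))
    (AlgHom.congr_fun P.coassoc (inB hB x))
  simp only [AlgHom.comp_apply, comulHom_inB] at h
  have h1 : ∀ t : Smash hB ⊗[k] Smash hB, TensorProduct.map (proj hB) (TensorProduct.map (proj hB)
      (proj hB)) ((Algebra.TensorProduct.map (AlgHom.id k _) P.comulHom) t)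
      = TensorProduct.map LinearMap.id (bcomul g)
        (TensorProduct.map (proj hB) (proj hB) t) := by
    intro t
    induction t with
    | zero => simp
    | add s t hs ht => simp only [map_add, hs, ht]
    | tmul a b => simp [P.bcomul_proj]
  have h2 : ∀ t : Smash hB ⊗[k] Smash hB, TensorProduct.map (proj hB) (TensorProduct.map (proj hB)
      (proj hB)) ((Algebra.TensorProduct.assoc k k k _ _ _).toAlgHom
        ((Algebra.TensorProduct.map P.comulHom (AlgHom.id k _)) t))
      = TensorProduct.assoc k B B B (TensorProduct.map (bcomul g) LinearMap.id
        (TensorProduct.map (proj hB) (proj hB) t)) := by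
    intro t
    induction t with
    | zero => simp
    | add s t hs ht => simp only [map_add, hs, ht]
    | tmul a b =>
      simp only [Algebra.TensorProduct.map_tmul, AlgHom.id_apply, TensorProduct.map_tmul,
        P.bcomul_proj, LinearMap.id_apply]
      induction P.comulHom a with
      | zero => simp
      | add s t hs ht => simp only [map_add, TensorProduct.add_tmul, hs, ht]
      | tmul a b => simp
  rw [h1, h2] at h
  exact h

theorem ε_proj (w : Smash hB) : ε (proj hB w) = P.counitHom w := by
  obtain ⟨w, rfl⟩ := (of hB).surjective w
  induction w with
  | zero => simp
  | add s t hs ht => simp only [map_add, hs, ht]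
  | tmul h x => rw [proj_of, map_smul, ← inH_mul_inB, map_mul, counitHom_inH, counitHom_inB]; rfl

theorem bcounit_left (x : B) :
    TensorProduct.lid k B (TensorProduct.map ε.toLinearMap LinearMap.id (bcomul g x)) = x := by
  have h := congrArg (proj hB) (AlgHom.congr_fun P.counit_left (inB hB x))
  simp only [AlgHom.comp_apply, comulHom_inB, AlgHom.id_apply, proj_inB] at h
  refine Eq.trans ?_ h
  rw [bcomul, LinearMap.comp_apply, AlgHom.toLinearMap_apply]
  induction g x with
  | zero => simp
  | add s t hs ht => simp only [map_add, hs, ht]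
  | tmul a b => simp [P.ε_proj]

/-- Since `x ◁ a` is the projection of the product `x a`, equivariance is multiplicativity of the
coproduct of the smash product. -/
theorem bcomul_act (a : H) (x : B) : bcomul g (CB.act a x)
    = TensorProduct.map₂ CB.act.flip CB.act.flip (bcomul g x) (comul a) := by
  have h : CB.act a x = proj hB (inB hB x * inH hB a) := by rw [proj_mul, proj_inB, ract_inH]
  rw [h, P.bcomul_proj, map_mul, comulHom_inB, comulHom_inH, map_proj_mul]
  change ract₂ hB (bcomul g x) _ = _
  rw [comulH, AlgHom.comp_apply, Bialgebra.comulAlgHom_apply]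
  induction (comul a : H ⊗[k] H) with
  | zero => simp
  | add s t hs ht => simp only [map_add, hs, ht]
  | tmul c d =>
    induction bcomul g x with
    | zero => simp
    | add s t hs ht => simp only [map_add, LinearMap.add_apply, hs, ht]
    | tmul p q => simp [ract₂, ract_inH]

omit P in
/-- `p ⊗ q ↦ p₀ ⊗ p₁ q`. -/
def untwist (hB : IsCrossedAlg CB) : B ⊗[k] B →ₗ[k] Smash hB ⊗[k] Smash hB :=
  TensorProduct.map (inB hB).toLinearMap
      (LinearMap.mul' k (Smash hB) ∘ₗ TensorProduct.map (inH hB).toLinearMap (inB hB).toLinearMap)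
    ∘ₗ (TensorProduct.assoc k B H B).toLinearMap ∘ₗ TensorProduct.map CB.coact LinearMap.id

omit P in
theorem untwist_one : untwist hB (1 ⊗ₜ 1) = 1 := by
  simp [untwist, hB.coact_one, Algebra.TensorProduct.one_def]

/-- It suffices to take `y` among the generators. There both sides have a term `p₀v₀ ⊗ p₁v₁(q ◁
v₂)`: on one side `q` has crossed `v₁` in the smash product, on the other the coaction of `p v₀` has
been expanded, and the bracketings agree by coassociativity of the coaction. -/
theorem untwist_ract₂ (y : B) (z : B ⊗[k] B) :
    untwist hB (ract₂ hB z (g y)) = untwist hB z * g y := by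
  have hy : y ∈ Algebra.adjoin k (Set.range ι) := by rw [P.adjoin]; trivial
  induction hy using Algebra.adjoin_induction generalizing z with
  | mem y hy =>
    obtain ⟨v, rfl⟩ := hy
    rw [P.g_ι', map_add, mul_add, map_add]
    congr 1
    · induction z with
      | zero => simp
      | add s t hs ht => simp only [map_add, LinearMap.add_apply, add_mul, hs, ht]
      | tmul p q =>
        let G : (B ⊗[k] H) →ₗ[k] V ⊗[k] (H ⊗[k] H) →ₗ[k] Smash hB ⊗[k] Smash hB :=
          TensorProduct.map₂ ((LinearMap.mul k (Smash hB)).compl₁₂ (inB hB).toLinearMap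
            ((inB hB).toLinearMap ∘ₗ ι))
            ((LinearMap.mul k (Smash hB)).compl₁₂ (inH hB).toLinearMap
              (LinearMap.mul' k (Smash hB) ∘ₗ TensorProduct.map (inH hB).toLinearMap
                ((inB hB).toLinearMap ∘ₗ CB.act.flip q)))
        have h1 : ∀ t : V ⊗[k] H, untwist hB (ract₂ hB (p ⊗ₜ q) (TensorProduct.map
            ((inB hB).toLinearMap ∘ₗ ι) (inH hB).toLinearMap t))
            = G (CB.coact p)
              (TensorProduct.assoc k V H H (TensorProduct.map C.coact LinearMap.id t)) := by
          intro t
          induction t with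
          | zero => simp
          | add s t hs ht => simp only [map_add, hs, ht]
          | tmul v b =>
            simp only [TensorProduct.map_tmul, ract₂, TensorProduct.map₂_apply_tmul, untwist,
              LinearMap.comp_apply, LinearMap.id_apply, AlgHom.toLinearMap_apply, ract_inB,
              ract_inH, hB.coact_mul, P.coact_ι]
            induction CB.coact p with
            | zero => simp
            | add s t hs ht =>
              simp only [map_add, TensorProduct.add_tmul, LinearMap.add_apply, add_mul, hs, ht]
            | tmul p b =>
              induction C.coact v with
              | zero => simp
              | add s t hs ht =>
                simp only [map_add, TensorProduct.add_tmul, mul_add, hs, ht]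
              | tmul v c => simp [G, mul_assoc]
        have h2 : ∀ t : V ⊗[k] H, untwist hB (p ⊗ₜ q) * (TensorProduct.map
            ((inB hB).toLinearMap ∘ₗ ι) (inH hB).toLinearMap t)
            = G (CB.coact p) (TensorProduct.map LinearMap.id comul t) := by
          intro t
          induction t with
          | zero => simp
          | add s t hs ht => simp only [map_add, mul_add, hs, ht]
          | tmul v b =>
            simp only [TensorProduct.map_tmul, untwist,
              LinearMap.comp_apply, LinearMap.id_apply, AlgHom.toLinearMap_apply]
            induction CB.coact p with
            | zero => simp
            | add s t hs ht =>
              simp only [map_add, TensorProduct.add_tmul, LinearMap.add_apply, add_mul, hs, ht]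
            | tmul p c =>
              have := crossRel_inB hB q b
              simp only [AlgHom.toLinearMap_apply] at this
              simp [G, mul_assoc, this]
        rw [h1, h2, C.coact_coassoc]
    · induction z with
      | zero => simp
      | add s t hs ht => simp only [map_add, LinearMap.add_apply, add_mul, hs, ht]
      | tmul p q =>
        simp only [ract₂, TensorProduct.map₂_apply_tmul, ract_one, ract_inB, untwist,
          LinearMap.comp_apply, LinearEquiv.coe_coe, TensorProduct.map_tmul, LinearMap.id_apply]
        induction CB.coact p with
        | zero => simp
        | add s t hs ht => simp only [map_add, TensorProduct.add_tmul, add_mul, hs, ht]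
        | tmul p c => simp [mul_assoc]
  | algebraMap r =>
    have : ract₂ hB z 1 = z := by
      rw [Algebra.TensorProduct.one_def]
      induction z with
      | zero => simp
      | add s t hs ht => simp only [map_add, LinearMap.add_apply, hs, ht]
      | tmul p q => simp [ract₂, ract_one]
    rw [AlgHom.commutes, Algebra.algebraMap_eq_smul_one, map_smul, map_smul, mul_smul_comm, mul_one,
      this]
  | add x y _ _ hx hy => simp only [map_add, mul_add, hx, hy]
  | mul x y _ _ hx hy => rw [map_mul, ract₂_mul, hy, hx, mul_assoc]

/-- The coproduct of the smash product is thus recovered from the braided one. This reduces its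
descent to quotients to a statement about the braided coproduct, and gives the bosonisation formula.
-/
theorem untwist_bcomul (x : B) : untwist hB (bcomul g x) = g x := by
  rw [bcomul_eq, P.untwist_ract₂, untwist_one, one_mul]

end PrimGen

end Smash

/-! ### The projection onto the generators and its equivariance. -/

namespace Smash.PrimGen

open RightCrossedModule

/-- `ϖ` is the projection onto the generators `V`: an `ε`-derivation restricting to the identity. -/
structure IsLinearPart {k B V : Type*} [CommRing k] [Ring B] [Algebra k B] [AddCommGroup V]
    [Module k V] (ι : V →ₗ[k] B) (ε : B →ₐ[k] k) (ϖ : B →ₗ[k] V) : Prop where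
  map_one : ϖ 1 = 0
  map_mul : ∀ x y, ϖ (x * y) = ε x • ϖ y + ε y • ϖ x
  map_ι : ∀ v, ϖ (ι v) = v

variable {k H B V : Type*} [CommRing k] [Ring H] [HopfAlgebra k H] [Ring B]
    [Algebra k B] [AddCommGroup V] [Module k V] {CB : RightCrossedModule k H B}
    {hB : IsCrossedAlg CB} {C : RightCrossedModule k H V} {ι : V →ₗ[k] B}
    {g : B →ₐ[k] Smash hB ⊗[k] Smash hB} {ε : B →ₐ[k] k} (P : PrimGen hB C ι g ε)

variable {ϖ : B →ₗ[k] V}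

include P

/-- Both sides come from algebra maps; on a generator, the summand `1 ⊗ v` of the coproduct dies
because the projection to `H` kills `v`. -/
theorem map_proj_projH (x : B) :
    TensorProduct.map (proj hB) P.projH.toLinearMap (g x) = CB.coact x := by
  have h : (Algebra.TensorProduct.map (AlgHom.id k _) P.projH).comp g
      = (Algebra.TensorProduct.map (inB hB) (AlgHom.id k H)).comp
        (AlgHom.ofLinearMap CB.coact hB.coact_one hB.coact_mul) := by
    refine AlgHom.ext_of_adjoin_eq_top P.adjoin ?_
    rintro _ ⟨v, rfl⟩
    simp only [AlgHom.comp_apply, P.g_ι', map_add, AlgHom.ofLinearMap_apply, P.coact_ι,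
      Algebra.TensorProduct.map_tmul, P.projH_inB, P.ε_ι, map_zero, TensorProduct.tmul_zero,
      add_zero]
    induction C.coact v with
    | zero => simp
    | add s t hs ht => simp only [map_add, hs, ht]
    | tmul a b => simp [P.projH_inH]
  have h1 : ∀ z : Smash hB ⊗[k] Smash hB, TensorProduct.map (proj hB) P.projH.toLinearMap z
      = TensorProduct.map (proj hB) LinearMap.id
        (Algebra.TensorProduct.map (AlgHom.id k _) P.projH z) := by
    intro z
    induction z with
    | zero => simp
    | add s t hs ht => simp only [map_add, hs, ht]
    | tmul a b => simp
  rw [h1, ← AlgHom.comp_apply, h, AlgHom.comp_apply, AlgHom.ofLinearMap_apply]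
  induction CB.coact x with
  | zero => simp
  | add s t hs ht => simp only [map_add, hs, ht]
  | tmul a b => simp [proj_inB]


theorem ε_act (a : H) (x : B) : ε (CB.act a x) = counit (R := k) a * ε x := by
  have hmem : x ∈ Algebra.adjoin k (Set.range ι) := by rw [P.adjoin]; trivial
  induction hmem using Algebra.adjoin_induction generalizing a with
  | algebraMap r =>
    rw [Algebra.algebraMap_eq_smul_one, map_smul, hB.act_one]
    simp [mul_comm]
  | mem x hx =>
    obtain ⟨v, rfl⟩ := hx
    simp [P.act_ι, P.ε_ι]
  | add x y _ _ hx hy => simp only [map_add, hx, hy, mul_add]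
  | mul x y _ _ hx hy =>
    have h2 : ∀ t : H ⊗[k] H, ε (LinearMap.mul' k B (TensorProduct.map
        (CB.act.flip x) (CB.act.flip y) t))
        = counit (R := k) (TensorProduct.lid k H (TensorProduct.map counit LinearMap.id t))
          * (ε x * ε y) := by
      intro t
      induction t with
      | zero => simp
      | add s t hs ht => simp only [map_add, hs, ht, add_mul]
      | tmul a b => simp [hx, hy]; ring
    have h3 := rTensor_counit_comul (R := k) a
    rw [LinearMap.rTensor] at h3
    rw [hB.act_mul, conv, LinearMap.comp_apply, LinearMap.comp_apply, h2, h3,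
      TensorProduct.lid_tmul, one_smul, map_mul]

/-- On a product `(x ◁ a₁)(y ◁ a₂)`, each term of the `ε`-derivation rule loses one leg of `Δa` to
the counit. -/
theorem ϖ_act (hϖ : IsLinearPart ι ε ϖ) (a : H) (x : B) : ϖ (CB.act a x) = C.act a (ϖ x) := by
  have hmem : x ∈ Algebra.adjoin k (Set.range ι) := by rw [P.adjoin]; trivial
  induction hmem using Algebra.adjoin_induction generalizing a with
  | algebraMap r =>
    rw [Algebra.algebraMap_eq_smul_one, map_smul, hB.act_one]
    simp [Algebra.algebraMap_eq_smul_one, hϖ.map_one]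
  | mem x hx =>
    obtain ⟨v, rfl⟩ := hx
    rw [P.act_ι, hϖ.map_ι, hϖ.map_ι]
  | add x y _ _ hx hy => simp only [map_add, hx, hy]
  | mul x y _ _ hx hy =>
    have h2 : ∀ t : H ⊗[k] H, ϖ (LinearMap.mul' k B (TensorProduct.map
        (CB.act.flip x) (CB.act.flip y) t))
        = ε x • C.act (TensorProduct.lid k H (TensorProduct.map counit LinearMap.id t)) (ϖ y)
          + ε y • C.act (TensorProduct.rid k H (TensorProduct.map LinearMap.id counit t)) (ϖ x)
        := by
      intro t
      induction t with
      | zero => simp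
      | add s t hs ht =>
        simp only [map_add, hs, ht, LinearMap.add_apply, smul_add]
        abel
      | tmul a b => simp [hx, hy, hϖ.map_mul, P.ε_act, smul_smul, mul_comm]
    have h3 := rTensor_counit_comul (R := k) a
    rw [LinearMap.rTensor] at h3
    have h4 := lTensor_counit_comul (R := k) a
    rw [LinearMap.lTensor] at h4
    rw [hB.act_mul, conv, LinearMap.comp_apply, LinearMap.comp_apply, h2, h3,
      h4, TensorProduct.lid_tmul, TensorProduct.rid_tmul, one_smul, hϖ.map_mul, map_add,
      map_smul, map_smul]

theorem ε_coact (x : B) : TensorProduct.lid k H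
    (TensorProduct.map ε.toLinearMap LinearMap.id (CB.coact x))
      = algebraMap k H (ε x) := by
  have : ((Algebra.TensorProduct.lid k H).toAlgHom.comp
      (Algebra.TensorProduct.map ε (AlgHom.id k H))).comp
        (AlgHom.ofLinearMap CB.coact hB.coact_one hB.coact_mul)
      = (Algebra.ofId k H).comp ε := by
    refine AlgHom.ext_of_adjoin_eq_top P.adjoin ?_
    rintro _ ⟨v, rfl⟩
    simp only [AlgHom.comp_apply, AlgHom.ofLinearMap_apply, P.coact_ι, P.ε_ι, map_zero]
    induction C.coact v with
    | zero => simp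
    | add s t hs ht => simp only [map_add, hs, ht, add_zero]
    | tmul a b => simp [P.ε_ι]
  exact AlgHom.congr_fun this x

theorem ϖ_coact (hϖ : IsLinearPart ι ε ϖ) (x : B) :
    TensorProduct.map ϖ LinearMap.id (CB.coact x) = C.coact (ϖ x) := by
  have hmem : x ∈ Algebra.adjoin k (Set.range ι) := by rw [P.adjoin]; trivial
  induction hmem using Algebra.adjoin_induction with
  | algebraMap r =>
    rw [Algebra.algebraMap_eq_smul_one, map_smul, hB.coact_one]
    simp [hϖ.map_one]
  | mem x hx =>
    obtain ⟨v, rfl⟩ := hx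
    rw [P.coact_ι, hϖ.map_ι]
    induction C.coact v with
    | zero => simp
    | add s t hs ht => simp only [map_add, hs, ht]
    | tmul a b => 
      simp only [TensorProduct.map_tmul]
      rw [hϖ.map_ι]
      rfl
  | add x y _ _ hx hy => simp only [map_add, hx, hy]
  | mul x y _ _ hx hy =>
    have h : ∀ z w : B ⊗[k] H, TensorProduct.map ϖ LinearMap.id (z * w)
        = leftMul k H V (TensorProduct.lid k H (TensorProduct.map ε.toLinearMap LinearMap.id z))
            (TensorProduct.map ϖ LinearMap.id w)
          + LinearMap.lTensor V (LinearMap.mulRight k (TensorProduct.lid k H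
            (TensorProduct.map ε.toLinearMap LinearMap.id w)))
              (TensorProduct.map ϖ LinearMap.id z) := by
      intro z w
      induction z with
      | zero => simp
      | add s t hs ht => 
        simp only [map_add, add_mul, hs, ht, LinearMap.add_apply]
        abel
      | tmul x a =>
        induction w with
        | zero => simp
        | add s t hs ht => 
          have : ∀ p q : H, LinearMap.mulRight k (p + q)
            = LinearMap.mulRight k p + LinearMap.mulRight k q := by
            intro p q; ext; simp [mul_add]
          simp only [map_add, mul_add, hs, ht, this, LinearMap.lTensor_add, LinearMap.add_apply]
          abel
        | tmul y b => 
          simp [leftMul, hϖ.map_mul, TensorProduct.add_tmul, TensorProduct.smul_tmul]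
    rw [hB.coact_mul, h, hx, hy, P.ε_coact, P.ε_coact, hϖ.map_mul,
      map_add, map_smul, map_smul]
    congr 1
    · rw [Algebra.algebraMap_eq_smul_one, map_smul, map_one]
      rfl
    · induction C.coact (ϖ x) with
      | zero => simp
      | add s t hs ht => simp only [map_add, smul_add, hs, ht]
      | tmul a b => simp [Algebra.algebraMap_eq_smul_one]

/-! ### The universal skew derivation -/

omit P in
/-- The component `B → V ⊗ B` of the braided coproduct. -/
def deriv (ϖ : B →ₗ[k] V) (g : B →ₐ[k] Smash hB ⊗[k] Smash hB) : B →ₗ[k] V ⊗[k] B :=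
  TensorProduct.map ϖ LinearMap.id ∘ₗ bcomul g

omit P in
/-- The map `v ⊗ t ↦ v₀ ⊗ (s ◁ v₁) t`. -/
def skewMul (CB : RightCrossedModule k H B) (C : RightCrossedModule k H V) (s : B) :
    V ⊗[k] B →ₗ[k] V ⊗[k] B :=
  TensorProduct.map LinearMap.id
      (LinearMap.mul' k B ∘ₗ TensorProduct.map (CB.act.flip s) LinearMap.id)
    ∘ₗ (TensorProduct.assoc k V H B).toLinearMap ∘ₗ TensorProduct.map C.coact LinearMap.id

omit P in
theorem skewMul_tmul (s t : B) (v : V) : skewMul CB C s (v ⊗ₜ t) = 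
    TensorProduct.map LinearMap.id (LinearMap.mulRight k t ∘ₗ CB.act.flip s)
      (C.coact v) := by
  simp only [skewMul, LinearMap.comp_apply, TensorProduct.map_tmul, LinearMap.id_apply,
    LinearEquiv.coe_coe]
  induction C.coact v with
  | zero => simp
  | add s t hs ht => simp only [map_add, TensorProduct.add_tmul, hs, ht]
  | tmul a b => simp

omit P in
theorem deriv_one (hϖ : IsLinearPart ι ε ϖ) : deriv ϖ g 1 = 0 := by
  simp [deriv, bcomul_one, hϖ.map_one]

/-- The skew Leibniz rule. The coproduct of `s t` is that of `s` acted on by the untwisted coproduct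
of `t`. Under `ϖ` on the first leg, the `ε`-derivation rule leaves one term where the first leg of
`Δt` is killed by the counit and one where that of `Δs` is; in the latter `s` has been braided past
the vector split off from `t`. -/
theorem deriv_mul (hϖ : IsLinearPart ι ε ϖ) (s t : B) : deriv ϖ g (s * t)
    = TensorProduct.map LinearMap.id (LinearMap.mulRight k t) (deriv ϖ g s)
      + skewMul CB C s (deriv ϖ g t) := by
  have key : ∀ z z' : B ⊗[k] B, TensorProduct.map ϖ LinearMap.id
      (ract₂ hB z (untwist hB z'))
      = TensorProduct.map LinearMap.id (LinearMap.mulRight k (TensorProduct.lid k B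
          (TensorProduct.map ε.toLinearMap LinearMap.id z'))) (TensorProduct.map ϖ LinearMap.id z)
        + skewMul CB C (TensorProduct.lid k B (TensorProduct.map ε.toLinearMap LinearMap.id z))
          (TensorProduct.map ϖ LinearMap.id z') := by
    intro z z'
    induction z with
    | zero => simp [skewMul]
    | add s t hs ht =>
      have : ∀ p q : B, skewMul CB C (p + q) = skewMul CB C p + skewMul CB C q := by
        intro p q
        ext v t
        simp [skewMul_tmul, LinearMap.comp_add, TensorProduct.map_add_right]
      simp only [map_add, LinearMap.add_apply, hs, ht, this]
      abel
    | tmul p q =>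
      induction z' with
      | zero => simp [skewMul]
      | add s t hs ht =>
        have : ∀ p q : B, LinearMap.mulRight k (p + q)
          = LinearMap.mulRight k p + LinearMap.mulRight k q := by
          intro p q; ext; simp [mul_add]
        simp only [map_add, hs, ht, this, TensorProduct.map_add_right, LinearMap.add_apply]
        abel
      | tmul p' q' =>
        have h1 : ∀ w : B ⊗[k] H, TensorProduct.map ϖ LinearMap.id
            (ract₂ hB (p ⊗ₜ q)
              (TensorProduct.map (inB hB).toLinearMap
                (LinearMap.mul' k _ ∘ₗ TensorProduct.map (inH hB).toLinearMap
                  (inB hB).toLinearMap)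
                (TensorProduct.assoc k B H B (w ⊗ₜ q'))))
            = ϖ p ⊗ₜ (CB.act (TensorProduct.lid k H (TensorProduct.map
                ε.toLinearMap LinearMap.id w)) q * q')
              + ε p • TensorProduct.map LinearMap.id (LinearMap.mulRight k q'
                ∘ₗ CB.act.flip q) (TensorProduct.map ϖ LinearMap.id w) := by
          intro w
          induction w with
          | zero => simp
          | add s t hs ht =>
            simp only [map_add, TensorProduct.add_tmul, LinearMap.add_apply, add_mul,
              TensorProduct.tmul_add, smul_add, hs, ht]
            abel
          | tmul x a =>
            simp [ract₂, ract_inB, ract_mul, ract_inH, hϖ.map_mul, TensorProduct.add_tmul,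
              TensorProduct.smul_tmul']
            rw [add_comm]
        have h2 : untwist hB (p' ⊗ₜ q')
            = (TensorProduct.map (inB hB).toLinearMap
                (LinearMap.mul' k _ ∘ₗ TensorProduct.map (inH hB).toLinearMap
                  (inB hB).toLinearMap)
                (TensorProduct.assoc k B H B (CB.coact p' ⊗ₜ q'))) := rfl
        rw [h2, h1, P.ε_coact, P.ϖ_coact hϖ, Algebra.algebraMap_eq_smul_one, map_smul,
          LinearMap.smul_apply, CB.act_one]
        have h3 : ∀ c : k, skewMul CB C (c • q) = c • skewMul CB C q := by
          intro c
          ext v t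
          simp [skewMul_tmul, LinearMap.comp_smul, TensorProduct.map_smul_right]
        simp [h3, skewMul_tmul]
  have h := key (bcomul g s) (bcomul g t)
  rw [P.untwist_bcomul, ← bcomul_mul,
    P.bcounit_left, P.bcounit_left] at h
  exact h

theorem deriv_act (hϖ : IsLinearPart ι ε ϖ) (a : H) (t : B) : deriv ϖ g (CB.act a t)
    = TensorProduct.map₂ C.act.flip CB.act.flip (deriv ϖ g t) (comul a) := by
  rw [deriv, LinearMap.comp_apply, P.bcomul_act, LinearMap.comp_apply]
  induction (comul a : H ⊗[k] H) with
  | zero => simp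
  | add s t hs ht => simp only [map_add, hs, ht]
  | tmul c d =>
    induction bcomul g t with
    | zero => simp
    | add s t hs ht => simp only [map_add, LinearMap.add_apply, hs, ht]
    | tmul p q => simp [P.ϖ_act hϖ]

theorem deriv_comul (t : B) : TensorProduct.assoc k V B B
    (TensorProduct.map (deriv ϖ g) LinearMap.id (bcomul g t))
      = TensorProduct.map LinearMap.id (bcomul g) (deriv ϖ g t) := by
  have h := congrArg (TensorProduct.map ϖ LinearMap.id) (P.bcomul_coassoc t)
  have h1 : ∀ z : B ⊗[k] B, TensorProduct.map ϖ LinearMap.id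
      (TensorProduct.map LinearMap.id (bcomul g) z)
      = TensorProduct.map LinearMap.id (bcomul g) (TensorProduct.map ϖ LinearMap.id z) := by
    intro z
    induction z with
    | zero => simp
    | add s t hs ht => simp only [map_add, hs, ht]
    | tmul p q => simp
  have h2 : ∀ z : B ⊗[k] B, TensorProduct.map ϖ LinearMap.id (TensorProduct.assoc k B B B
      (TensorProduct.map (bcomul g) LinearMap.id z))
      = TensorProduct.assoc k V B B (TensorProduct.map (deriv ϖ g) LinearMap.id z) := by
    intro z
    induction z with
    | zero => simp
    | add s t hs ht => simp only [map_add, hs, ht]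
    | tmul p q =>
      simp only [TensorProduct.map_tmul, deriv, LinearMap.comp_apply, LinearMap.id_apply]
      induction bcomul g p with
      | zero => simp
      | add s t hs ht => simp only [map_add, TensorProduct.add_tmul, hs, ht]
      | tmul p q => simp
  rw [← h2]
  refine h.trans ?_
  exact h1 _

omit P in
/-- The diagonal coaction `v ⊗ t ↦ v₀ ⊗ t₀ ⊗ v₁ t₁` on `V ⊗ B`. -/
def diagCoact (CB : RightCrossedModule k H B) (C : RightCrossedModule k H V) :
    V ⊗[k] B →ₗ[k] (V ⊗[k] B) ⊗[k] H :=
  TensorProduct.map LinearMap.id (LinearMap.mul' k H)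
    ∘ₗ (TensorProduct.tensorTensorTensorComm k V H B H).toLinearMap
    ∘ₗ TensorProduct.map C.coact CB.coact

theorem map_proj_projH_comulH_mul (a : H) (z : Smash hB ⊗[k] Smash hB) :
      TensorProduct.map (proj hB) P.projH.toLinearMap (comulH hB a * z)
      = leftMul k H B a (TensorProduct.map (proj hB) P.projH.toLinearMap z) := by
  have h3 := rTensor_counit_comul (R := k) a
  rw [LinearMap.rTensor] at h3
  have h4 : ∀ t : H ⊗[k] H, TensorProduct.map (proj hB) P.projH.toLinearMap
      (Algebra.TensorProduct.map (inH hB) (inH hB) t * z)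
      = leftMul k H B (TensorProduct.lid k H (TensorProduct.map counit LinearMap.id t))
        (TensorProduct.map (proj hB) P.projH.toLinearMap z) := by
    intro t
    induction t with
    | zero => simp
    | add s t hs ht => simp only [map_add, add_mul, LinearMap.add_apply, hs, ht]
    | tmul a b =>
      induction z with
      | zero => simp
      | add s t hs ht => simp only [map_add, mul_add, hs, ht]
      | tmul c d =>
        simp [proj_inH_mul, leftMul, P.projH_inH, TensorProduct.smul_tmul']
  rw [comulH, AlgHom.comp_apply, h4, Bialgebra.comulAlgHom_apply, h3, TensorProduct.lid_tmul,
    one_smul]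

set_option maxHeartbeats 800000 in
theorem deriv_coact (hϖ : IsLinearPart ι ε ϖ) (t : B) :
    TensorProduct.map (deriv ϖ g) LinearMap.id (CB.coact t)
      = diagCoact CB C (deriv ϖ g t) := by
  -- `L` is applied to coassociativity in the smash product. One bracketing gives the coaction
  -- followed by the derivative, the other the diagonal coaction of the derivative.
  let L : Smash hB ⊗[k] (Smash hB ⊗[k] Smash hB) →ₗ[k] V ⊗[k] (B ⊗[k] H) :=
    TensorProduct.map (ϖ ∘ₗ proj hB) (TensorProduct.map (proj hB) P.projH.toLinearMap)
  have h2 : ∀ z : Smash hB ⊗[k] Smash hB,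
      L ((Algebra.TensorProduct.assoc k k k _ _ _).toAlgHom
        (Algebra.TensorProduct.map P.comulHom (AlgHom.id k _) z))
      = TensorProduct.assoc k V B H (TensorProduct.map (deriv ϖ g) LinearMap.id
          (TensorProduct.map (proj hB) P.projH.toLinearMap z)) := by
    intro z
    induction z with
    | zero => simp
    | add s t hs ht => simp only [map_add, hs, ht]
    | tmul a b =>
      simp only [TensorProduct.map_tmul, Algebra.TensorProduct.map_tmul, deriv,
        LinearMap.comp_apply, P.bcomul_proj, LinearMap.id_apply, AlgHom.id_apply]
      induction P.comulHom a with
      | zero => simp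
      | add s t hs ht => simp only [map_add, TensorProduct.add_tmul, hs, ht]
      | tmul c d => simp [L]
  have h1 : ∀ z : B ⊗[k] B, L (Algebra.TensorProduct.map (AlgHom.id k _) P.comulHom
      (untwist hB z))
      = TensorProduct.assoc k V B H (diagCoact CB C (TensorProduct.map ϖ LinearMap.id z)) := by
    intro z
    induction z with
    | zero => simp
    | add s t hs ht => simp only [map_add, hs, ht]
    | tmul p q =>
      simp only [untwist, diagCoact, LinearMap.comp_apply, TensorProduct.map_tmul,
        ← P.ϖ_coact hϖ, LinearMap.id_apply]
      induction CB.coact p with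
      | zero => simp
      | add s t hs ht => simp only [map_add, TensorProduct.add_tmul, hs, ht]
      | tmul x a =>
        simp only [TensorProduct.map_tmul, LinearMap.id_apply, LinearEquiv.coe_coe,
          TensorProduct.assoc_tmul, LinearMap.comp_apply, LinearMap.mul'_apply,
          AlgHom.toLinearMap_apply, Algebra.TensorProduct.map_tmul, AlgHom.id_apply, map_mul,
          P.comulHom_inH, P.comulHom_inB, L, proj_inB, P.map_proj_projH_comulH_mul,
            P.map_proj_projH]
        induction CB.coact q with
        | zero => simp
        | add s t hs ht => simp only [map_add, TensorProduct.tmul_add, hs, ht]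
        | tmul c d => simp [leftMul]
  apply (TensorProduct.assoc k V B H).injective
  have h := congrArg L (AlgHom.congr_fun P.coassoc (inB hB t))
  simp only [AlgHom.comp_apply, P.comulHom_inB] at h
  rw [h2, P.map_proj_projH, ← P.untwist_bcomul t, h1] at h
  exact h


end Smash.PrimGen

namespace Nichols

open Smash RightCrossedModule

variable {k H V : Type*} [CommRing k] [Ring H] [HopfAlgebra k H] [AddCommGroup V] [Module k V]
  (C : RightCrossedModule k H V)

local notation "T" => TensorAlgebra k V

/-! ### The tensor algebra as a crossed module algebra -/

/-- The action on the tensor algebra, as an algebra map into a convolution algebra. -/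
def tensorConv : T →ₐ[k] WithConv (H →ₗ[k] T) :=
  TensorAlgebra.lift k
    { toFun := fun v => toConv (TensorAlgebra.ι k ∘ₗ C.act.flip v)
      map_add' := fun v w => by ext; simp
      map_smul' := fun c v => by ext; simp }

/-- The coaction on the tensor algebra. -/
def tensorCoact : T →ₐ[k] T ⊗[k] H :=
  TensorAlgebra.lift k (TensorProduct.map (TensorAlgebra.ι k) LinearMap.id ∘ₗ C.coact)

/-- The crossed module structure of the tensor algebra. -/
def tensorCrossed : RightCrossedModule k H T :=
  ofGenerators C (TensorAlgebra.ι k) TensorAlgebra.adjoin_range_ι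
    (tensorConv C) (fun v a => by simp [tensorConv])
    (tensorCoact C) (fun v => by simp [tensorCoact])

theorem isCrossedAlg_tensor : IsCrossedAlg (tensorCrossed C) := isCrossedAlg_ofGenerators ..

/-- The smash product of `H` with the tensor algebra. -/
abbrev TensorSmash : Type _ := Smash (isCrossedAlg_tensor C)

/-- The coproduct of the smash product on the tensor algebra. -/
def tensorG : T →ₐ[k] TensorSmash C ⊗[k] TensorSmash C :=
  TensorAlgebra.lift k
    (TensorProduct.map ((inB (isCrossedAlg_tensor C)).toLinearMap ∘ₗ TensorAlgebra.ι k)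
      (inH (isCrossedAlg_tensor C)).toLinearMap ∘ₗ C.coact
      + TensorProduct.mk k _ _ 1 ∘ₗ (inB (isCrossedAlg_tensor C)).toLinearMap ∘ₗ TensorAlgebra.ι k)

theorem tensor_act_ι (a : H) (v : V) :
    (tensorCrossed C).act a (TensorAlgebra.ι k v) = TensorAlgebra.ι k (C.act a v) := by
  change (tensorConv C _) a = _
  simp [tensorConv]

theorem tensor_coact_ι (v : V) : (tensorCrossed C).coact (TensorAlgebra.ι k v)
    = TensorProduct.map (TensorAlgebra.ι k) LinearMap.id (C.coact v) := by
  change tensorCoact C _ = _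
  simp [tensorCoact]

theorem tensorPrimGen : PrimGen (isCrossedAlg_tensor C) C (TensorAlgebra.ι k) (tensorG C)
    TensorAlgebra.algebraMapInv where
  adjoin := TensorAlgebra.adjoin_range_ι
  act_ι := tensor_act_ι C
  coact_ι := tensor_coact_ι C
  g_ι v := by
    simp only [tensorG, TensorAlgebra.lift_ι_apply, primComul, tensor_coact_ι,
      LinearMap.add_apply, LinearMap.comp_apply, TensorProduct.mk_apply, AlgHom.toLinearMap_apply]
    congr 1
    induction C.coact v with
    | zero => simp
    | add s t hs ht => simp only [map_add, hs, ht]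
    | tmul a b => simp
  ε_ι v := by simp [TensorAlgebra.algebraMapInv]

/-- The braided coproduct of the tensor algebra. -/
def tensorComul : T →ₗ[k] T ⊗[k] T := PrimGen.bcomul (tensorG C)

local notation "ε" => (TensorAlgebra.algebraMapInv : TensorAlgebra k V →ₐ[k] k)
local notation "ϖ" => (TensorAlgebra.ιInv : TensorAlgebra k V →ₗ[k] V)

theorem ιInv_one : ϖ 1 = 0 := by
  let _ : Module kᵐᵒᵖ V := Module.compHom _ ((RingHom.id k).fromOpposite mul_comm)
  have : IsCentralScalar k V := ⟨fun r m => rfl⟩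
  change (TensorAlgebra.toTrivSqZeroExt (1 : T)).snd = 0
  rw [map_one, TrivSqZeroExt.snd_one]

/-- `ε` and `ιInv` are the two components of the algebra map from `T(V)` to the trivial square-zero
extension `k ⊕ V`, whose product is this rule. -/
theorem ιInv_mul (x y : T) : ϖ (x * y) = ε x • ϖ y + ε y • ϖ x := by
  let _ : Module kᵐᵒᵖ V := Module.compHom _ ((RingHom.id k).fromOpposite mul_comm)
  have : IsCentralScalar k V := ⟨fun r m => rfl⟩
  have h : ∀ x : T, ε x = (TensorAlgebra.toTrivSqZeroExt x).fst := by
    intro x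
    have : ε = (TrivSqZeroExt.fstHom k k V).comp TensorAlgebra.toTrivSqZeroExt := by
      ext v
      simp [TensorAlgebra.algebraMapInv]
    rw [this]
    rfl
  rw [h, h]
  change (TensorAlgebra.toTrivSqZeroExt (x * y)).snd = _ • (TensorAlgebra.toTrivSqZeroExt y).snd
    + _ • (TensorAlgebra.toTrivSqZeroExt x).snd
  rw [map_mul, TrivSqZeroExt.snd_mul]
  simp

theorem isLinearPart_ιInv : PrimGen.IsLinearPart (TensorAlgebra.ι k) ε ϖ where
  map_one := ιInv_one
  map_mul := ιInv_mul
  map_ι v := TensorAlgebra.ι_leftInverse v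

end Nichols

/-! ### Detecting subspaces of tensor products by functionals. -/

namespace TensorProduct

variable {k M N : Type*} [Field k] [AddCommGroup M] [Module k M] [AddCommGroup N] [Module k N]

/-- In a basis of `N`, the coefficients of `y` are its contractions with the coordinate functionals.
Such a basis exists because `k` is a field. -/
theorem mem_range_map_subtype_left (K : Submodule k M) (y : M ⊗[k] N)
    (h : ∀ ψ : Module.Dual k N, TensorProduct.rid k M (TensorProduct.map LinearMap.id ψ y) ∈ K) :
    y ∈ LinearMap.range (TensorProduct.map K.subtype (LinearMap.id : N →ₗ[k] N)) := by
  let b := Module.Basis.ofVectorSpace k N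
  obtain ⟨c, rfl⟩ := TensorProduct.eq_repr_basis_right b y
  refine Submodule.sum_mem _ fun i _ => ?_
  have hi : c i ∈ K := by
    have := h (b.coord i)
    rw [Finsupp.sum, map_sum, map_sum, Finset.sum_eq_single i] at this
    · simpa using this
    · intro j _ hj
      simp [Finsupp.single_eq_of_ne hj.symm]
    · intro hi
      simp [Finsupp.notMem_support_iff.1 hi]
  exact ⟨⟨c i, hi⟩ ⊗ₜ b i, by simp⟩

theorem mem_range_map_subtype_right (K : Submodule k M) (y : N ⊗[k] M)
    (h : ∀ ψ : Module.Dual k N, TensorProduct.lid k M (TensorProduct.map ψ LinearMap.id y) ∈ K) :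
    y ∈ LinearMap.range (TensorProduct.map (LinearMap.id : N →ₗ[k] N) K.subtype) := by
  have h1 : TensorProduct.comm k N M y
      ∈ LinearMap.range (TensorProduct.map K.subtype (LinearMap.id : N →ₗ[k] N)) := by
    refine mem_range_map_subtype_left K _ fun ψ => ?_
    have e : ∀ y : N ⊗[k] M, TensorProduct.rid k M
        (TensorProduct.map LinearMap.id ψ (TensorProduct.comm k N M y))
        = TensorProduct.lid k M (TensorProduct.map ψ LinearMap.id y) := by
      intro y
      induction y with
      | zero => simp
      | add s t hs ht => simp only [map_add, hs, ht]
      | tmul a b => simp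
    rw [e]
    exact h ψ
  obtain ⟨z, hz⟩ := h1
  refine ⟨TensorProduct.comm k K N z, ?_⟩
  apply (TensorProduct.comm k N M).injective
  rw [← hz]
  clear hz
  induction z with
  | zero => simp
  | add s t hs ht => simp only [map_add, hs, ht]
  | tmul a b => simp

end TensorProduct

/-! ### The radical of the skew derivations. -/

namespace Smash.PrimGen

open RightCrossedModule

variable {k H B V : Type*} [Field k] [Ring H] [HopfAlgebra k H] [Ring B]
    [Algebra k B] [AddCommGroup V] [Module k V] {CB : RightCrossedModule k H B}
    {hB : IsCrossedAlg CB} {C : RightCrossedModule k H V} {ι : V →ₗ[k] B}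
    {g : B →ₐ[k] Smash hB ⊗[k] Smash hB} {ε : B →ₐ[k] k} (P : PrimGen hB C ι g ε)

/-- The skew partial derivative in the direction `φ ∈ V*`. -/
def pd (ϖ : B →ₗ[k] V) (g : B →ₐ[k] Smash hB ⊗[k] Smash hB) (φ : Module.Dual k V) : B →ₗ[k] B :=
  (TensorProduct.lid k B).toLinearMap ∘ₗ TensorProduct.map φ LinearMap.id ∘ₗ deriv ϖ g

/-- The iterated partial derivative at a word in `V*`, followed by the counit. -/
def wordForm (ε : B →ₐ[k] k) (ϖ : B →ₗ[k] V) (g : B →ₐ[k] Smash hB ⊗[k] Smash hB) :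
    List (Module.Dual k V) → (B →ₗ[k] k)
  | [] => ε.toLinearMap
  | φ :: w => wordForm ε ϖ g w ∘ₗ pd ϖ g φ

/-- The elements all of whose iterated derivatives have vanishing counit: the largest subspace of
the augmentation ideal stable under the partial derivatives. -/
def radical (ε : B →ₐ[k] k) (ϖ : B →ₗ[k] V) (g : B →ₐ[k] Smash hB ⊗[k] Smash hB) :
    Submodule k B := ⨅ w, LinearMap.ker (wordForm ε ϖ g w)

variable {ϖ : B →ₗ[k] V} 

theorem mem_radical {x : B} : x ∈ radical ε ϖ g ↔ ∀ w, wordForm ε ϖ g w x = 0 := by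
  simp [radical]

theorem ε_eq_zero {x : B} (hx : x ∈ radical ε ϖ g) : ε x = 0 := mem_radical.1 hx []

theorem pd_mem_radical {x : B} (hx : x ∈ radical ε ϖ g) (φ : Module.Dual k V) :
    pd ϖ g φ x ∈ radical ε ϖ g := mem_radical.2 fun w => mem_radical.1 hx (φ :: w)

theorem le_radical (L : Submodule k B) (h0 : ∀ x ∈ L, ε x = 0)
    (h1 : ∀ x ∈ L, ∀ φ, pd ϖ g φ x ∈ L) : L ≤ radical ε ϖ g := by
  intro x hx
  rw [mem_radical]
  intro w
  induction w generalizing x with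
  | nil => exact h0 x hx
  | cons φ w ih => exact ih (h1 x hx φ)

/-- By maximality of the radical, its closure under an operation follows once the span of all
results of the operation on radical elements is killed by the counit and stable under derivatives.
-/
theorem span_le_radical (S : Set B) (h0 : ∀ x ∈ S, ε x = 0)
    (h1 : ∀ x ∈ S, ∀ φ, pd ϖ g φ x ∈ Submodule.span k S) :
    Submodule.span k S ≤ radical ε ϖ g := by
  refine le_radical _ ?_ ?_
  · change Submodule.span k S ≤ LinearMap.ker ε.toLinearMap
    exact Submodule.span_le.2 h0
  · intro x hx φ
    have : Submodule.span k S ≤ (Submodule.span k S).comap (pd ϖ g φ) :=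
      Submodule.span_le.2 fun x hx => h1 x hx φ
    exact this hx

theorem deriv_mem {x : B} (hx : x ∈ radical ε ϖ g) : deriv ϖ g x ∈
    LinearMap.range (TensorProduct.map (LinearMap.id : V →ₗ[k] V) (radical ε ϖ g).subtype) :=
  TensorProduct.mem_range_map_subtype_right _ _ fun φ => pd_mem_radical hx φ

include P

theorem act_mem_radical (hϖ : IsLinearPart ι ε ϖ) {x : B} (hx : x ∈ radical ε ϖ g) (a : H) :
    CB.act a x ∈ radical ε ϖ g := by
  refine span_le_radical {y | ∃ a, ∃ x ∈ radical ε ϖ g, y = CB.act a x} ?_ ?_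
    (Submodule.subset_span ⟨a, x, hx, rfl⟩)
  · rintro _ ⟨a, x, hx, rfl⟩
    rw [P.ε_act, ε_eq_zero hx, mul_zero]
  · rintro _ ⟨a, x, hx, rfl⟩ φ
    rw [pd, LinearMap.comp_apply, LinearMap.comp_apply, P.deriv_act hϖ]
    obtain ⟨z, hz⟩ := deriv_mem hx
    rw [← hz]
    clear hz
    generalize (comul a : H ⊗[k] H) = c
    induction z with
    | zero => simp
    | add s t hs ht => simp only [map_add, LinearMap.add_apply]; exact add_mem hs ht
    | tmul v y =>
      induction c with
      | zero => simp
      | add s t hs ht => simp only [map_add]; exact add_mem hs ht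
      | tmul c d =>
        simp only [TensorProduct.map_tmul, TensorProduct.map₂_apply_tmul, LinearMap.id_apply,
          LinearEquiv.coe_coe, TensorProduct.lid_tmul]
        exact Submodule.smul_mem _ _ (Submodule.subset_span ⟨d, y, y.2, rfl⟩)

omit P in
/-- `(s ◁ a) t ∈ L` for all `a` implies that `skewMul` by `s` sends `V ⊗ t` to `V ⊗ L`. -/
theorem lid_skewMul_mem (L : Submodule k B) (s t : B) (h : ∀ a, CB.act a s * t ∈ L)
    (φ : Module.Dual k V) (v : V) :
    TensorProduct.lid k B (TensorProduct.map φ LinearMap.id (skewMul CB C s (v ⊗ₜ t))) ∈ L := by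
  rw [skewMul_tmul]
  induction C.coact v with
  | zero => simp
  | add s t hs ht => simp only [map_add]; exact add_mem hs ht
  | tmul v a =>
    simp only [TensorProduct.map_tmul, LinearMap.id_apply, LinearMap.comp_apply,
      LinearMap.flip_apply, LinearMap.mulRight_apply, TensorProduct.lid_tmul]
    exact L.smul_mem _ (h a)

/-- By the skew Leibniz rule the derivatives of `x t` are combinations of terms `(∂x) t` and `(x ◁
a) t'`. These are again products of a radical element with something, by stability under derivatives
and under the action. -/
theorem mul_mem_radical_right (hϖ : IsLinearPart ι ε ϖ) {x : B} (hx : x ∈ radical ε ϖ g) (t : B) :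
    x * t ∈ radical ε ϖ g := by
  refine span_le_radical {y | ∃ t, ∃ x ∈ radical ε ϖ g, y = x * t} ?_ ?_
    (Submodule.subset_span ⟨t, x, hx, rfl⟩)
  · rintro _ ⟨t, x, hx, rfl⟩
    rw [map_mul, ε_eq_zero hx, zero_mul]
  · rintro _ ⟨t, x, hx, rfl⟩ φ
    rw [pd, LinearMap.comp_apply, LinearMap.comp_apply, P.deriv_mul hϖ, map_add, map_add]
    refine add_mem ?_ ?_
    · obtain ⟨z, hz⟩ := deriv_mem hx
      rw [← hz]
      clear hz
      induction z with
      | zero => simp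
      | add s t hs ht => simp only [map_add]; exact add_mem hs ht
      | tmul v y =>
        simp only [TensorProduct.map_tmul, LinearMap.id_apply, LinearMap.mulRight_apply,
          LinearEquiv.coe_coe, TensorProduct.lid_tmul]
        exact Submodule.smul_mem _ _ (Submodule.subset_span ⟨t, y, y.2, rfl⟩)
    · induction deriv ϖ g t with
      | zero => simp
      | add s t hs ht => simp only [map_add]; exact add_mem hs ht
      | tmul v y =>
        refine lid_skewMul_mem _ _ _ (fun a => ?_) φ v
        exact Submodule.subset_span ⟨y, _, P.act_mem_radical hϖ hx a, rfl⟩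

/-- The terms of the Leibniz rule are now `(∂t) x` and `(t ◁ a) ∂x`, with the radical element still
on the right. -/
theorem mul_mem_radical_left (hϖ : IsLinearPart ι ε ϖ) {x : B} (hx : x ∈ radical ε ϖ g) (t : B) :
    t * x ∈ radical ε ϖ g := by
  refine span_le_radical {y | ∃ t, ∃ x ∈ radical ε ϖ g, y = t * x} ?_ ?_
    (Submodule.subset_span ⟨t, x, hx, rfl⟩)
  · rintro _ ⟨t, x, hx, rfl⟩
    rw [map_mul, ε_eq_zero hx, mul_zero]
  · rintro _ ⟨t, x, hx, rfl⟩ φ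
    rw [pd, LinearMap.comp_apply, LinearMap.comp_apply, P.deriv_mul hϖ, map_add, map_add]
    refine add_mem ?_ ?_
    · induction deriv ϖ g t with
      | zero => simp
      | add s t hs ht => simp only [map_add]; exact add_mem hs ht
      | tmul v y =>
        simp only [TensorProduct.map_tmul, LinearMap.id_apply, LinearMap.mulRight_apply,
          LinearEquiv.coe_coe, TensorProduct.lid_tmul]
        exact Submodule.smul_mem _ _ (Submodule.subset_span ⟨y, x, hx, rfl⟩)
    · obtain ⟨z, hz⟩ := deriv_mem hx
      rw [← hz]
      clear hz
      induction z with
      | zero => simp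
      | add s t hs ht => simp only [map_add]; exact add_mem hs ht
      | tmul v y =>
        refine lid_skewMul_mem _ _ _ (fun a => ?_) φ v
        exact Submodule.subset_span ⟨_, y, y.2, rfl⟩

theorem coact_mem_radical (hϖ : IsLinearPart ι ε ϖ) {x : B} (hx : x ∈ radical ε ϖ g) :
    CB.coact x ∈ LinearMap.range
      (TensorProduct.map (radical ε ϖ g).subtype (LinearMap.id : H →ₗ[k] H)) := by
  refine TensorProduct.mem_range_map_subtype_left _ _ fun ψ => ?_
  -- All functionals are taken at once, since differentiating replaces `ψ` by `b ↦ ψ(a b)`, where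
  -- `a` comes from the coaction on the vector split off.
  refine span_le_radical {y | ∃ ψ : Module.Dual k H, ∃ x ∈ radical ε ϖ g,
      y = TensorProduct.rid k B (TensorProduct.map LinearMap.id ψ (CB.coact x))} ?_ ?_
    (Submodule.subset_span ⟨ψ, x, hx, rfl⟩)
  · rintro _ ⟨ψ, x, hx, rfl⟩
    have h : ∀ z : B ⊗[k] H, ε (TensorProduct.rid k B (TensorProduct.map LinearMap.id ψ z))
        = ψ (TensorProduct.lid k H (TensorProduct.map ε.toLinearMap LinearMap.id z)) := by
      intro z
      induction z with
      | zero => simp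
      | add s t hs ht => simp only [map_add, hs, ht]
      | tmul a b => simp [mul_comm]
    rw [h, P.ε_coact, ε_eq_zero hx, map_zero, map_zero]
  · rintro _ ⟨ψ, x, hx, rfl⟩ φ
    have h : ∀ z : B ⊗[k] H,
        pd ϖ g φ (TensorProduct.rid k B (TensorProduct.map LinearMap.id ψ z))
        = TensorProduct.lid k B (TensorProduct.map φ LinearMap.id (TensorProduct.rid k (V ⊗[k] B)
          (TensorProduct.map LinearMap.id ψ (TensorProduct.map (deriv ϖ g) LinearMap.id z)))) := by
      intro z
      induction z with
      | zero => simp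
      | add s t hs ht => simp only [map_add, hs, ht]
      | tmul a b => simp [pd]
    rw [h, P.deriv_coact hϖ]
    obtain ⟨z, hz⟩ := deriv_mem hx
    rw [← hz]
    clear hz
    induction z with
    | zero => simp
    | add s t hs ht => simp only [map_add]; exact add_mem hs ht
    | tmul v y =>
      simp only [TensorProduct.map_tmul, diagCoact, LinearMap.comp_apply, LinearMap.id_apply]
      induction C.coact v with
      | zero => simp
      | add s t hs ht => simp only [map_add, TensorProduct.add_tmul]; exact add_mem hs ht
      | tmul v a =>
        have h2 : ∀ z : B ⊗[k] H, TensorProduct.lid k B (TensorProduct.map φ LinearMap.id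
            (TensorProduct.rid k (V ⊗[k] B) (TensorProduct.map LinearMap.id ψ
              (TensorProduct.map LinearMap.id (LinearMap.mul' k H)
                (TensorProduct.tensorTensorTensorComm k V H B H ((v ⊗ₜ a) ⊗ₜ z))))))
            = φ v • TensorProduct.rid k B (TensorProduct.map LinearMap.id
              (ψ ∘ₗ LinearMap.mulLeft k a) z) := by
          intro z
          induction z with
          | zero => simp
          | add s t hs ht => simp only [map_add, TensorProduct.tmul_add, smul_add, hs, ht]
          | tmul p b => simp [smul_smul, mul_comm]
        simp only [Submodule.subtype_apply, LinearEquiv.coe_coe]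
        rw [h2]
        exact Submodule.smul_mem _ _ (Submodule.subset_span ⟨_, y, y.2, rfl⟩)

theorem bcomul_pd (φ : Module.Dual k V) (x : B) : bcomul g (pd ϖ g φ x)
    = TensorProduct.map (pd ϖ g φ) LinearMap.id (bcomul g x) := by
  have h1 : ∀ z : V ⊗[k] B, bcomul g (TensorProduct.lid k B (TensorProduct.map φ LinearMap.id z))
      = TensorProduct.lid k (B ⊗[k] B) (TensorProduct.map φ LinearMap.id
        (TensorProduct.map LinearMap.id (bcomul g) z)) := by
    intro z
    induction z with
    | zero => simp
    | add s t hs ht => simp only [map_add, hs, ht]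
    | tmul a b => simp
  have h2 : ∀ z : B ⊗[k] B, TensorProduct.map (pd ϖ g φ) LinearMap.id z
      = TensorProduct.lid k (B ⊗[k] B) (TensorProduct.map φ LinearMap.id
        (TensorProduct.assoc k V B B (TensorProduct.map (deriv ϖ g) LinearMap.id z))) := by
    intro z
    induction z with
    | zero => simp
    | add s t hs ht => simp only [map_add, hs, ht]
    | tmul a b =>
      simp only [TensorProduct.map_tmul, pd, LinearMap.comp_apply, LinearMap.id_apply]
      induction deriv ϖ g a with
      | zero => simp
      | add s t hs ht => simp only [map_add, TensorProduct.add_tmul, hs, ht]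
      | tmul c d => simp [TensorProduct.smul_tmul']
  rw [h2, P.deriv_comul, pd, LinearMap.comp_apply, LinearMap.comp_apply]
  exact h1 _

/-- Derivatives commute with the braided coproduct when they act on its first leg. Evaluating a word
there therefore leaves the corresponding iterated derivative of `x` in the second leg, by the counit
axiom. -/
theorem wordForm_bcomul_mem {x : B} (hx : x ∈ radical ε ϖ g) (w : List (Module.Dual k V)) :
    TensorProduct.lid k B (TensorProduct.map (wordForm ε ϖ g w) LinearMap.id (bcomul g x))
      ∈ radical ε ϖ g := by
  induction w generalizing x with
  | nil => rw [wordForm, P.bcounit_left]; exact hx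
  | cons φ w ih =>
    have h := ih (pd_mem_radical hx φ)
    rw [P.bcomul_pd, ← LinearMap.comp_apply, ← TensorProduct.map_comp] at h
    exact h

/-- The radical is a coideal for the braided coproduct. -/
theorem map_bcomul_eq_zero {M : Type*} [AddCommGroup M] [Module k M] (q : B →ₗ[k] M)
    (hq : radical ε ϖ g ≤ LinearMap.ker q) {x : B} (hx : x ∈ radical ε ϖ g) :
    TensorProduct.map q q (bcomul g x) = 0 := by
  -- Modulo `q` in the second leg, the first leg lies in the radical: evaluating a word on it leaves
  -- a radical element in the second leg, which `q` kills. Applying `q` to the first leg then gives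
  -- zero.
  have h : TensorProduct.map LinearMap.id q (bcomul g x) ∈ LinearMap.range
      (TensorProduct.map (radical ε ϖ g).subtype (LinearMap.id : M →ₗ[k] M)) := by
    refine TensorProduct.mem_range_map_subtype_left _ _ fun ψ => ?_
    rw [mem_radical]
    intro w
    have e : ∀ z : B ⊗[k] B, wordForm ε ϖ g w (TensorProduct.rid k B
        (TensorProduct.map LinearMap.id ψ (TensorProduct.map LinearMap.id q z)))
        = ψ (q (TensorProduct.lid k B
          (TensorProduct.map (wordForm ε ϖ g w) LinearMap.id z))) := by
      intro z
      induction z with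
      | zero => simp
      | add s t hs ht => simp only [map_add, hs, ht]
      | tmul a b => simp [mul_comm]
    rw [e, LinearMap.mem_ker.1 (hq (P.wordForm_bcomul_mem hx w)), map_zero]
  obtain ⟨z, hz⟩ := h
  have e1 : ∀ z : B ⊗[k] B, TensorProduct.map q q z
      = TensorProduct.map q LinearMap.id (TensorProduct.map LinearMap.id q z) := by
    intro z
    induction z with
    | zero => simp
    | add s t hs ht => simp only [map_add, hs, ht]
    | tmul a b => simp
  rw [e1, ← hz, ← LinearMap.comp_apply, ← TensorProduct.map_comp]
  have : q ∘ₗ (radical ε ϖ g).subtype = 0 := by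
    ext y
    exact hq y.2
  rw [this, TensorProduct.map_zero_left, LinearMap.zero_apply]

end Smash.PrimGen

/-! ### Tensor powers inside the tensor algebra. -/

namespace BraidedPower

variable {k V : Type*} [CommRing k] [AddCommGroup V] [Module k V]

open TensorPower

theorem toTensorAlgebra_mulEquiv {n m : ℕ} (s : ⨂[k]^n V) (t : ⨂[k]^m V) :
    toTensorAlgebra (mulEquiv (s ⊗ₜ[k] t)) = toTensorAlgebra s * toTensorAlgebra t :=
  TensorPower.toTensorAlgebra_gMul s t

theorem toTensorAlgebra_cast {n m : ℕ} (h : n = m) (t : ⨂[k]^n V) :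
    toTensorAlgebra (TensorPower.cast k V h t) = toTensorAlgebra t := by
  subst h
  simp

theorem toTensorAlgebra_eq {n : ℕ} (t : ⨂[k]^n V) : toTensorAlgebra t
    = TensorAlgebra.ofDirectSum (DirectSum.of (fun n => ⨂[k]^n V) n t) := by
  exact (DirectSum.toAddMonoid_of (β := fun n => ⨂[k]^n V)
    (fun _ => (toTensorAlgebra (R := k) (M := V)).toAddMonoidHom) n t).symm

theorem toDirectSum_toTensorAlgebra {n : ℕ} (t : ⨂[k]^n V) :
    TensorAlgebra.toDirectSum (toTensorAlgebra t) = DirectSum.of (fun n => ⨂[k]^n V) n t := by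
  rw [toTensorAlgebra_eq, TensorAlgebra.toDirectSum_ofDirectSum]

/-- `T(V)` is the direct sum of the tensor powers. Identities between tensors with reindexed degrees
can therefore be verified in `T(V)`, where they reduce to associativity. -/
theorem toTensorAlgebra_injective (n : ℕ) :
    Function.Injective (toTensorAlgebra : ⨂[k]^n V →ₗ[k] TensorAlgebra k V) := by
  intro s t h
  have := congrArg TensorAlgebra.toDirectSum h
  rw [toDirectSum_toTensorAlgebra, toDirectSum_toTensorAlgebra] at this
  exact DirectSum.of_injective n this

/-- A vector as a tensor of degree one. -/
def single : V ≃ₗ[k] ⨂[k]^1 V :=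
  (PiTensorProduct.subsingletonEquiv (R := k) (s := fun _ : Fin 1 => V) 0).symm

theorem toTensorAlgebra_single (v : V) :
    toTensorAlgebra (single v : ⨂[k]^1 V) = TensorAlgebra.ι k v := by
  simp [single, PiTensorProduct.subsingletonEquiv_symm_apply', TensorAlgebra.tprod_apply]

theorem exists_eq_smul_one (t : ⨂[k]^0 V) :
    ∃ c : k, t = c • (PiTensorProduct.tprod k Fin.elim0 : ⨂[k]^0 V) := by
  obtain ⟨c, rfl⟩ := (algebraMap₀ (R := k) (M := V)).surjective t
  exact ⟨c, algebraMap₀_eq_smul_one c⟩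

/-- Appending a vector to a tensor. -/
def snoc {n : ℕ} (s : ⨂[k]^n V) (v : V) : ⨂[k]^(n + 1) V := mulEquiv (s ⊗ₜ[k] single v)

theorem toTensorAlgebra_snoc {n : ℕ} (s : ⨂[k]^n V) (v : V) :
    toTensorAlgebra (snoc s v) = toTensorAlgebra s * TensorAlgebra.ι k v := by
  rw [snoc, toTensorAlgebra_mulEquiv, toTensorAlgebra_single]

/-- Induction on tensors along a decomposition `n = r + m`. -/
theorem mul_induction {n : ℕ} (r m : ℕ) (h : r + m = n) {motive : ⨂[k]^n V → Prop}
    (zero : motive 0) (add : ∀ s t, motive s → motive t → motive (s + t))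
    (mul : ∀ (t : ⨂[k]^n V) (p : ⨂[k]^r V) (q : ⨂[k]^m V),
      toTensorAlgebra t = toTensorAlgebra p * toTensorAlgebra q → motive t) (t : ⨂[k]^n V) :
    motive t := by
  subst h
  obtain ⟨t, rfl⟩ := (mulEquiv (R := k) (M := V) (n := r) (m := m)).surjective t
  induction t with
  | zero => simpa using zero
  | add s t hs ht => rw [map_add]; exact add _ _ hs ht
  | tmul p q => exact mul _ p q (toTensorAlgebra_mulEquiv p q)

theorem snoc_induction {n : ℕ} {motive : ⨂[k]^(n + 1) V → Prop}
    (zero : motive 0) (add : ∀ s t, motive s → motive t → motive (s + t))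
    (snoc : ∀ s v, motive (snoc s v)) (t : ⨂[k]^(n + 1) V) : motive t := by
  refine mul_induction n 1 rfl zero add (fun t p q h => ?_) t
  obtain ⟨v, rfl⟩ := single.surjective q
  rw [toTensorAlgebra_injective _ (h.trans (toTensorAlgebra_mulEquiv p _).symm)]
  exact snoc p v

theorem tensId_snoc {n : ℕ} (f : Module.End k (⨂[k]^n V)) (s : ⨂[k]^n V) (v : V) :
    tensId f (snoc s v) = snoc (f s) v := by
  simp [tensId, snoc]

theorem tensId_mul {n : ℕ} (f g : Module.End k (⨂[k]^n V)) :
    tensId (f * g) = tensId f * tensId g := by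
  refine LinearMap.ext fun t => ?_
  induction t using snoc_induction with
  | zero => simp
  | add s t hs ht => rw [map_add, map_add, hs, ht]
  | snoc s v => simp only [Module.End.mul_apply, tensId_snoc]

theorem tensId_one {n : ℕ} : tensId (1 : Module.End k (⨂[k]^n V)) = 1 := by
  refine LinearMap.ext fun t => ?_
  induction t using snoc_induction with
  | zero => simp
  | add s t hs ht => rw [map_add, map_add, hs, ht]
  | snoc s v => simp only [Module.End.one_apply, tensId_snoc]

theorem toTensorAlgebra_idTens {n : ℕ} (f : Module.End k (⨂[k]^n V)) (t : ⨂[k]^(n + 1) V)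
    (p : ⨂[k]^1 V) (q : ⨂[k]^n V) (h : toTensorAlgebra t = toTensorAlgebra p * toTensorAlgebra q) :
    toTensorAlgebra (idTens f t) = toTensorAlgebra p * toTensorAlgebra (f q) := by
  have ht : TensorPower.cast k V (Nat.add_comm n 1) t = mulEquiv (p ⊗ₜ q) := by
    apply toTensorAlgebra_injective
    rw [toTensorAlgebra_cast, toTensorAlgebra_mulEquiv, h]
  simp only [idTens, LinearMap.comp_apply, LinearEquiv.coe_coe, ht, LinearEquiv.symm_apply_apply,
    TensorProduct.map_tmul, LinearMap.id_apply, toTensorAlgebra_cast, toTensorAlgebra_mulEquiv]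

theorem toTensorAlgebra_squareEquiv (z : V ⊗[k] V) : toTensorAlgebra (squareEquiv k V z)
    = LinearMap.mul' k _ (TensorProduct.map (TensorAlgebra.ι k) (TensorAlgebra.ι k) z) := by
  induction z with
  | zero => simp
  | add s t hs ht => simp only [map_add, hs, ht]
  | tmul v w => 
    have : squareEquiv k V (v ⊗ₜ w) = mulEquiv (single v ⊗ₜ[k] single w) := rfl
    rw [this]
    refine (toTensorAlgebra_mulEquiv (single v) (single w)).trans ?_
    rw [toTensorAlgebra_single, toTensorAlgebra_single]
    rfl

theorem toTensorAlgebra_braidAt (Φ : Module.End k (V ⊗[k] V)) {n : ℕ} (s : ⨂[k]^n V) (v w : V) :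
    toTensorAlgebra (braidAt Φ (n + 2) (n + 1) (snoc (snoc s v) w))
      = toTensorAlgebra s * toTensorAlgebra (squareEquiv k V (Φ (v ⊗ₜ w))) := by
  have ht : snoc (snoc s v) w
      = mulEquiv (R := k) (n := n) (m := 2) (s ⊗ₜ[k] squareEquiv k V (v ⊗ₜ w)) := by
    apply toTensorAlgebra_injective
    refine Eq.trans ?_ (toTensorAlgebra_mulEquiv s (squareEquiv k V (v ⊗ₜ w))).symm
    rw [toTensorAlgebra_squareEquiv, toTensorAlgebra_snoc,
      toTensorAlgebra_snoc, _root_.mul_assoc]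
    rfl
  rw [ht, braidAt, if_pos rfl]
  simp only [LinearMap.comp_apply, LinearEquiv.coe_coe, LinearEquiv.symm_apply_apply,
    TensorProduct.map_tmul, LinearMap.id_apply]
  exact toTensorAlgebra_mulEquiv s _

theorem braidChain_self (Φ : Module.End k (V ⊗[k] V)) (n : ℕ) : braidChain Φ n n = 1 := by
  simp [braidChain]

/-- The chain on `V^{⊗(n+2)}` is `Φ_{r+1} ⋯ Φ_{n+1}`, and only `Φ_{n+1}` touches the last tensor
factor. -/
theorem braidChain_succ (Φ : Module.End k (V ⊗[k] V)) (n r : ℕ) (h : r ≤ n) :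
    braidChain Φ (n + 2) (r + 1)
      = tensId (braidChain Φ (n + 1) (r + 1)) * braidAt Φ (n + 2) (n + 1) := by
  have h1 : n + 2 - (r + 1) = (n - r) + 1 := by omega
  have h2 : n + 1 - (r + 1) = n - r := by omega
  have h3 : r + 1 + (n - r) = n + 1 := by omega
  have h4 : ∀ l : List ℕ, (∀ i ∈ l, i ≠ n + 1) → (l.map (braidAt Φ (n + 2))).prod
      = tensId ((l.map (braidAt Φ (n + 1))).prod) := by
    intro l hl
    induction l with
    | nil => simp [tensId_one]
    | cons i l ih =>
      rw [List.map_cons, List.prod_cons, ih fun j hj => hl j (List.mem_cons_of_mem _ hj),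
        List.map_cons, List.prod_cons, tensId_mul, braidAt, if_neg (hl i List.mem_cons_self)]
  rw [braidChain, h1, List.range'_1_concat, List.map_append, List.prod_append, h3, h4, braidChain,
    h2, List.map_singleton, List.prod_singleton]
  intro i hi
  rw [List.mem_range'_1] at hi
  omega

theorem binom_eq_zero (Φ : Module.End k (V ⊗[k] V)) (n r : ℕ) (h : n < r) : binom Φ n r = 0 := by
  induction n generalizing r with
  | zero =>
    obtain ⟨r, rfl⟩ := Nat.exists_eq_succ_of_ne_zero h.ne'
    rfl
  | succ n ih =>
    obtain ⟨r, rfl⟩ := Nat.exists_eq_succ_of_ne_zero (Nat.ne_of_gt (Nat.zero_lt_of_lt h))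
    rw [binom, ih r (by omega), ih (r + 1) (by omega)]
    have : tensId (0 : Module.End k (⨂[k]^n V)) = 0 := by
      ext
      simp [tensId]
    rw [this, mul_zero, _root_.add_zero]

/-- The component `V^{⊗n} → V^{⊗r} ⊗ V^{⊗(n-r)}` of deconcatenation, read in the tensor algebra. -/
def deconc (n r : ℕ) : ⨂[k]^n V →ₗ[k] TensorAlgebra k V ⊗[k] TensorAlgebra k V :=
  if h : r ≤ n then TensorProduct.map toTensorAlgebra toTensorAlgebra ∘ₗ split k V n r h else 0

theorem deconc_eq {n r m : ℕ} (h : r + m = n) (t : ⨂[k]^n V) (p : ⨂[k]^r V) (q : ⨂[k]^m V)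
    (ht : toTensorAlgebra t = toTensorAlgebra p * toTensorAlgebra q) :
    deconc n r t = toTensorAlgebra p ⊗ₜ toTensorAlgebra q := by
  have hr : r ≤ n := by omega
  have hm : m = n - r := by omega
  subst hm
  have e : TensorPower.cast k V (Nat.add_sub_of_le hr).symm t = mulEquiv (p ⊗ₜ q) := by
    apply toTensorAlgebra_injective
    rw [toTensorAlgebra_cast, toTensorAlgebra_mulEquiv, ht]
  simp [deconc, hr, split, e]

theorem deconc_snoc {n r : ℕ} (h : r ≤ n) (t : ⨂[k]^n V) (v : V) :
    deconc (n + 1) r (snoc t v) = deconc n r t * (1 ⊗ₜ TensorAlgebra.ι k v) := by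
  induction t using mul_induction r (n - r) (Nat.add_sub_of_le h) with
  | zero => simp [snoc]
  | add s t hs ht =>
    have : snoc (s + t) v = snoc s v + snoc t v := by simp [snoc, TensorProduct.add_tmul]
    rw [this, map_add, hs, ht, map_add, add_mul]
  | mul t p q ht =>
    have h1 : r + (n - r) = n := by omega
    have h2 : r + (n - r + 1) = n + 1 := by omega
    rw [deconc_eq h1 t p q ht, deconc_eq h2 (snoc t v) p (snoc q v)
      (by rw [toTensorAlgebra_snoc, toTensorAlgebra_snoc, ht, _root_.mul_assoc]),
      toTensorAlgebra_snoc]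
    simp

theorem toTensorAlgebra_gOne' :
    toTensorAlgebra (PiTensorProduct.tprod k Fin.elim0 : ⨂[k]^0 V) = 1 :=
  TensorPower.toTensorAlgebra_gOne

theorem deconc_self (n : ℕ) (t : ⨂[k]^n V) : deconc n n t = toTensorAlgebra t ⊗ₜ 1 := by
  rw [deconc_eq (n := n) (m := 0) rfl t t (PiTensorProduct.tprod k Fin.elim0)
    (by rw [toTensorAlgebra_gOne', _root_.mul_one]), toTensorAlgebra_gOne']

theorem deconc_zero (n : ℕ) (t : ⨂[k]^n V) : deconc n 0 t = 1 ⊗ₜ toTensorAlgebra t := by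
  rw [deconc_eq (m := n) (zero_add n) t (PiTensorProduct.tprod k Fin.elim0) t
    (by rw [toTensorAlgebra_gOne', _root_.one_mul]), toTensorAlgebra_gOne']

end BraidedPower

/-! ### The braided coproduct of the tensor algebra and the braided binomials. -/

namespace Nichols

open Smash RightCrossedModule TensorPower BraidedPower

section Coproduct

variable {k H V : Type*} [CommRing k] [Ring H] [HopfAlgebra k H] [AddCommGroup V] [Module k V]
  (C : RightCrossedModule k H V)

local notation "T" => TensorAlgebra k V
local notation "hT" => isCrossedAlg_tensor C

/-- `p ⊗ q ↦ p v₀ ⊗ (q ◁ v₁)` on the tensor square of the tensor algebra. -/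
def braidedSnoc (z : T ⊗[k] T) (w : V ⊗[k] H) : T ⊗[k] T :=
  ract₂ hT z (TensorProduct.map ((inB hT).toLinearMap ∘ₗ TensorAlgebra.ι k)
    (inH hT).toLinearMap w)

theorem braidedSnoc_tmul (p q : T) (v : V) (a : H) : braidedSnoc C (p ⊗ₜ q) (v ⊗ₜ a)
    = (p * TensorAlgebra.ι k v) ⊗ₜ (tensorCrossed C).act a q := by
  simp [braidedSnoc, ract₂, ract_inB, ract_inH]

theorem braidedSnoc_add_left (z z' : T ⊗[k] T) (w : V ⊗[k] H) :
    braidedSnoc C (z + z') w = braidedSnoc C z w + braidedSnoc C z' w := by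
  simp [braidedSnoc]

theorem braidedSnoc_add_right (z : T ⊗[k] T) (w w' : V ⊗[k] H) :
    braidedSnoc C z (w + w') = braidedSnoc C z w + braidedSnoc C z w' := by
  simp [braidedSnoc]

theorem braidedSnoc_zero_left (w : V ⊗[k] H) : braidedSnoc C 0 w = 0 := by
  simp [braidedSnoc]

theorem braidedSnoc_zero_right (z : T ⊗[k] T) : braidedSnoc C z 0 = 0 := by
  simp [braidedSnoc]

/-- The summands `v₀ ⊗ v₁` and `1 ⊗ v` of the coproduct of `v` correspond to the two terms in the
recursion of the braided binomials. -/
theorem tensorComul_mul_ι (x : T) (v : V) : tensorComul C (x * TensorAlgebra.ι k v)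
    = braidedSnoc C (tensorComul C x) (C.coact v)
      + tensorComul C x * (1 ⊗ₜ TensorAlgebra.ι k v) := by
  rw [tensorComul, PrimGen.bcomul_mul, (tensorPrimGen C).g_ι', map_add, braidedSnoc]
  congr 1
  induction PrimGen.bcomul (tensorG C) x with
  | zero => simp
  | add s t hs ht => simp only [map_add, LinearMap.add_apply, add_mul, hs, ht]
  | tmul p q => simp [ract₂, ract_one, ract_inB]

/-- The product of `braidedSnoc` at the first factor and concatenation of the second factor. -/
def braidedSnocPair (z : T ⊗[k] T) : V ⊗[k] V →ₗ[k] T ⊗[k] T :=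
  LinearMap.mul' k (T ⊗[k] T) ∘ₗ TensorProduct.map
    (ract₂ hT z ∘ₗ TensorProduct.map ((inB hT).toLinearMap ∘ₗ TensorAlgebra.ι k)
      (inH hT).toLinearMap ∘ₗ C.coact)
    (TensorProduct.mk k T T 1 ∘ₗ TensorAlgebra.ι k)

theorem braidedSnocPair_tmul (z : T ⊗[k] T) (v w : V) : braidedSnocPair C z (v ⊗ₜ w)
    = braidedSnoc C z (C.coact v) * (1 ⊗ₜ TensorAlgebra.ι k w) := rfl

/-- For `z = p ⊗ q` both sides are `p v₀ ⊗ (q ◁ v₁)(u ◁ v₂)`: moving `v` past `q u` at once agrees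
with moving it first past `u` by the braiding and then past `q`. -/
theorem braidedSnocPair_braiding (z : T ⊗[k] T) (u v : V) :
    braidedSnocPair C z (C.braiding (u ⊗ₜ v))
      = braidedSnoc C (z * (1 ⊗ₜ TensorAlgebra.ι k u)) (C.coact v) := by
  induction z with
  | zero => simp [braidedSnocPair, braidedSnoc]
  | add s t hs ht =>
    have : braidedSnocPair C (s + t) = braidedSnocPair C s + braidedSnocPair C t := by
      ext
      simp [braidedSnocPair, add_mul]
    rw [this, LinearMap.add_apply, hs, ht, add_mul, braidedSnoc_add_left]
  | tmul p q =>
    let F : V ⊗[k] (H ⊗[k] H) →ₗ[k] T ⊗[k] T :=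
      TensorProduct.map (LinearMap.mulLeft k p ∘ₗ TensorAlgebra.ι k)
        (LinearMap.mul' k T ∘ₗ TensorProduct.map ((tensorCrossed C).act.flip q)
          ((tensorCrossed C).act.flip (TensorAlgebra.ι k u)))
    have h1 : ∀ w : V ⊗[k] H, braidedSnocPair C (p ⊗ₜ q)
        (TensorProduct.map LinearMap.id (TensorProduct.lift C.act.flip)
          (TensorProduct.leftComm k V V H (u ⊗ₜ w)))
        = F (TensorProduct.assoc k V H H (TensorProduct.map C.coact LinearMap.id w)) := by
      intro w
      induction w with
      | zero => simp
      | add s t hs ht => simp only [map_add, TensorProduct.tmul_add, hs, ht]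
      | tmul v a =>
        simp only [TensorProduct.leftComm_tmul, TensorProduct.map_tmul, LinearMap.id_apply,
          TensorProduct.lift.tmul, braidedSnocPair_tmul]
        induction C.coact v with
        | zero => simp [braidedSnoc_zero_right]
        | add s t hs ht =>
          simp only [map_add, TensorProduct.add_tmul, braidedSnoc_add_right, add_mul, hs, ht]
        | tmul v b => simp [braidedSnoc_tmul, F, tensor_act_ι]
    have h2 : ∀ w : V ⊗[k] H, braidedSnoc C (p ⊗ₜ q * (1 ⊗ₜ TensorAlgebra.ι k u)) w
        = F (TensorProduct.map LinearMap.id comul w) := by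
      intro w
      induction w with
      | zero => simp [braidedSnoc_zero_right]
      | add s t hs ht => simp only [map_add, braidedSnoc_add_right, hs, ht]
      | tmul v a =>
        rw [Algebra.TensorProduct.tmul_mul_tmul, braidedSnoc_tmul, (hT).act_mul]
        simp [F, conv]
    rw [h2, ← C.coact_coassoc, ← h1]
    rfl

/-- The chain `Ψ_{r+1} ⋯ Ψ_n` carries the appended vector leftwards into position `r + 1`, and the
coaction on `v` acts on each factor passed. The induction on `n` starts at `n = r`, where nothing is
passed and the counit axiom of the coaction applies. -/
theorem deconc_braidChain (n r : ℕ) (h : r ≤ n) (s : ⨂[k]^n V) (v : V) :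
    deconc (n + 1) (r + 1) (braidChain C.braiding (n + 1) (r + 1) (snoc s v))
      = braidedSnoc C (deconc n r s) (C.coact v) := by
  induction n, h using Nat.le_induction generalizing v with
  | base =>
    rw [braidChain_self, Module.End.one_apply, deconc_self, deconc_self, toTensorAlgebra_snoc]
    have : ∀ w : V ⊗[k] H, braidedSnoc C (toTensorAlgebra s ⊗ₜ 1) w
        = (toTensorAlgebra s * TensorAlgebra.ι k
          (TensorProduct.rid k V (TensorProduct.map LinearMap.id counit w))) ⊗ₜ 1 := by
      intro w
      induction w with
      | zero => simp [braidedSnoc_zero_right]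
      | add s t hs ht =>
        simp only [map_add, braidedSnoc_add_right, mul_add, TensorProduct.add_tmul, hs, ht]
      | tmul v a =>
        rw [braidedSnoc_tmul, (hT).act_one]
        simp [Algebra.algebraMap_eq_smul_one, TensorProduct.smul_tmul']
    rw [this, C.coact_counit]
  | succ n h ih =>
    induction s using snoc_induction with
    | zero => simp [snoc, braidedSnoc_zero_left]
    | add s t hs ht =>
      have : snoc (s + t) v = snoc s v + snoc t v := by simp [snoc, TensorProduct.add_tmul]
      rw [this, map_add, map_add, hs, ht, map_add, braidedSnoc_add_left]
    | snoc s u =>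
      rw [braidChain_succ _ _ _ h, Module.End.mul_apply, deconc_snoc h,
        ← braidedSnocPair_braiding]
      have e : braidAt C.braiding (n + 2) (n + 1) (snoc (snoc s u) v)
          = mulEquiv (n := n) (m := 2) (s ⊗ₜ squareEquiv k V (C.braiding (u ⊗ₜ v))) := by
        apply toTensorAlgebra_injective
        rw [toTensorAlgebra_braidAt]
        exact (toTensorAlgebra_mulEquiv s _).symm
      rw [e]
      induction C.braiding (u ⊗ₜ v) with
      | zero => simp
      | add x y hx hy =>
        rw [map_add, map_add, TensorProduct.tmul_add, map_add, map_add, map_add, hx, hy]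
      | tmul v w =>
        have e : mulEquiv (n := n) (m := 2) (s ⊗ₜ squareEquiv k V (v ⊗ₜ w))
            = snoc (snoc s v) w := by
          apply toTensorAlgebra_injective
          refine (toTensorAlgebra_mulEquiv s _).trans ?_
          rw [toTensorAlgebra_snoc, toTensorAlgebra_snoc, toTensorAlgebra_squareEquiv,
            _root_.mul_assoc]
          rfl
        rw [e, tensId_snoc, deconc_snoc (by omega), ih, braidedSnocPair_tmul]

/-- The braided coproduct of the tensor algebra is given by the braided binomials. -/
theorem tensorComul_toTensorAlgebra (n : ℕ) (t : ⨂[k]^n V) :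
    tensorComul C (toTensorAlgebra t)
      = ∑ r ∈ Finset.range (n + 1), deconc n r (binom C.braiding n r t) := by
  induction n with
  | zero =>
    obtain ⟨c, rfl⟩ := exists_eq_smul_one t
    simp only [map_smul, toTensorAlgebra_gOne', tensorComul, PrimGen.bcomul_one, zero_add,
      Finset.range_one, Finset.sum_singleton, binom, Module.End.one_apply, deconc_zero]
  | succ n ih =>
    induction t using snoc_induction with
    | zero => simp
    | add s t hs ht => simp only [map_add, hs, ht, Finset.sum_add_distrib]
    | snoc t v =>
      rw [toTensorAlgebra_snoc, tensorComul_mul_ι, ih, Finset.sum_range_succ' _ (n + 1)]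
      have h1 : ∀ r ∈ Finset.range (n + 1),
          deconc (n + 1) (r + 1) (binom C.braiding (n + 1) (r + 1) (snoc t v))
          = braidedSnoc C (deconc n r (binom C.braiding n r t)) (C.coact v)
            + deconc n (r + 1) (binom C.braiding n (r + 1) t) * (1 ⊗ₜ TensorAlgebra.ι k v) := by
        intro r hr
        rw [Finset.mem_range] at hr
        rw [binom, LinearMap.add_apply, Module.End.mul_apply, tensId_snoc, tensId_snoc, map_add,
          deconc_braidChain C n r (by omega)]
        congr 1
        -- At `r = n` the second summand involves the binomial `[n, n+1] = 0`, so the second family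
        -- of terms really stops at `n`.
        rcases Nat.lt_or_ge n (r + 1) with h | h
        · rw [binom_eq_zero _ _ _ h]
          simp [snoc]
        · rw [deconc_snoc h]
      rw [Finset.sum_congr rfl h1, Finset.sum_add_distrib, add_assoc]
      congr 1
      · generalize Finset.range (n + 1) = S
        induction S using Finset.cons_induction with
        | empty => simp [braidedSnoc_zero_left]
        | cons a s ha ih => rw [Finset.sum_cons, Finset.sum_cons, braidedSnoc_add_left, ih]
      · rw [binom, Module.End.one_apply, deconc_snoc (Nat.zero_le n), ← Finset.sum_mul,
          ← add_mul]
        congr 1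
        have h3 := Finset.sum_range_succ' (fun r => deconc n r (binom C.braiding n r t)) (n + 1)
        rw [Finset.sum_range_succ, binom_eq_zero _ _ _ (Nat.lt_succ_self n)] at h3
        simpa [binom] using h3

end Coproduct

/-! ### The linear part of a tensor and splitting off its first factor. -/

section Radical

variable {k H V : Type*} [CommRing k] [AddCommGroup V] [Module k V]

local notation "T" => TensorAlgebra k V
local notation "ε" => (TensorAlgebra.algebraMapInv : TensorAlgebra k V →ₐ[k] k)
local notation "ϖ" => (TensorAlgebra.ιInv : TensorAlgebra k V →ₗ[k] V)

theorem ε_ι (v : V) : ε (TensorAlgebra.ι k v) = 0 := by simp [TensorAlgebra.algebraMapInv]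

theorem ε_toTensorAlgebra (n : ℕ) (t : ⨂[k]^(n + 1) V) : ε (toTensorAlgebra t) = 0 := by
  induction t using snoc_induction with
  | zero => simp
  | add s t hs ht => simp only [map_add, hs, ht, add_zero]
  | snoc s v => rw [toTensorAlgebra_snoc, map_mul, ε_ι, mul_zero]

theorem ιInv_toTensorAlgebra (n : ℕ) (hn : n ≠ 1) (t : ⨂[k]^n V) : ϖ (toTensorAlgebra t) = 0 := by
  match n, hn, t with
  | 0, _, t =>
    obtain ⟨c, rfl⟩ := exists_eq_smul_one t
    rw [map_smul, toTensorAlgebra_gOne', map_smul, ιInv_one, smul_zero]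
  | n + 2, _, t =>
    induction t using snoc_induction with
    | zero => simp
    | add s t hs ht => simp only [map_add, hs, ht, add_zero]
    | snoc s v =>
      rw [toTensorAlgebra_snoc, ιInv_mul, ε_ι, ε_toTensorAlgebra, zero_smul, zero_smul, add_zero]

theorem map_ιInv_deconc (n r : ℕ) (hr : r ≠ 1) (t : ⨂[k]^n V) :
    TensorProduct.map ϖ LinearMap.id (deconc n r t) = 0 := by
  by_cases h : r ≤ n
  · induction t using mul_induction r (n - r) (Nat.add_sub_of_le h) with
    | zero => simp
    | add s t hs ht => simp only [map_add, hs, ht, add_zero]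
    | mul t p q ht =>
      rw [deconc_eq (Nat.add_sub_of_le h) t p q ht, TensorProduct.map_tmul,
        ιInv_toTensorAlgebra r hr, TensorProduct.zero_tmul]
  · simp [deconc, h]

/-- Splitting off the first factor of a tensor. -/
def consEquiv (k V : Type*) [CommRing k] [AddCommGroup V] [Module k V] (n : ℕ) :
    V ⊗[k] ⨂[k]^n V ≃ₗ[k] ⨂[k]^(n + 1) V :=
  (TensorProduct.congr single (LinearEquiv.refl k _)).trans
    (mulEquiv.trans (TensorPower.cast k V (Nat.add_comm 1 n)))

theorem toTensorAlgebra_consEquiv (n : ℕ) (v : V) (t : ⨂[k]^n V) :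
    toTensorAlgebra (consEquiv k V n (v ⊗ₜ t)) = TensorAlgebra.ι k v * toTensorAlgebra t := by
  simp [consEquiv, toTensorAlgebra_cast, toTensorAlgebra_mulEquiv, toTensorAlgebra_single]

theorem idTens_consEquiv (n : ℕ) (f : Module.End k (⨂[k]^n V)) (y : V ⊗[k] ⨂[k]^n V) :
    idTens f (consEquiv k V n y) = consEquiv k V n (TensorProduct.map LinearMap.id f y) := by
  induction y with
  | zero => simp
  | add s t hs ht => simp only [map_add, hs, ht]
  | tmul v t =>
    apply toTensorAlgebra_injective
    rw [toTensorAlgebra_idTens f _ (single v) t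
      (by rw [toTensorAlgebra_consEquiv, toTensorAlgebra_single]), TensorProduct.map_tmul,
      toTensorAlgebra_consEquiv, toTensorAlgebra_single]
    rfl

theorem map_ιInv_deconc_consEquiv (n : ℕ) (y : V ⊗[k] ⨂[k]^n V) :
    TensorProduct.map ϖ LinearMap.id (deconc (n + 1) 1 (consEquiv k V n y))
      = TensorProduct.map LinearMap.id toTensorAlgebra y := by
  induction y with
  | zero => simp
  | add s t hs ht => simp only [map_add, hs, ht]
  | tmul v t =>
    rw [deconc_eq (m := n) (Nat.add_comm 1 n) _ (single v) t
      (by rw [toTensorAlgebra_consEquiv, toTensorAlgebra_single]), toTensorAlgebra_single]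
    simp only [TensorProduct.map_tmul, LinearMap.id_apply]
    rw [TensorAlgebra.ι_leftInverse v]

end Radical

/-! ### The radical of the tensor algebra and the braided factorials. -/

section Factorial

variable {k H V : Type*} [Field k] [Ring H] [HopfAlgebra k H] [AddCommGroup V] [Module k V]
  (C : RightCrossedModule k H V)

local notation "T" => TensorAlgebra k V
local notation "ε" => (TensorAlgebra.algebraMapInv : TensorAlgebra k V →ₐ[k] k)
local notation "ϖ" => (TensorAlgebra.ιInv : TensorAlgebra k V →ₗ[k] V)

/-- The radical of the tensor algebra. -/
abbrev tensorRadical : Submodule k T := PrimGen.radical ε ϖ (tensorG C)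

/-- The projection to `V` on the first leg kills every component of the coproduct except `r = 1`,
which is given by the braided integer. -/
theorem deriv_toTensorAlgebra (n : ℕ) (t : ⨂[k]^(n + 1) V) :
    PrimGen.deriv ϖ (tensorG C) (toTensorAlgebra t) = TensorProduct.map LinearMap.id toTensorAlgebra
      ((consEquiv k V n).symm (binom C.braiding (n + 1) 1 t)) := by
  have h := tensorComul_toTensorAlgebra C (n + 1) t
  rw [tensorComul] at h
  rw [PrimGen.deriv, LinearMap.comp_apply, h, map_sum, Finset.sum_eq_single 1]
  · rw [← map_ιInv_deconc_consEquiv, LinearEquiv.apply_symm_apply]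
  · intro r _ hr
    exact map_ιInv_deconc _ _ hr _
  · intro h
    simp at h

/-- The `φ`-derivative on tensor powers. -/
def tensorPd (n : ℕ) (φ : Module.Dual k V) : ⨂[k]^(n + 1) V →ₗ[k] ⨂[k]^n V :=
  (TensorProduct.lid k _).toLinearMap ∘ₗ TensorProduct.map φ LinearMap.id
    ∘ₗ (consEquiv k V n).symm.toLinearMap ∘ₗ binom C.braiding (n + 1) 1

theorem pd_toTensorAlgebra (n : ℕ) (φ : Module.Dual k V) (t : ⨂[k]^(n + 1) V) :
    PrimGen.pd ϖ (tensorG C) φ (toTensorAlgebra t) = toTensorAlgebra (tensorPd C n φ t) := by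
  simp only [PrimGen.pd, LinearMap.comp_apply, deriv_toTensorAlgebra, tensorPd,
    LinearEquiv.coe_coe]
  induction (consEquiv k V n).symm (binom C.braiding (n + 1) 1 t) with
  | zero => simp
  | add s t hs ht => simp only [map_add, hs, ht]
  | tmul v t => simp

/-- Once the first factor is split off, the outer map in the recursion of the factorial is `id ⊗
[n]!`. A tensor in `V ⊗ V^{⊗n}` vanishes when all its contractions with functionals on `V` do, and
these contractions of the braided integer are the derivatives. -/
theorem factorial_succ_eq_zero (n : ℕ) (t : ⨂[k]^(n + 1) V) :
    factorial C.braiding (n + 1) t = 0 ↔ ∀ φ, factorial C.braiding n (tensorPd C n φ t) = 0 := by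
  obtain ⟨y, hy⟩ := (consEquiv k V n).surjective (binom C.braiding (n + 1) 1 t)
  have h1 : ∀ φ : Module.Dual k V, factorial C.braiding n (tensorPd C n φ t)
      = TensorProduct.lid k _ (TensorProduct.map φ LinearMap.id
        (TensorProduct.map LinearMap.id (factorial C.braiding n) y)) := by
    intro φ
    simp only [tensorPd, LinearMap.comp_apply, LinearEquiv.coe_coe, ← hy,
      LinearEquiv.symm_apply_apply]
    clear hy
    induction y with
    | zero => simp
    | add s t hs ht => simp only [map_add, hs, ht]
    | tmul v t => simp
  rw [factorial, Module.End.mul_apply, ← hy, idTens_consEquiv, LinearEquiv.map_eq_zero_iff]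
  constructor
  · intro h φ
    rw [h1, h, map_zero, map_zero]
  · intro h
    obtain ⟨z, hz⟩ := TensorProduct.mem_range_map_subtype_right (⊥ : Submodule k (⨂[k]^n V))
      (TensorProduct.map LinearMap.id (factorial C.braiding n) y) (fun φ => by
        rw [← h1, h]; exact Submodule.zero_mem _)
    rw [← hz]
    have : (⊥ : Submodule k (⨂[k]^n V)).subtype = 0 := by
      ext x
      exact (Submodule.mem_bot k).1 x.2
    rw [this, TensorProduct.map_zero_right, LinearMap.zero_apply]

theorem mem_tensorRadical_iff {x : T} : x ∈ tensorRadical C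
    ↔ ε x = 0 ∧ ∀ φ, PrimGen.pd ϖ (tensorG C) φ x ∈ tensorRadical C := by
  refine ⟨fun h => ⟨PrimGen.ε_eq_zero h, PrimGen.pd_mem_radical h⟩, fun h => ?_⟩
  rw [PrimGen.mem_radical]
  rintro (_ | ⟨φ, w⟩)
  · exact h.1
  · exact PrimGen.mem_radical.1 (h.2 φ) w

/-- Both conditions satisfy the same recursion: in positive degree each holds for `t` exactly when
it holds for all derivatives of `t`, and in degree zero each says `t = 0`. -/
theorem toTensorAlgebra_mem_radical (n : ℕ) (t : ⨂[k]^n V) :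
    toTensorAlgebra t ∈ tensorRadical C ↔ factorial C.braiding n t = 0 := by
  induction n with
  | zero =>
    rw [mem_tensorRadical_iff]
    obtain ⟨c, rfl⟩ := exists_eq_smul_one t
    rw [map_smul, toTensorAlgebra_gOne', factorial, Module.End.one_apply, map_smul, map_one,
      smul_eq_mul, _root_.mul_one]
    constructor
    · rintro ⟨rfl, _⟩
      rw [zero_smul]
    · intro h
      have h2 := congrArg ε (congrArg (toTensorAlgebra (R := k) (M := V)) h)
      rw [map_smul, toTensorAlgebra_gOne', map_smul, map_one, smul_eq_mul, _root_.mul_one, map_zero,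
        map_zero] at h2
      subst h2
      simp
  | succ n ih =>
    rw [mem_tensorRadical_iff, factorial_succ_eq_zero, ε_toTensorAlgebra]
    simp only [pd_toTensorAlgebra, ih, true_and]

/-- The homogeneous component of degree `n` on the tensor algebra. -/
def component (k V : Type*) [CommRing k] [AddCommGroup V] [Module k V] (n : ℕ) :
    TensorAlgebra k V →ₗ[k] TensorAlgebra k V :=
  toTensorAlgebra ∘ₗ DirectSum.component k ℕ (fun n => ⨂[k]^n V) n
    ∘ₗ TensorAlgebra.toDirectSum.toLinearMap

theorem component_self (n : ℕ) (t : ⨂[k]^n V) :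
    component k V n (toTensorAlgebra t) = toTensorAlgebra t := by
  simp only [component, LinearMap.comp_apply, AlgHom.toLinearMap_apply,
    toDirectSum_toTensorAlgebra]
  congr 1
  exact DirectSum.of_eq_same _ _

theorem component_of_ne {n m : ℕ} (h : n ≠ m) (t : ⨂[k]^m V) :
    component k V n (toTensorAlgebra t) = 0 := by
  simp only [component, LinearMap.comp_apply, AlgHom.toLinearMap_apply,
    toDirectSum_toTensorAlgebra]
  have : DirectSum.component k ℕ (fun n => ⨂[k]^n V) n
      (DirectSum.of (fun n => ⨂[k]^n V) m t) = 0 := DirectSum.of_eq_of_ne _ _ _ h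
  rw [this, map_zero]

theorem exists_sum_toTensorAlgebra (x : T) : ∃ S : Finset ℕ, x = ∑ n ∈ S, component k V n x := by
  classical
  refine ⟨DFinsupp.support (TensorAlgebra.toDirectSum x), ?_⟩
  conv_lhs => rw [← TensorAlgebra.ofDirectSum_toDirectSum x,
    ← DirectSum.sum_support_of (TensorAlgebra.toDirectSum x), map_sum]
  refine Finset.sum_congr rfl fun n _ => ?_
  rw [← toTensorAlgebra_eq]
  rfl

theorem toTensorAlgebra_induction {motive : T → Prop} (zero : motive 0)
    (add : ∀ x y, motive x → motive y → motive (x + y))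
    (of : ∀ n (t : ⨂[k]^n V), motive (toTensorAlgebra t)) (x : T) : motive x := by
  obtain ⟨S, hS⟩ := exists_sum_toTensorAlgebra x
  rw [hS]
  exact Finset.sum_induction _ motive add zero fun n _ => of n _

theorem pd_component (φ : Module.Dual k V) (n : ℕ) (x : T) :
    PrimGen.pd ϖ (tensorG C) φ (component k V (n + 1) x)
      = component k V n (PrimGen.pd ϖ (tensorG C) φ x) := by
  induction x using toTensorAlgebra_induction with
  | zero => simp
  | add x y hx hy => simp only [map_add, hx, hy]
  | of m t =>
    cases m with
    | zero =>
      rw [component_of_ne (Nat.succ_ne_zero n), map_zero]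
      obtain ⟨c, rfl⟩ := exists_eq_smul_one t
      simp [PrimGen.pd, PrimGen.deriv_one isLinearPart_ιInv]
    | succ m =>
      rw [pd_toTensorAlgebra]
      by_cases h : n = m
      · subst h
        rw [component_self, component_self, pd_toTensorAlgebra]
      · rw [component_of_ne h, component_of_ne (by omega), map_zero]

theorem ε_component_zero (x : T) : component k V 0 x = algebraMap k _ (ε x) := by
  induction x using toTensorAlgebra_induction with
  | zero => simp
  | add x y hx hy => simp only [map_add, hx, hy]
  | of m t =>
    cases m with
    | zero =>
      rw [component_self]
      obtain ⟨c, rfl⟩ := exists_eq_smul_one t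
      simp [Algebra.algebraMap_eq_smul_one]
    | succ m => rw [component_of_ne (Nat.succ_ne_zero m).symm, ε_toTensorAlgebra, map_zero]

/-- The radical is homogeneous because derivatives lower the degree by one and so commute with
taking components, up to this shift. -/
theorem component_mem_radical {x : T} (hx : x ∈ tensorRadical C) (n : ℕ) :
    component k V n x ∈ tensorRadical C := by
  induction n generalizing x with
  | zero => rw [ε_component_zero, PrimGen.ε_eq_zero hx, map_zero]; exact Submodule.zero_mem _
  | succ n ih =>
    rw [mem_tensorRadical_iff]
    refine ⟨ε_toTensorAlgebra n _, fun φ => ?_⟩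
    rw [pd_component]
    exact ih (PrimGen.pd_mem_radical hx φ)

/-- The radical of the tensor algebra is the sum of the kernels of the braided factorials. -/
theorem tensorRadical_eq : tensorRadical C
    = ⨆ n, (LinearMap.ker (factorial C.braiding n)).map toTensorAlgebra := by
  apply le_antisymm
  · intro x hx
    obtain ⟨S, hS⟩ := exists_sum_toTensorAlgebra x
    rw [hS]
    refine Submodule.sum_mem _ fun n _ => ?_
    refine Submodule.mem_iSup_of_mem n ?_
    have h := component_mem_radical C hx n
    exact ⟨_, (toTensorAlgebra_mem_radical C n _).1 h, rfl⟩
  · refine iSup_le fun n => ?_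
    rintro _ ⟨t, ht, rfl⟩
    exact (toTensorAlgebra_mem_radical C n t).2 ht

end Factorial

end Nichols

/-! ### Kernels of quotient maps and descent along surjections. -/

namespace RingQuot

/-- If the elements of a two-sided ideal `K` form a set of relations, `K` is the kernel of the
quotient map. -/
theorem mkAlgHom_eq_zero_iff {k R : Type*} [CommRing k] [Ring R] [Algebra k R] (r : R → R → Prop)
    (K : Submodule k R) (hl : ∀ x ∈ K, ∀ t, t * x ∈ K) (hr : ∀ x ∈ K, ∀ t, x * t ∈ K)
    (h : ∀ x y, r x y → x - y ∈ K) (x : R) (hx : RingQuot.mkAlgHom k r x = 0) : x ∈ K := by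
  let c : RingCon R :=
    { r := fun x y => x - y ∈ K
      iseqv := ⟨fun x => by simp, fun {x y} h => by rw [← neg_sub]; exact neg_mem h,
        fun {x y z} h h' => by rw [← sub_add_sub_cancel x y z]; exact add_mem h h'⟩
      add' := fun {a b c d} h h' => by rw [add_sub_add_comm]; exact add_mem h h'
      mul' := fun {a b c d} h h' => by
        have : a * c - b * d = (a - b) * c + b * (c - d) := by noncomm_ring
        rw [this]
        exact add_mem (hr _ h _) (hl _ h' _) }
  let f : RingQuot r →+* c.Quotient := RingQuot.lift ⟨c.mk', fun {x y} hxy => by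
    exact Quotient.sound (h x y hxy)⟩
  have h1 : c.mk' x = c.mk' 0 := by
    rw [map_zero, ← map_zero f, ← hx]
    change _ = f ((RingQuot.mkAlgHom k r : R →+* RingQuot r) x)
    rw [RingQuot.mkAlgHom_coe]
    exact (RingQuot.lift_mkRingHom_apply _ _ _).symm
  have h2 : x - 0 ∈ K := Quotient.exact h1
  rwa [sub_zero] at h2

end RingQuot

namespace AlgHom

variable {k A B E : Type*} [CommRing k] [Ring A] [Algebra k A] [Ring B] [Algebra k B] [Ring E]
  [Algebra k E]

/-- The algebra map induced on the image of a surjection. -/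
def descend (q : A →ₐ[k] B) (hq : Function.Surjective q) (f : A →ₐ[k] E)
    (h : ∀ x, q x = 0 → f x = 0) : B →ₐ[k] E :=
  let F := (q : A →+* B).liftOfSurjective hq ⟨(f : A →+* E), fun x hx => h x hx⟩
  { F with
    commutes' := fun r => by
      have := RingHom.liftOfRightInverse_comp_apply (q : A →+* B) _
        (Function.rightInverse_surjInv hq) ⟨(f : A →+* E), fun x hx => h x hx⟩ (algebraMap k A r)
      simp only [RingHom.coe_coe, AlgHom.commutes] at this
      exact this }

theorem descend_apply (q : A →ₐ[k] B) (hq : Function.Surjective q) (f : A →ₐ[k] E)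
    (h : ∀ x, q x = 0 → f x = 0) (x : A) : descend q hq f h (q x) = f x :=
  RingHom.liftOfRightInverse_comp_apply (q : A →+* B) _
    (Function.rightInverse_surjInv hq) ⟨(f : A →+* E), fun x hx => h x hx⟩ x

end AlgHom

/-! ### Structures on the quotient of the tensor algebra by its radical. -/

namespace Nichols

open Smash RightCrossedModule TensorPower BraidedPower

variable {k H V B : Type*} [Field k] [Ring H] [HopfAlgebra k H] [AddCommGroup V] [Module k V]
  [Ring B] [Algebra k B] (C : RightCrossedModule k H V)
  (q : TensorAlgebra k V →ₐ[k] B) (hq : Function.Surjective q)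
  (hker : ∀ x, q x = 0 ↔ x ∈ tensorRadical C)

local notation "T" => TensorAlgebra k V

include hq in
theorem adjoin_range_comp_ι :
    Algebra.adjoin k (Set.range (q.toLinearMap ∘ₗ TensorAlgebra.ι k)) = ⊤ := by
  rw [LinearMap.coe_comp, Set.range_comp, AlgHom.coe_toLinearMap, ← AlgHom.map_adjoin,
    TensorAlgebra.adjoin_range_ι, Algebra.map_top, AlgHom.range_eq_top]
  exact hq

/-- The action on the quotient. -/
def quotConv : B →ₐ[k] WithConv (H →ₗ[k] B) :=
  AlgHom.descend q hq ((Convolution.postcomp H q).comp (tensorConv C)) (by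
    intro x hx
    ext a
    change q ((tensorCrossed C).act a x) = 0
    rw [hker]
    exact (tensorPrimGen C).act_mem_radical isLinearPart_ιInv ((hker x).1 hx) a)

theorem quotConv_apply (x : T) (a : H) :
    quotConv C q hq hker (q x) a = q ((tensorCrossed C).act a x) := by
  rw [quotConv, AlgHom.descend_apply]
  rfl

/-- The coaction on the quotient. -/
def quotCoact : B →ₐ[k] B ⊗[k] H :=
  AlgHom.descend q hq ((Algebra.TensorProduct.map q (AlgHom.id k H)).comp (tensorCoact C))
    (by
      intro x hx
      obtain ⟨z, hz⟩ := (tensorPrimGen C).coact_mem_radical isLinearPart_ιInv ((hker x).1 hx)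
      change TensorProduct.map q.toLinearMap LinearMap.id ((tensorCrossed C).coact x) = 0
      rw [← hz, ← LinearMap.comp_apply, ← TensorProduct.map_comp]
      have : q.toLinearMap ∘ₗ (tensorRadical C).subtype = 0 := by
        ext y
        exact (hker y).2 y.2
      rw [this, TensorProduct.map_zero_left, LinearMap.zero_apply])

theorem quotCoact_apply (x : T) : quotCoact C q hq hker (q x)
    = TensorProduct.map q.toLinearMap LinearMap.id ((tensorCrossed C).coact x) := by
  rw [quotCoact, AlgHom.descend_apply]
  rfl

/-- The crossed module structure on the quotient of the tensor algebra by its radical. -/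
def quotCrossed : RightCrossedModule k H B :=
  ofGenerators C (q.toLinearMap ∘ₗ TensorAlgebra.ι k) (adjoin_range_comp_ι q hq)
    (quotConv C q hq hker) (fun v a => by
      rw [LinearMap.comp_apply, AlgHom.toLinearMap_apply, quotConv_apply, tensor_act_ι]
      rfl)
    (quotCoact C q hq hker) (fun v => by
      rw [LinearMap.comp_apply, AlgHom.toLinearMap_apply, quotCoact_apply, tensor_coact_ι]
      induction C.coact v with
      | zero => simp
      | add s t hs ht => simp only [map_add, hs, ht]
      | tmul a b => simp)

theorem quotCrossed_act (a : H) (x : T) :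
    (quotCrossed C q hq hker).act a (q x) = q ((tensorCrossed C).act a x) :=
  quotConv_apply C q hq hker x a

theorem quotCrossed_coact (x : T) : (quotCrossed C q hq hker).coact (q x)
    = TensorProduct.map q.toLinearMap LinearMap.id ((tensorCrossed C).coact x) :=
  quotCoact_apply C q hq hker x

theorem isCrossedAlg_quot : IsCrossedAlg (quotCrossed C q hq hker) := isCrossedAlg_ofGenerators ..

local notation "hQ" => isCrossedAlg_quot C q hq hker

/-- The quotient map of smash products. -/
def smashMap : TensorSmash C →ₐ[k] Smash hQ :=
  Smash.lift _ (inH hQ) ((inB hQ).comp q) (fun x a => by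
    have h := crossRel_inB hQ (q x) a
    simp only [AlgHom.toLinearMap_apply, AlgHom.comp_apply] at h ⊢
    rw [h]
    congr 2
    congr 1
    ext b
    simp [quotCrossed_act])

theorem smashMap_inH (a : H) : smashMap C q hq hker (inH _ a) = inH hQ a := lift_inH ..
theorem smashMap_inB (x : T) : smashMap C q hq hker (inB _ x) = inB hQ (q x) := lift_inB ..

theorem map_smashMap_untwist (z : T ⊗[k] T) :
    Algebra.TensorProduct.map (smashMap C q hq hker) (smashMap C q hq hker)
      (PrimGen.untwist (isCrossedAlg_tensor C) z)
    = PrimGen.untwist hQ (TensorProduct.map q.toLinearMap q.toLinearMap z) := by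
  induction z with
  | zero => simp
  | add s t hs ht => simp only [map_add, hs, ht]
  | tmul x y =>
    simp only [PrimGen.untwist, LinearMap.comp_apply, TensorProduct.map_tmul,
      AlgHom.toLinearMap_apply, quotCrossed_coact]
    induction (tensorCrossed C).coact x with
    | zero => simp
    | add s t hs ht => simp only [map_add, TensorProduct.add_tmul, hs, ht]
    | tmul a b => simp [smashMap_inB, smashMap_inH]

/-- The coproduct of the smash product on the quotient. -/
def quotG : B →ₐ[k] Smash hQ ⊗[k] Smash hQ :=
  AlgHom.descend q hq ((Algebra.TensorProduct.map (smashMap C q hq hker)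
      (smashMap C q hq hker)).comp (tensorG C)) (by
    intro x hx
    -- The coproduct into the smash product is the untwisted braided coproduct, for which the
    -- radical is a coideal.
    rw [AlgHom.comp_apply, ← (tensorPrimGen C).untwist_bcomul, map_smashMap_untwist,
      (tensorPrimGen C).map_bcomul_eq_zero q.toLinearMap (fun y hy => (hker y).2 hy)
        ((hker x).1 hx), map_zero])

theorem quotG_apply (x : T) : quotG C q hq hker (q x)
    = Algebra.TensorProduct.map (smashMap C q hq hker) (smashMap C q hq hker) (tensorG C x) := by
  rw [quotG, AlgHom.descend_apply]
  rfl

/-- The counit on the quotient. -/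
def quotCounit : B →ₐ[k] k :=
  AlgHom.descend q hq TensorAlgebra.algebraMapInv (by
    intro x hx
    exact PrimGen.ε_eq_zero ((hker x).1 hx))

theorem quotCounit_apply (x : T) :
    quotCounit C q hq hker (q x) = TensorAlgebra.algebraMapInv x := by
  rw [quotCounit, AlgHom.descend_apply]

theorem quotPrimGen : PrimGen hQ C (q.toLinearMap ∘ₗ TensorAlgebra.ι k)
    (quotG C q hq hker) (quotCounit C q hq hker) where
  adjoin := adjoin_range_comp_ι q hq
  act_ι a v := by
    rw [LinearMap.comp_apply, AlgHom.toLinearMap_apply, quotCrossed_act, tensor_act_ι]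
    rfl
  coact_ι v := by
    rw [LinearMap.comp_apply, AlgHom.toLinearMap_apply, quotCrossed_coact, tensor_coact_ι,
      ← LinearMap.comp_apply, ← TensorProduct.map_comp]
    rfl
  g_ι v := by
    rw [LinearMap.comp_apply, AlgHom.toLinearMap_apply, quotG_apply, (tensorPrimGen C).g_ι,
      primComul, primComul, quotCrossed_coact, map_add]
    congr 1
    · induction (tensorCrossed C).coact (TensorAlgebra.ι k v) with
      | zero => simp
      | add s t hs ht => simp only [map_add, hs, ht]
      | tmul a b => simp [smashMap_inB, smashMap_inH]
    · simp [smashMap_inB]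
  ε_ι v := by
    rw [LinearMap.comp_apply, AlgHom.toLinearMap_apply, quotCounit_apply,
      (tensorPrimGen C).ε_ι]

theorem bcomul_quotG (x : T) : PrimGen.bcomul (quotG C q hq hker) (q x)
    = TensorProduct.map q.toLinearMap q.toLinearMap (tensorComul C x) := by
  have h : ∀ w : TensorSmash C, proj hQ (smashMap C q hq hker w) = q (proj _ w) := by
    intro w
    obtain ⟨w, rfl⟩ := (of _).surjective w
    induction w with
    | zero => simp
    | add s t hs ht => simp only [map_add, hs, ht]
    | tmul a x =>
      rw [← inH_mul_inB, map_mul, smashMap_inH, smashMap_inB, proj_inH_mul, proj_inH_mul,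
        proj_inB, proj_inB, map_smul]
  rw [PrimGen.bcomul, LinearMap.comp_apply, AlgHom.toLinearMap_apply, quotG_apply, tensorComul,
    PrimGen.bcomul, LinearMap.comp_apply, AlgHom.toLinearMap_apply]
  induction tensorG C x with
  | zero => simp
  | add s t hs ht => simp only [map_add, hs, ht]
  | tmul a b => simp [h]

end Nichols

/-! ### Parity operators and ordinary covers of graded algebras. -/

section Graded

variable {k Ω M : Type*} [CommRing k] [Ring Ω] [Algebra k Ω] [AddCommGroup M] [Module k M]
  (𝒜 : ℕ → Submodule k Ω) [GradedAlgebra 𝒜]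

theorem DirectSum.toModule_decompose_of_mem (f : ∀ n, 𝒜 n →ₗ[k] M) {n : ℕ} {w : Ω} (hw : w ∈ 𝒜 n) :
    DirectSum.toModule k ℕ M f (DirectSum.decomposeLinearEquiv 𝒜 w) = f n ⟨w, hw⟩ := by
  rw [DirectSum.decomposeLinearEquiv_apply, DirectSum.decompose_of_mem 𝒜 hw]
  exact DirectSum.toModule_lof k n _

theorem gradeSign_of_mem {n : ℕ} {w : Ω} (hw : w ∈ 𝒜 n) : gradeSign 𝒜 w = (-1 : k) ^ n • w :=
  DirectSum.toModule_decompose_of_mem 𝒜 _ hw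

end Graded

/-- An ordinary algebra `Ω'` containing a graded algebra `Ω` and an element `G` of order two which
implements the parity operator of `Ω` by conjugation, so that `Ω' = Ω ⊕ G Ω`. -/
structure IsSuperCover {k Ω Ω' : Type*} [CommRing k] [Ring Ω] [Algebra k Ω] [Ring Ω'] [Algebra k Ω']
    (𝒜 : ℕ → Submodule k Ω) [GradedAlgebra 𝒜] (I : Ω →ₐ[k] Ω') (P : Ω' →ₗ[k] Ω) (G : Ω') :
    Prop where
  proj_incl : ∀ w, P (I w) = w
  G_mul_G : G * G = 1
  proj_G_mul : ∀ w, P (G * w) = P w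
  incl_mul_G : ∀ n, ∀ w ∈ 𝒜 n, I w * G = (-1 : k) ^ n • (G * I w)
  span : ∀ w', ∃ w₀ w₁, w' = I w₀ + G * I w₁

namespace IsSuperCover

variable {k Ω Ω' : Type*} [CommRing k] [Ring Ω] [Algebra k Ω] [Ring Ω'] [Algebra k Ω']
    {𝒜 : ℕ → Submodule k Ω} [GradedAlgebra 𝒜] {I : Ω →ₐ[k] Ω'} {P : Ω' →ₗ[k] Ω} {G : Ω'}
    (S : IsSuperCover 𝒜 I P G)

/-- The linear map `w ↦ w ⊗ G^|w|`. -/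
def twistLinear (𝒜 : ℕ → Submodule k Ω) [GradedAlgebra 𝒜] (I : Ω →ₐ[k] Ω') (G : Ω') :
    Ω →ₗ[k] Ω' ⊗[k] Ω' :=
  DirectSum.toModule k ℕ _ (fun n => (TensorProduct.mk k Ω' Ω').flip (G ^ n) ∘ₗ I.toLinearMap
    ∘ₗ (𝒜 n).subtype) ∘ₗ (DirectSum.decomposeLinearEquiv 𝒜).toLinearMap

theorem twistLinear_of_mem {n : ℕ} {w : Ω} (hw : w ∈ 𝒜 n) :
    twistLinear 𝒜 I G w = I w ⊗ₜ (G ^ n) :=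
  DirectSum.toModule_decompose_of_mem 𝒜 _ hw

/-- The algebra map `w ↦ w ⊗ G^|w|`. -/
def twist (𝒜 : ℕ → Submodule k Ω) [GradedAlgebra 𝒜] (I : Ω →ₐ[k] Ω') (G : Ω') :
    Ω →ₐ[k] Ω' ⊗[k] Ω' :=
  AlgHom.ofLinearMap (twistLinear 𝒜 I G)
    (by rw [twistLinear_of_mem SetLike.GradedOne.one_mem, map_one, pow_zero]; rfl)
    (fun x y => by
      induction x using DirectSum.Decomposition.inductionOn 𝒜 with
      | zero => simp
      | add x x' hx hx' => simp only [map_add, add_mul, hx, hx']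
      | homogeneous x =>
        induction y using DirectSum.Decomposition.inductionOn 𝒜 with
        | zero => simp
        | add x x' hx hx' => simp only [map_add, mul_add, hx, hx']
        | homogeneous y =>
          rw [twistLinear_of_mem (SetLike.GradedMul.mul_mem x.2 y.2), twistLinear_of_mem x.2,
            twistLinear_of_mem y.2, map_mul, pow_add, Algebra.TensorProduct.tmul_mul_tmul])

theorem twist_of_mem {n : ℕ} {w : Ω} (hw : w ∈ 𝒜 n) :
    twist 𝒜 I G w = I w ⊗ₜ (G ^ n) := twistLinear_of_mem hw

include S

theorem incl_mul_G_pow (m : ℕ) {n : ℕ} {w : Ω} (hw : w ∈ 𝒜 n) :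
    I w * G ^ m = (-1 : k) ^ (m * n) • (G ^ m * I w) := by
  induction m with
  | zero => simp
  | succ m ih =>
    rw [pow_succ, ← mul_assoc, ih, smul_mul_assoc, mul_assoc, S.incl_mul_G n w hw, mul_smul_comm,
      smul_smul, ← mul_assoc, ← pow_add]
    congr 2
    ring

/-- The algebra map `p ⊗ q ↦ p ⊗ G^|p| q` from the super tensor square of `Ω` to the tensor square
of `Ω'`. -/
def tensorTwist : GradedTensorProduct k 𝒜 𝒜 →ₐ[k] Ω' ⊗[k] Ω' :=
  GradedTensorProduct.lift 𝒜 𝒜 (twist 𝒜 I G) (Algebra.TensorProduct.includeRight.comp I)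
    -- Moving an element of degree `j` past `G^i` in the second leg produces exactly the Koszul sign
    -- `(-1)^{ij}`.
    (fun i j a b => by
      rw [twist_of_mem a.2, AlgHom.comp_apply, Algebra.TensorProduct.includeRight_apply,
        Algebra.TensorProduct.tmul_mul_tmul, Algebra.TensorProduct.tmul_mul_tmul, one_mul,
        mul_one, S.incl_mul_G_pow i b.2]
      rw [TensorProduct.tmul_smul, mul_comm i j]
      have e : ∀ (n : ℕ) (z : Ω' ⊗[k] Ω'), ((-1 : ℤˣ) ^ n) • z = (-1 : k) ^ n • z := by
        intro n z
        rcases Nat.even_or_odd n with h | h <;> simp [h.neg_one_pow, Units.smul_def]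
      refine Eq.trans ?_ (e _ _).symm
      rw [smul_smul, ← mul_pow, neg_mul_neg, one_mul, one_pow, one_smul])

theorem tensorTwist_of_mem {n : ℕ} {w : Ω} (hw : w ∈ 𝒜 n) (y : Ω) :
    S.tensorTwist (GradedTensorProduct.of k 𝒜 𝒜 (w ⊗ₜ y)) = I w ⊗ₜ (G ^ n * I y) := by
  change twist 𝒜 I G w * _ = _
  rw [twist_of_mem hw]
  simp

theorem proj_G_pow_mul (n : ℕ) (w : Ω') : P (G ^ n * w) = P w := by
  induction n with
  | zero => simp
  | succ n ih => rw [pow_succ', mul_assoc, S.proj_G_mul, ih]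

/-- `P` forgets left factors `G`, so `P ⊗ P` is a left inverse of the twist. -/
theorem map_proj_tensorTwist (z : Ω ⊗[k] Ω) :
    TensorProduct.map P P (S.tensorTwist (GradedTensorProduct.of k 𝒜 𝒜 z)) = z := by
  induction z with
  | zero => simp
  | add s t hs ht => simp only [map_add, hs, ht]
  | tmul x y =>
    induction x using DirectSum.Decomposition.inductionOn 𝒜 with
    | zero => simp
    | add x x' hx hx' => simp only [map_add, TensorProduct.add_tmul, hx, hx']
    | homogeneous x =>
      rw [S.tensorTwist_of_mem x.2, TensorProduct.map_tmul, S.proj_incl, S.proj_G_pow_mul,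
        S.proj_incl]

theorem tensorTwist_injective : Function.Injective S.tensorTwist := by
  intro x y h
  obtain ⟨x, rfl⟩ := (GradedTensorProduct.of k 𝒜 𝒜).surjective x
  obtain ⟨y, rfl⟩ := (GradedTensorProduct.of k 𝒜 𝒜).surjective y
  rw [← S.map_proj_tensorTwist x, h, S.map_proj_tensorTwist]

omit S in
/-- The coproduct induced on `Ω` by a coproduct on `Ω'`. -/
def comul (I : Ω →ₐ[k] Ω') (P : Ω' →ₗ[k] Ω) (D : Ω' →ₐ[k] Ω' ⊗[k] Ω') : Ω →ₗ[k] Ω ⊗[k] Ω :=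
  TensorProduct.map P P ∘ₗ D.toLinearMap ∘ₗ I.toLinearMap

section Comul

variable {D : Ω' →ₐ[k] Ω' ⊗[k] Ω'} (hD : ∀ w, D (I w) ∈ S.tensorTwist.range) 

include hD

theorem tensorTwist_comul (w : Ω) :
    S.tensorTwist (GradedTensorProduct.of k 𝒜 𝒜 (comul I P D w)) = D (I w) := by
  obtain ⟨z, hz⟩ := hD w
  obtain ⟨z, rfl⟩ := (GradedTensorProduct.of k 𝒜 𝒜).surjective z
  have hz' : S.tensorTwist (GradedTensorProduct.of k 𝒜 𝒜 z) = D (I w) := hz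
  rw [comul, LinearMap.comp_apply, LinearMap.comp_apply, AlgHom.toLinearMap_apply,
    AlgHom.toLinearMap_apply, ← hz', S.map_proj_tensorTwist]

/-- Multiplicativity of `D` is pulled back along the injective algebra map `tensorTwist`; the Koszul
signs are already contained in the latter. -/
theorem comul_mul (x y : Ω) : GradedTensorProduct.of k 𝒜 𝒜 (comul I P D (x * y))
    = GradedTensorProduct.of k 𝒜 𝒜 (comul I P D x)
      * GradedTensorProduct.of k 𝒜 𝒜 (comul I P D y) := by
  apply S.tensorTwist_injective
  refine Eq.trans ?_ (map_mul S.tensorTwist _ _).symm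
  rw [S.tensorTwist_comul hD, S.tensorTwist_comul hD, S.tensorTwist_comul hD, map_mul, map_mul]

end Comul

section Coalgebra

variable {D : Ω' →ₐ[k] Ω' ⊗[k] Ω'} (hG : D G = G ⊗ₜ G) (E : Ω' →ₐ[k] k) (hE : E G = 1)
include hG

/-- `G` is group-like and `P` ignores it, so `P` is compatible with the coproducts although it need
not be multiplicative. This is what carries coassociativity over to `Ω`. -/
theorem comul_proj (w : Ω') : comul I P D (P w) = TensorProduct.map P P (D w) := by
  obtain ⟨w₀, w₁, rfl⟩ := S.span w
  have h : ∀ z : Ω' ⊗[k] Ω', TensorProduct.map P P (G ⊗ₜ G * z) = TensorProduct.map P P z := by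
    intro z
    induction z with
    | zero => simp
    | add s t hs ht => simp only [map_add, mul_add, hs, ht]
    | tmul x y => simp [S.proj_G_mul]
  simp only [map_add, S.proj_G_mul, S.proj_incl, map_mul, hG, h]
  rfl

theorem comul_coassoc 
    (hc : ∀ w, TensorProduct.assoc k Ω' Ω' Ω' (TensorProduct.map D.toLinearMap LinearMap.id (D w))
      = TensorProduct.map LinearMap.id D.toLinearMap (D w)) (w : Ω) :
    TensorProduct.assoc k Ω Ω Ω (TensorProduct.map (comul I P D) LinearMap.id (comul I P D w))
      = TensorProduct.map LinearMap.id (comul I P D) (comul I P D w) := by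
  have h := congrArg (TensorProduct.map P (TensorProduct.map P P)) (hc (I w))
  have h1 : ∀ z : Ω' ⊗[k] Ω', TensorProduct.map P (TensorProduct.map P P)
      (TensorProduct.assoc k Ω' Ω' Ω' (TensorProduct.map D.toLinearMap LinearMap.id z))
      = TensorProduct.assoc k Ω Ω Ω (TensorProduct.map (comul I P D) LinearMap.id
        (TensorProduct.map P P z)) := by
    intro z
    induction z with
    | zero => simp
    | add s t hs ht => simp only [map_add, hs, ht]
    | tmul x y =>
      simp only [TensorProduct.map_tmul, LinearMap.id_apply, S.comul_proj hG,
        AlgHom.toLinearMap_apply]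
      induction D x with
      | zero => simp
      | add s t hs ht => simp only [map_add, TensorProduct.add_tmul, hs, ht]
      | tmul x y => simp
  have h2 : ∀ z : Ω' ⊗[k] Ω', TensorProduct.map P (TensorProduct.map P P)
      (TensorProduct.map LinearMap.id D.toLinearMap z)
      = TensorProduct.map LinearMap.id (comul I P D) (TensorProduct.map P P z) := by
    intro z
    induction z with
    | zero => simp
    | add s t hs ht => simp only [map_add, hs, ht]
    | tmul x y => simp [S.comul_proj hG]
  rw [h1, h2] at h
  exact h

omit hG
include hE

theorem counit_proj (w : Ω') : E (I (P w)) = E w := by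
  obtain ⟨w₀, w₁, rfl⟩ := S.span w
  simp only [map_add, S.proj_G_mul, S.proj_incl, map_mul, hE, one_mul]

theorem counit_comul_left
    (hc : ∀ w, TensorProduct.lid k Ω' (TensorProduct.map E.toLinearMap LinearMap.id (D w)) = w)
    (w : Ω) : TensorProduct.lid k Ω
      (TensorProduct.map (E.comp I).toLinearMap LinearMap.id (comul I P D w)) = w := by
  have h := congrArg P (hc (I w))
  have h1 : ∀ z : Ω' ⊗[k] Ω', P (TensorProduct.lid k Ω'
      (TensorProduct.map E.toLinearMap LinearMap.id z))
      = TensorProduct.lid k Ω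
      (TensorProduct.map (E.comp I).toLinearMap LinearMap.id (TensorProduct.map P P z)) := by
    intro z
    induction z with
    | zero => simp
    | add s t hs ht => simp only [map_add, hs, ht]
    | tmul x y => simp [S.counit_proj E hE]
  rw [h1, S.proj_incl] at h
  exact h

theorem counit_comul_right
    (hc : ∀ w, TensorProduct.rid k Ω' (TensorProduct.map LinearMap.id E.toLinearMap (D w)) = w)
    (w : Ω) : TensorProduct.rid k Ω
      (TensorProduct.map LinearMap.id (E.comp I).toLinearMap (comul I P D w)) = w := by
  have h := congrArg P (hc (I w))
  have h1 : ∀ z : Ω' ⊗[k] Ω', P (TensorProduct.rid k Ω'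
      (TensorProduct.map LinearMap.id E.toLinearMap z))
      = TensorProduct.rid k Ω
      (TensorProduct.map LinearMap.id (E.comp I).toLinearMap (TensorProduct.map P P z)) := by
    intro z
    induction z with
    | zero => simp
    | add s t hs ht => simp only [map_add, hs, ht]
    | tmul x y => simp [S.counit_proj E hE]
  rw [h1, S.proj_incl] at h
  exact h

end Coalgebra

section Differential

omit S in
/-- The graded commutator with `θ`. -/
def innerDiff (𝒜 : ℕ → Submodule k Ω) [GradedAlgebra 𝒜] (θ : Ω) : Ω →ₗ[k] Ω :=
  LinearMap.mulLeft k θ - LinearMap.mulRight k θ ∘ₗ gradeSign 𝒜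

omit S in
theorem innerDiff_apply (θ w : Ω) : innerDiff 𝒜 θ w = θ * w - gradeSign 𝒜 w * θ := rfl

omit S in
theorem innerDiff_of_mem (θ : Ω) {n : ℕ} {w : Ω} (hw : w ∈ 𝒜 n) :
    innerDiff 𝒜 θ w = θ * w - (-1) ^ n * (w * θ) := by
  rw [innerDiff_apply, gradeSign_of_mem 𝒜 hw, smul_mul_assoc, Algebra.smul_def]
  simp

theorem incl_gradeSign (w : Ω) : I (gradeSign 𝒜 w) = G * I w * G := by
  induction w using DirectSum.Decomposition.inductionOn 𝒜 with
  | zero => simp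
  | add x x' hx hx' => simp only [map_add, mul_add, add_mul, hx, hx']
  | homogeneous x =>
    rw [gradeSign_of_mem 𝒜 x.2, mul_assoc, S.incl_mul_G _ _ x.2, mul_smul_comm, ← mul_assoc,
      S.G_mul_G, one_mul, map_smul]

omit S in
-- A graded commutator with an odd element is a super-derivation, and its square is the ordinary
-- commutator with `θ²`.
theorem isDifferentialExterior_innerDiff (θ : Ω) (hθ : θ ∈ 𝒜 1) (h2 : θ * θ = 0) :
    IsDifferentialExterior 𝒜 (innerDiff 𝒜 θ) := by
  have hdeg : ∀ n, ∀ x ∈ 𝒜 n, innerDiff 𝒜 θ x ∈ 𝒜 (n + 1) := by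
    intro n x hx
    rw [innerDiff_apply, gradeSign_of_mem 𝒜 hx]
    refine sub_mem ?_ ?_
    · rw [add_comm]
      exact SetLike.GradedMul.mul_mem hθ hx
    · rw [smul_mul_assoc]
      exact Submodule.smul_mem _ _ (SetLike.GradedMul.mul_mem hx hθ)
  refine ⟨hdeg, ?_, ?_⟩
  · intro n x hx y
    induction y using DirectSum.Decomposition.inductionOn 𝒜 with
    | zero => simp
    | add y y' hy hy' => simp only [map_add, mul_add, hy, hy']; abel
    | @homogeneous m y =>
      rw [innerDiff_of_mem θ (SetLike.GradedMul.mul_mem hx y.2), innerDiff_of_mem θ hx,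
        innerDiff_of_mem θ y.2, pow_add]
      rcases neg_one_pow_eq_or Ω n with h | h <;> rcases neg_one_pow_eq_or Ω m with h' | h' <;>
        rw [h, h'] <;> noncomm_ring
  · intro x
    induction x using DirectSum.Decomposition.inductionOn 𝒜 with
    | zero => simp
    | add y y' hy hy' => simp only [map_add, hy, hy', add_zero]
    | @homogeneous m y =>
      rw [innerDiff_of_mem θ (hdeg m y y.2), innerDiff_of_mem θ y.2, pow_succ]
      have e1 : θ * (θ * (y : Ω)) = 0 := by rw [← mul_assoc, h2, zero_mul]
      have e2 : (y : Ω) * θ * θ = 0 := by rw [mul_assoc, h2, mul_zero]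
      rcases neg_one_pow_eq_or Ω m with h | h <;> rw [h] <;>
        simp [mul_sub, sub_mul, mul_add, add_mul, e1, e2, mul_assoc]

/-- In the cover, the graded commutator is `θ w - (G w G) θ`. Put `τ = θ ⊗ G + 1 ⊗ θ`. The
right-hand side becomes the graded commutator of `τ` with `Δw`, formed with `G ⊗ G`; the left-hand
side becomes that of `Δθ = (G ⊗ G)u + τ`. Their difference is `(G ⊗ G)` times the commutator of `u`
with `Δw`, which is zero. -/
theorem comul_innerDiff {D : Ω' →ₐ[k] Ω' ⊗[k] Ω'} (hD : ∀ w, D (I w) ∈ S.tensorTwist.range)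
    (hG : D G = G ⊗ₜ G) {θ : Ω} (hθ : θ ∈ 𝒜 1) (u : Ω' ⊗[k] Ω')
    (hu : D (I θ) = G ⊗ₜ G * u + (I θ ⊗ₜ G + 1 ⊗ₜ I θ))
    (hc : ∀ w, u * D (I w) = D (I w) * u) (w : Ω) :
    comul I P D (innerDiff 𝒜 θ w)
      = TensorProduct.map (innerDiff 𝒜 θ) LinearMap.id (comul I P D w)
        + TensorProduct.map (gradeSign 𝒜) (innerDiff 𝒜 θ) (comul I P D w) := by
  have key : ∀ z : Ω ⊗[k] Ω, S.tensorTwist (GradedTensorProduct.of k 𝒜 𝒜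
      (TensorProduct.map (innerDiff 𝒜 θ) LinearMap.id z
        + TensorProduct.map (gradeSign 𝒜) (innerDiff 𝒜 θ) z))
      = (I θ ⊗ₜ G + 1 ⊗ₜ I θ) * S.tensorTwist (GradedTensorProduct.of k 𝒜 𝒜 z)
        - G ⊗ₜ G * S.tensorTwist (GradedTensorProduct.of k 𝒜 𝒜 z) * G ⊗ₜ G
          * (I θ ⊗ₜ G + 1 ⊗ₜ I θ) := by
    intro z
    induction z with
    | zero => simp
    | add s t hs ht =>
      have : ∀ a b c d : Ω ⊗[k] Ω, a + b + (c + d) = a + c + (b + d) := fun _ _ _ _ => by abel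
      rw [map_add (TensorProduct.map _ _), map_add (TensorProduct.map _ _), this, map_add, map_add,
        hs, ht, map_add, map_add]
      simp only [mul_add, add_mul]
      abel
    | tmul x y =>
      induction x using DirectSum.Decomposition.inductionOn 𝒜 with
      | zero => simp
      | add x x' hx hx' =>
        have : ∀ a b c d : Ω ⊗[k] Ω, a + b + (c + d) = a + c + (b + d) := fun _ _ _ _ => by abel
        rw [TensorProduct.add_tmul, map_add (TensorProduct.map _ _),
          map_add (TensorProduct.map _ _), this, map_add, map_add,
          hx, hx', map_add, map_add]
        simp only [mul_add, add_mul]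
        abel
      | @homogeneous n x =>
        have hdx : innerDiff 𝒜 θ x ∈ 𝒜 (n + 1) := by
          rw [innerDiff_apply, gradeSign_of_mem 𝒜 x.2]
          refine sub_mem ?_ ?_
          · rw [add_comm]
            exact SetLike.GradedMul.mul_mem hθ x.2
          · rw [smul_mul_assoc]
            exact Submodule.smul_mem _ _ (SetLike.GradedMul.mul_mem x.2 hθ)
        have e1 : G * I x * G = (-1 : k) ^ n • I x := by
          rw [mul_assoc, S.incl_mul_G n x x.2, mul_smul_comm, ← mul_assoc, S.G_mul_G, one_mul]
        have e2 : I θ * (G ^ n * I y) = (-1 : k) ^ n • (G ^ n * (I θ * I y)) := by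
          rw [← mul_assoc, S.incl_mul_G_pow n hθ, smul_mul_assoc, mul_assoc, mul_one]
        have e3 : G * (G ^ n * I y) * G * G = G ^ (n + 1) * I y := by
          rw [mul_assoc _ G G, S.G_mul_G, mul_one, pow_succ', mul_assoc]
        have e4 : G * (G ^ n * I y) * G * I θ = G ^ n * (G * I y * G * I θ) := by
          rw [← mul_assoc, ← pow_succ', pow_succ]
          simp only [mul_assoc]
        rw [TensorProduct.map_tmul, TensorProduct.map_tmul, LinearMap.id_apply, map_add, map_add,
          S.tensorTwist_of_mem hdx, gradeSign_of_mem 𝒜 x.2, TensorProduct.smul_tmul,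
          S.tensorTwist_of_mem x.2, S.tensorTwist_of_mem x.2]
        simp only [mul_add, add_mul, Algebra.TensorProduct.tmul_mul_tmul, one_mul, mul_one, e1, e2,
          e3, e4, innerDiff_apply, gradeSign_of_mem 𝒜 x.2, map_sub, map_mul, map_smul,
          S.incl_gradeSign, TensorProduct.sub_tmul, TensorProduct.tmul_sub, mul_sub,
          TensorProduct.tmul_smul, mul_smul_comm, smul_sub, smul_mul_assoc,
          TensorProduct.smul_tmul']
        simp only [pow_succ', mul_assoc]
        abel
  apply (GradedTensorProduct.of k 𝒜 𝒜).injective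
  apply S.tensorTwist_injective
  rw [key, S.tensorTwist_comul hD, S.tensorTwist_comul hD, innerDiff_apply, map_sub, map_mul,
    map_mul, S.incl_gradeSign, map_sub, map_mul, map_mul, map_mul, map_mul, hG, hu]
  have hGG : (G ⊗ₜ[k] G) * (G ⊗ₜ[k] G) = 1 := by
    rw [Algebra.TensorProduct.tmul_mul_tmul, S.G_mul_G]; rfl
  have h3 : G ⊗ₜ[k] G * u * D (I w) = G ⊗ₜ G * D (I w) * G ⊗ₜ G * (G ⊗ₜ G * u) := by
    rw [mul_assoc, hc, mul_assoc (_ * _) (G ⊗ₜ[k] G), ← mul_assoc (G ⊗ₜ[k] G) (G ⊗ₜ[k] G), hGG,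
      one_mul, mul_assoc]
  rw [add_mul, mul_add, h3]
  abel

end Differential

end IsSuperCover

/-! ### Antipodes on graded coalgebras by geometric series. -/

namespace GradedCoalgebra

section TensorDeg

variable {k M N : Type*} [CommRing k] [AddCommGroup M] [Module k M] [AddCommGroup N] [Module k N]

/-- The degree `n` part of a tensor product of graded modules. -/
def tensorDeg (𝒜 : ℕ → Submodule k M) (ℬ : ℕ → Submodule k N) (n : ℕ) : Submodule k (M ⊗[k] N) :=
  ⨆ p ∈ Finset.HasAntidiagonal.antidiagonal n,
    LinearMap.range (TensorProduct.map (𝒜 p.1).subtype (ℬ p.2).subtype)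

variable {𝒜 : ℕ → Submodule k M} {ℬ : ℕ → Submodule k N}

theorem tmul_mem_tensorDeg {i j n : ℕ} (h : i + j = n) {x : M} {y : N} (hx : x ∈ 𝒜 i)
    (hy : y ∈ ℬ j) : x ⊗ₜ y ∈ tensorDeg 𝒜 ℬ n :=
  Submodule.mem_iSup_of_mem (i, j) (Submodule.mem_iSup_of_mem
    (Finset.HasAntidiagonal.mem_antidiagonal.2 h) ⟨⟨x, hx⟩ ⊗ₜ ⟨y, hy⟩, rfl⟩)

theorem tensorDeg_le {n : ℕ} {L : Submodule k (M ⊗[k] N)}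
    (h : ∀ i j, i + j = n → ∀ x ∈ 𝒜 i, ∀ y ∈ ℬ j, x ⊗ₜ y ∈ L) : tensorDeg 𝒜 ℬ n ≤ L := by
  refine iSup₂_le fun p hp => ?_
  rintro _ ⟨z, rfl⟩
  induction z with
  | zero => simp
  | add s t hs ht => rw [map_add]; exact add_mem hs ht
  | tmul x y => exact h _ _ (Finset.HasAntidiagonal.mem_antidiagonal.1 hp) x x.2 y y.2

theorem eqOn_tensorDeg {E : Type*} [AddCommGroup E] [Module k E] {n : ℕ} (f g : M ⊗[k] N →ₗ[k] E)
    (h : ∀ i j, i + j = n → ∀ x ∈ 𝒜 i, ∀ y ∈ ℬ j, f (x ⊗ₜ y) = g (x ⊗ₜ y)) {z : M ⊗[k] N}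
    (hz : z ∈ tensorDeg 𝒜 ℬ n) : f z = g z :=
  tensorDeg_le (L := LinearMap.eqLocus f g) h hz

end TensorDeg

variable {k Ω : Type*} [CommRing k] [Ring Ω] [Algebra k Ω] [Coalgebra k Ω]
  {𝒜 : ℕ → Submodule k Ω} [GradedAlgebra 𝒜]

/-- Degree-preserving elements of the convolution algebra. -/
def IsHomogeneous (𝒜 : ℕ → Submodule k Ω) (f : WithConv (Ω →ₗ[k] Ω)) : Prop :=
  ∀ n, ∀ x ∈ 𝒜 n, f x ∈ 𝒜 n

theorem convMul_apply (f g : WithConv (Ω →ₗ[k] Ω)) (x : Ω) : (f * g) x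
    = (LinearMap.mul' k Ω ∘ₗ TensorProduct.map f.ofConv g.ofConv) (comul x) := rfl

variable (hdeg : ∀ n, ∀ x ∈ 𝒜 n, (comul x : Ω ⊗[k] Ω) ∈ tensorDeg 𝒜 𝒜 n)

include hdeg

theorem IsHomogeneous.mul {f g : WithConv (Ω →ₗ[k] Ω)} (hf : IsHomogeneous 𝒜 f)
    (hg : IsHomogeneous 𝒜 g) : IsHomogeneous 𝒜 (f * g) := by
  intro n x hx
  rw [convMul_apply]
  refine tensorDeg_le (L := (𝒜 n).comap (LinearMap.mul' k Ω ∘ₗ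
    TensorProduct.map f.ofConv g.ofConv)) ?_ (hdeg n x hx)
  rintro i j rfl x hx y hy
  exact SetLike.GradedMul.mul_mem (hf i x hx) (hg j y hy)

omit hdeg in
theorem isHomogeneous_one (hε : ∀ n, n ≠ 0 → ∀ x ∈ 𝒜 n, (counit x : k) = 0) :
    IsHomogeneous 𝒜 1 := by
  intro n x hx
  rw [LinearMap.convOne_apply]
  by_cases h : n = 0
  · subst h
    exact SetLike.algebraMap_mem_graded 𝒜 _
  · rw [hε n h x hx, map_zero]
    exact Submodule.zero_mem _

theorem isHomogeneous_pow (hε : ∀ n, n ≠ 0 → ∀ x ∈ 𝒜 n, (counit x : k) = 0)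
    {f : WithConv (Ω →ₗ[k] Ω)} (hf : IsHomogeneous 𝒜 f) (m : ℕ) : IsHomogeneous 𝒜 (f ^ m) := by
  induction m with
  | zero => rw [pow_zero]; exact isHomogeneous_one hε
  | succ m ih => rw [pow_succ]; exact IsHomogeneous.mul hdeg ih hf

omit [GradedAlgebra 𝒜] in
-- Each of the `m` factors must receive a leg of positive degree, which is impossible when the total
-- degree is below `m`.
theorem pow_apply_eq_zero {f : WithConv (Ω →ₗ[k] Ω)} (hf : ∀ x ∈ 𝒜 0, f x = 0) {n m : ℕ}
    (h : n < m) {x : Ω} (hx : x ∈ 𝒜 n) : (f ^ m) x = 0 := by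
  induction m generalizing n x with
  | zero => omega
  | succ m ih =>
    rw [pow_succ', convMul_apply, eqOn_tensorDeg _ 0 _ (hdeg n x hx), LinearMap.zero_apply]
    intro i j hij x hx y hy
    rw [LinearMap.comp_apply, TensorProduct.map_tmul, LinearMap.mul'_apply, LinearMap.zero_apply]
    by_cases hi : i = 0
    · subst hi
      rw [hf x hx, zero_mul]
    · rw [ih (by omega) hy, mul_zero]

omit hdeg in
/-- The sum of the powers of a locally nilpotent element of the convolution algebra. -/
def geomSum (𝒜 : ℕ → Submodule k Ω) [GradedAlgebra 𝒜] (f : WithConv (Ω →ₗ[k] Ω)) :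
    WithConv (Ω →ₗ[k] Ω) :=
  toConv (DirectSum.toModule k ℕ Ω
    (fun n => (∑ m ∈ Finset.range (n + 1), f ^ m).ofConv ∘ₗ (𝒜 n).subtype)
      ∘ₗ (DirectSum.decomposeLinearEquiv 𝒜).toLinearMap)

/-- Powers beyond the degree vanish, so any long enough truncation gives the same value. This
freedom allows a single truncation for all legs of a coproduct, whose degrees are at most the total
degree. -/
theorem geomSum_apply {f : WithConv (Ω →ₗ[k] Ω)} (hf : ∀ x ∈ 𝒜 0, f x = 0) {n m : ℕ}
    (h : n ≤ m) {x : Ω} (hx : x ∈ 𝒜 n) :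
    geomSum 𝒜 f x = (∑ i ∈ Finset.range (m + 1), f ^ i : WithConv (Ω →ₗ[k] Ω)) x := by
  have h1 : geomSum 𝒜 f x = (∑ i ∈ Finset.range (n + 1), f ^ i : WithConv (Ω →ₗ[k] Ω)) x :=
    DirectSum.toModule_decompose_of_mem 𝒜 _ hx
  rw [h1]
  obtain ⟨d, rfl⟩ := Nat.exists_eq_add_of_le h
  clear h1 h
  induction d with
  | zero => rfl
  | succ d ih =>
    rw [ih, ← Nat.add_assoc, Finset.sum_range_succ _ (n + d + 1), WithConv.ofConv_add,
      LinearMap.add_apply, pow_apply_eq_zero hdeg hf (by omega) hx, add_zero]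

theorem isHomogeneous_geomSum (hε : ∀ n, n ≠ 0 → ∀ x ∈ 𝒜 n, (counit x : k) = 0)
    {f : WithConv (Ω →ₗ[k] Ω)} (hf : ∀ x ∈ 𝒜 0, f x = 0) (hf' : IsHomogeneous 𝒜 f) :
    IsHomogeneous 𝒜 (geomSum 𝒜 f) := by
  intro n x hx
  rw [geomSum_apply hdeg hf le_rfl hx]
  induction Finset.range (n + 1) using Finset.cons_induction with
  | empty => simp
  | cons a s ha ih =>
    rw [Finset.sum_cons, WithConv.ofConv_add, LinearMap.add_apply]
    exact add_mem (isHomogeneous_pow hdeg hε hf' a n x hx) ih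

omit hdeg [Coalgebra k Ω] in
theorem conv_ext {f g : WithConv (Ω →ₗ[k] Ω)} (h : ∀ n, ∀ x ∈ 𝒜 n, f x = g x) : f = g := by
  ext x
  induction x using DirectSum.Decomposition.inductionOn 𝒜 with
  | zero => simp
  | add x y hx hy => simp only [map_add, hx, hy]
  | homogeneous x => exact h _ x x.2

theorem geomSum_mul {f : WithConv (Ω →ₗ[k] Ω)} (hf : ∀ x ∈ 𝒜 0, f x = 0) :
    geomSum 𝒜 f * (1 - f) = 1 := by
  apply conv_ext (𝒜 := 𝒜)
  intro n x hx
  have h1 : (geomSum 𝒜 f * (1 - f)) x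
      = ((∑ i ∈ Finset.range (n + 1), f ^ i : WithConv (Ω →ₗ[k] Ω)) * (1 - f)) x := by
    rw [convMul_apply, convMul_apply]
    refine eqOn_tensorDeg _ _ ?_ (hdeg n x hx)
    intro i j hij x hx y hy
    simp only [LinearMap.comp_apply, TensorProduct.map_tmul]
    rw [geomSum_apply hdeg hf (m := n) (by omega) hx]
  rw [h1, geom_sum_mul_neg, WithConv.ofConv_sub, LinearMap.sub_apply,
    pow_apply_eq_zero hdeg hf (Nat.lt_succ_self n) hx, sub_zero]

theorem mul_geomSum {f : WithConv (Ω →ₗ[k] Ω)} (hf : ∀ x ∈ 𝒜 0, f x = 0) :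
    (1 - f) * geomSum 𝒜 f = 1 := by
  apply conv_ext (𝒜 := 𝒜)
  intro n x hx
  have h1 : ((1 - f) * geomSum 𝒜 f) x
      = ((1 - f) * (∑ i ∈ Finset.range (n + 1), f ^ i : WithConv (Ω →ₗ[k] Ω))) x := by
    rw [convMul_apply, convMul_apply]
    refine eqOn_tensorDeg _ _ ?_ (hdeg n x hx)
    intro i j hij x hx y hy
    simp only [LinearMap.comp_apply, TensorProduct.map_tmul]
    rw [geomSum_apply hdeg hf (m := n) (by omega) hy]
  rw [h1, mul_neg_geom_sum, WithConv.ofConv_sub, LinearMap.sub_apply,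
    pow_apply_eq_zero hdeg hf (Nat.lt_succ_self n) hx, sub_zero]

/-- A graded algebra and coalgebra whose degree zero part has an antipode has an antipode. -/
theorem exists_antipode (hε : ∀ n, n ≠ 0 → ∀ x ∈ 𝒜 n, (counit x : k) = 0)
    (s : WithConv (Ω →ₗ[k] Ω)) (hs : IsHomogeneous 𝒜 s)
    (hl : ∀ x ∈ 𝒜 0, (s * toConv LinearMap.id : WithConv (Ω →ₗ[k] Ω)) x = algebraMap k Ω (counit x))
    (hr : ∀ x ∈ 𝒜 0,
      (toConv LinearMap.id * s : WithConv (Ω →ₗ[k] Ω)) x = algebraMap k Ω (counit x)) :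
    ∃ S : Ω →ₗ[k] Ω, (∀ n, ∀ x ∈ 𝒜 n, S x ∈ 𝒜 n) ∧
      (∀ x, LinearMap.mul' k Ω (TensorProduct.map S LinearMap.id (comul x))
        = algebraMap k Ω (counit x)) ∧
      (∀ x, LinearMap.mul' k Ω (TensorProduct.map LinearMap.id S (comul x))
        = algebraMap k Ω (counit x)) := by
  let e : WithConv (Ω →ₗ[k] Ω) := toConv LinearMap.id
  have he : IsHomogeneous 𝒜 e := fun n x hx => hx
  have hsub : ∀ f : WithConv (Ω →ₗ[k] Ω), IsHomogeneous 𝒜 f → IsHomogeneous 𝒜 (1 - f) := by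
    intro f hf n x hx
    exact sub_mem (isHomogeneous_one hε n x hx) (hf n x hx)
  have hzero : ∀ f : WithConv (Ω →ₗ[k] Ω), (∀ x ∈ 𝒜 0, f x = algebraMap k Ω (counit x)) →
      ∀ x ∈ 𝒜 0, (1 - f) x = 0 := by
    intro f hf x hx
    rw [WithConv.ofConv_sub, LinearMap.sub_apply, hf x hx, LinearMap.convOne_apply, sub_self]
  -- `s * e` and `e * s` differ from `1` by maps vanishing in degree zero, so both are inverted by
  -- geometric series.
  have h1 := geomSum_mul hdeg (hzero (s * e) hl)
  have h2 := mul_geomSum hdeg (hzero (e * s) hr)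
  rw [sub_sub_cancel] at h1 h2
  -- The left and the right convolution inverse of the identity coincide.
  have h3 : geomSum 𝒜 (1 - s * e) * s = s * geomSum 𝒜 (1 - e * s) := by
    calc geomSum 𝒜 (1 - s * e) * s
        = geomSum 𝒜 (1 - s * e) * s * (e * s * geomSum 𝒜 (1 - e * s)) := by
          rw [h2, mul_one]
      _ = (geomSum 𝒜 (1 - s * e) * (s * e)) * (s * geomSum 𝒜 (1 - e * s)) := by
          simp only [mul_assoc]
      _ = _ := by rw [h1, one_mul]
  refine ⟨(geomSum 𝒜 (1 - s * e) * s).ofConv, ?_, ?_, ?_⟩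
  · exact IsHomogeneous.mul hdeg (isHomogeneous_geomSum hdeg hε (hzero _ hl)
      (hsub _ (IsHomogeneous.mul hdeg hs he))) hs
  · intro x
    have := congrArg (fun f : WithConv (Ω →ₗ[k] Ω) => f x) h1
    rw [← mul_assoc] at this
    simpa [convMul_apply] using this
  · intro x
    rw [h3]
    have := congrArg (fun f : WithConv (Ω →ₗ[k] Ω) => f x) h2
    rw [mul_assoc] at this
    simpa [convMul_apply] using this

end GradedCoalgebra

/-! ### The grading of the quotient by the radical. -/

namespace Nichols

open Smash RightCrossedModule TensorPower BraidedPower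

variable {k V B : Type*} [Field k] [AddCommGroup V] [Module k V] [Ring B] [Algebra k B]
  (q : TensorAlgebra k V →ₐ[k] B)

local notation "T" => TensorAlgebra k V

/-- The degree `n` part of a quotient of the tensor algebra. -/
def quotDeg (n : ℕ) : Submodule k B :=
  LinearMap.range (q.toLinearMap ∘ₗ (toTensorAlgebra : ⨂[k]^n V →ₗ[k] T))

theorem mem_quotDeg {n : ℕ} (t : ⨂[k]^n V) : q (toTensorAlgebra t) ∈ quotDeg q n := ⟨t, rfl⟩

theorem ι_mem_quotDeg (v : V) : q (TensorAlgebra.ι k v) ∈ quotDeg q 1 := by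
  rw [← toTensorAlgebra_single]
  exact mem_quotDeg q _

/-- Degree `n` is spanned by products of `n` generators, so this serves as an induction principle on
degree, appending one generator on the right. -/
theorem quotDeg_le (L : ℕ → Submodule k B) (h0 : 1 ∈ L 0)
    (hs : ∀ n, ∀ x ∈ L n, ∀ v, x * q (TensorAlgebra.ι k v) ∈ L (n + 1)) (n : ℕ) :
    quotDeg q n ≤ L n := by
  rintro _ ⟨t, rfl⟩
  rw [LinearMap.comp_apply, AlgHom.toLinearMap_apply]
  induction n with
  | zero =>
    obtain ⟨c, rfl⟩ := exists_eq_smul_one t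
    rw [map_smul, toTensorAlgebra_gOne', map_smul, map_one]
    exact Submodule.smul_mem _ _ h0
  | succ n ih =>
    induction t using snoc_induction with
    | zero => simp
    | add s t hs ht => rw [map_add, map_add]; exact Submodule.add_mem _ hs ht
    | snoc s v => rw [toTensorAlgebra_snoc, map_mul]; exact hs n _ (ih s) v

instance gradedMonoid_quotDeg : SetLike.GradedMonoid (quotDeg q) where
  one_mem := by
    rw [← map_one q, ← toTensorAlgebra_gOne']
    exact mem_quotDeg q _
  mul_mem := by
    rintro i j _ _ ⟨s, rfl⟩ ⟨t, rfl⟩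
    simp only [LinearMap.comp_apply, AlgHom.toLinearMap_apply]
    rw [← map_mul, ← toTensorAlgebra_mulEquiv]
    exact mem_quotDeg q _

/-- The decomposition map of the tensor algebra into the degrees of a quotient. -/
def decomposeTensor : T →ₐ[k] ⨁ n, quotDeg q n :=
  TensorAlgebra.lift k (DirectSum.lof k ℕ (fun n => quotDeg q n) 1 ∘ₗ
    (q.toLinearMap ∘ₗ TensorAlgebra.ι k).codRestrict (quotDeg q 1) (ι_mem_quotDeg q))

theorem decomposeTensor_toTensorAlgebra (n : ℕ) (t : ⨂[k]^n V) :
    decomposeTensor q (toTensorAlgebra t)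
      = DirectSum.lof k ℕ (fun n => quotDeg q n) n ⟨q (toTensorAlgebra t), mem_quotDeg q t⟩ := by
  have h : ∀ (t : ⨂[k]^n V), DirectSum.lof k ℕ (fun n => quotDeg q n) n
      ⟨q (toTensorAlgebra t), mem_quotDeg q t⟩ = (DirectSum.lof k ℕ (fun n => quotDeg q n) n ∘ₗ
        (q.toLinearMap ∘ₗ (toTensorAlgebra : ⨂[k]^n V →ₗ[k] T)).rangeRestrict) t := fun _ => rfl
  induction n with
  | zero =>
    obtain ⟨c, rfl⟩ := exists_eq_smul_one t
    rw [h, map_smul, map_smul, map_smul, toTensorAlgebra_gOne', map_one, ← h]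
    rw [DirectSum.lof_eq_of, DirectSum.one_def]
    refine congrArg (c • DirectSum.of (fun n => quotDeg q n) 0 ·) (Subtype.ext ?_)
    change 1 = q (toTensorAlgebra _)
    rw [toTensorAlgebra_gOne', map_one]
  | succ n ih =>
    induction t using snoc_induction with
    | zero => rw [h, map_zero, map_zero, map_zero]
    | add s t hs ht => rw [h, map_add, map_add, map_add, hs, ht, ← h, ← h]
    | snoc s v =>
      have h1 : decomposeTensor q (TensorAlgebra.ι k v) = DirectSum.lof k ℕ (fun n => quotDeg q n) 1
        ⟨q (TensorAlgebra.ι k v), ι_mem_quotDeg q v⟩ := by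
        simp only [decomposeTensor, TensorAlgebra.lift_ι_apply]
        rfl
      refine (congrArg _ (toTensorAlgebra_snoc s v)).trans ?_
      rw [map_mul, ih s (fun _ => rfl), h1, DirectSum.lof_eq_of,
        DirectSum.lof_eq_of, DirectSum.of_mul_of, DirectSum.lof_eq_of]
      congr 1
      apply Subtype.ext
      change _ * _ = _
      simp only [toTensorAlgebra_snoc, map_mul]

variable {H : Type*} [Ring H] [HopfAlgebra k H] (C : RightCrossedModule k H V)
  (hq : Function.Surjective q) (hker : ∀ x, q x = 0 ↔ x ∈ tensorRadical C)

include hker in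
-- Homogeneity of the radical: every component of `x` also maps to zero.
theorem decomposeTensor_eq_zero {x : T} (hx : q x = 0) : decomposeTensor q x = 0 := by
  obtain ⟨S, hS⟩ := exists_sum_toTensorAlgebra x
  rw [hS, map_sum]
  refine Finset.sum_eq_zero fun n _ => ?_
  have h : q (component k V n x) = 0 :=
    (hker _).2 (component_mem_radical C ((hker x).1 hx) n)
  rw [component, LinearMap.comp_apply] at h ⊢
  rw [decomposeTensor_toTensorAlgebra]
  simp only [h]
  exact map_zero _

/-- The grading of the quotient of the tensor algebra by its radical. -/
@[reducible]
def quotGraded : GradedAlgebra (quotDeg q) :=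
  GradedAlgebra.ofAlgHom (quotDeg q)
    (AlgHom.descend (E := ⨁ n, quotDeg q n) q hq (decomposeTensor q) fun _ hx =>
      decomposeTensor_eq_zero q C hker hx)
    (by
      refine AlgHom.ext_of_adjoin_eq_top (adjoin_range_comp_ι q hq) ?_
      rintro _ ⟨v, rfl⟩
      rw [AlgHom.comp_apply, LinearMap.comp_apply, AlgHom.toLinearMap_apply, AlgHom.descend_apply,
        decomposeTensor, TensorAlgebra.lift_ι_apply, LinearMap.comp_apply, DirectSum.lof_eq_of,
        DirectSum.coeAlgHom_of]
      rfl)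
    (by
      rintro i ⟨_, t, rfl⟩
      exact (AlgHom.descend_apply q hq _ _ _).trans (decomposeTensor_toTensorAlgebra q i t))

theorem quotCrossed_act_ι (a : H) (v : V) :
    (quotCrossed C q hq hker).act a (q (TensorAlgebra.ι k v))
    = q (TensorAlgebra.ι k (C.act a v)) := (quotPrimGen C q hq hker).act_ι a v

theorem quotCrossed_coact_ι (v : V) : (quotCrossed C q hq hker).coact (q (TensorAlgebra.ι k v))
    = TensorProduct.map (q.toLinearMap ∘ₗ TensorAlgebra.ι k) LinearMap.id (C.coact v) :=
  (quotPrimGen C q hq hker).coact_ι v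

theorem act_mem_quotDeg (a : H) {n : ℕ} {x : B} (hx : x ∈ quotDeg q n) :
    (quotCrossed C q hq hker).act a x ∈ quotDeg q n := by
  -- All `a` are treated at once, because on a product the action passes to the legs of `Δa`.
  have h := quotDeg_le q (fun n => ⨅ a, (quotDeg q n).comap ((quotCrossed C q hq hker).act a))
    ?_ ?_ n hx
  · exact (Submodule.mem_iInf _).1 h a
  · refine (Submodule.mem_iInf _).2 fun a => ?_
    rw [Submodule.mem_comap, (isCrossedAlg_quot C q hq hker).act_one]
    exact SetLike.algebraMap_mem_graded (quotDeg q) _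
  · intro n x hx v
    refine (Submodule.mem_iInf _).2 fun a => ?_
    rw [Submodule.mem_comap, (isCrossedAlg_quot C q hq hker).act_mul, conv, LinearMap.comp_apply,
      LinearMap.comp_apply]
    induction (comul a : H ⊗[k] H) with
    | zero => simp
    | add s t hs ht => simp only [map_add]; exact add_mem hs ht
    | tmul a b =>
      simp only [TensorProduct.map_tmul, LinearMap.mul'_apply, LinearMap.flip_apply,
        quotCrossed_act_ι]
      exact SetLike.GradedMul.mul_mem ((Submodule.mem_iInf _).1 hx a) (ι_mem_quotDeg q _)

theorem coact_mem_quotDeg {n : ℕ} {x : B} (hx : x ∈ quotDeg q n) :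
    (quotCrossed C q hq hker).coact x ∈
    LinearMap.range (TensorProduct.map (quotDeg q n).subtype (LinearMap.id : H →ₗ[k] H)) := by
  refine quotDeg_le q (fun n => (LinearMap.range (TensorProduct.map (quotDeg q n).subtype
    (LinearMap.id : H →ₗ[k] H))).comap (quotCrossed C q hq hker).coact) ?_ ?_ n hx
  · rw [Submodule.mem_comap, (isCrossedAlg_quot C q hq hker).coact_one]
    exact ⟨⟨1, SetLike.GradedOne.one_mem⟩ ⊗ₜ 1, rfl⟩
  · intro n x hx v
    rw [Submodule.mem_comap] at hx ⊢
    rw [(isCrossedAlg_quot C q hq hker).coact_mul, quotCrossed_coact_ι]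
    obtain ⟨z, hz⟩ := hx
    rw [← hz]
    clear hz
    induction z with
    | zero => simp
    | add s t hs ht => rw [map_add, add_mul]; exact add_mem hs ht
    | tmul a b =>
      induction C.coact v with
      | zero => simp
      | add s t hs ht => rw [map_add, mul_add]; exact add_mem hs ht
      | tmul c d =>
        exact ⟨⟨a * q (TensorAlgebra.ι k c), SetLike.GradedMul.mul_mem a.2 (ι_mem_quotDeg q c)⟩
          ⊗ₜ (b * d), by simp⟩

/-- A group-like element acts multiplicatively, so `-1` on the generators becomes the parity
operator on the whole algebra. -/
theorem act_groupLike_quotDeg {Γ : H} (hΔ : comul Γ = Γ ⊗ₜ[k] Γ) (hε : counit (R := k) Γ = 1)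
    (hΓ : ∀ v, C.act Γ v = -v) {n : ℕ} {x : B} (hx : x ∈ quotDeg q n) :
    (quotCrossed C q hq hker).act Γ x = (-1 : k) ^ n • x := by
  refine quotDeg_le q (fun n => LinearMap.eqLocus ((quotCrossed C q hq hker).act Γ)
    ((-1 : k) ^ n • LinearMap.id))
    ?_ ?_ n hx
  · rw [LinearMap.mem_eqLocus, (isCrossedAlg_quot C q hq hker).act_one, hε]
    simp
  · intro n x hx v
    rw [LinearMap.mem_eqLocus, LinearMap.smul_apply, LinearMap.id_apply] at hx ⊢
    rw [(isCrossedAlg_quot C q hq hker).act_mul, conv, LinearMap.comp_apply,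
      LinearMap.comp_apply, hΔ, TensorProduct.map_tmul, LinearMap.mul'_apply, LinearMap.flip_apply,
      LinearMap.flip_apply, hx, quotCrossed_act_ι, hΓ, pow_succ]
    simp

theorem bcomul_quotG_toTensorAlgebra (n : ℕ) (t : ⨂[k]^n V) :
    PrimGen.bcomul (quotG C q hq hker) (q (toTensorAlgebra t))
      = ∑ r : Fin (n + 1), TensorProduct.map (q.toLinearMap ∘ₗ toTensorAlgebra)
          (q.toLinearMap ∘ₗ toTensorAlgebra)
          (split k V n r (Nat.le_of_lt_succ r.2) (binom C.braiding n r t)) := by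
  rw [bcomul_quotG, tensorComul_toTensorAlgebra, map_sum, Finset.sum_range]
  refine Finset.sum_congr rfl fun r _ => ?_
  rw [deconc, dif_pos (Nat.le_of_lt_succ r.2), TensorProduct.map_comp, LinearMap.comp_apply,
    LinearMap.comp_apply]

theorem bcomul_quotG_mem {n : ℕ} {x : B} (hx : x ∈ quotDeg q n) :
    PrimGen.bcomul (quotG C q hq hker) x
      ∈ GradedCoalgebra.tensorDeg (quotDeg q) (quotDeg q) n := by
  obtain ⟨t, rfl⟩ := hx
  rw [LinearMap.comp_apply, AlgHom.toLinearMap_apply, bcomul_quotG_toTensorAlgebra]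
  refine Submodule.sum_mem _ fun r _ => ?_
  generalize split k V n r _ _ = z
  induction z with
  | zero => simp
  | add s t hs ht => rw [map_add]; exact add_mem hs ht
  | tmul s t =>
    exact GradedCoalgebra.tmul_mem_tensorDeg (by omega) (mem_quotDeg q s) (mem_quotDeg q t)

end Nichols

/-! ### Extensions by a group-like sign. -/

/-- A crossed module `C'` over a Hopf algebra `H`, which extends `A` by a central group-like element
`Γ` of order two, such that `Γ` acts on `C'` by `-1`, and the coaction of `C'` is that of `C` times
`Γ`. The braiding of `C'` is therefore minus that of `C`. -/
structure IsSuperExtension {k A H V : Type*} [CommRing k] [Ring A] [HopfAlgebra k A] [Ring H]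
    [HopfAlgebra k H] [AddCommGroup V] [Module k V] (C : RightCrossedModule k A V)
    (C' : RightCrossedModule k H V) (i : A →ₐ[k] H) (p : H →ₐ[k] A) (Γ : H) : Prop where
  comul_incl : ∀ a, comul (R := k) (i a) = TensorProduct.map i.toLinearMap i.toLinearMap (comul a)
  counit_incl : ∀ a, counit (R := k) (i a) = counit (R := k) a
  proj_incl : ∀ a, p (i a) = a
  proj_Γ : p Γ = 1
  comul_Γ : comul (R := k) Γ = Γ ⊗ₜ[k] Γ
  counit_Γ : counit (R := k) Γ = 1
  Γ_mul_Γ : Γ * Γ = 1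
  incl_mul_Γ : ∀ a, i a * Γ = Γ * i a
  span : ∀ h, ∃ a b, h = i a + Γ * i b
  act_incl : ∀ a v, C'.act (i a) v = C.act a v
  act_Γ : ∀ v, C'.act Γ v = -v
  coact_eq : ∀ v, C'.coact v
    = TensorProduct.map LinearMap.id (LinearMap.mulLeft k Γ ∘ₗ i.toLinearMap) (C.coact v)

/-- The braiding acts by the coaction leg of its second argument, which now carries one `Γ`, and `Γ`
acts by `-1`. -/
theorem IsSuperExtension.braiding {k A H V : Type*} [CommRing k] [Ring A] [HopfAlgebra k A] [Ring H]
    [HopfAlgebra k H] [AddCommGroup V] [Module k V] {C : RightCrossedModule k A V}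
    {C' : RightCrossedModule k H V} {i : A →ₐ[k] H} {p : H →ₐ[k] A} {Γ : H}
    (X : IsSuperExtension C C' i p Γ) : C'.braiding = -C.braiding := by
  ext v w
  simp only [RightCrossedModule.braiding, TensorProduct.AlgebraTensorModule.curry_apply,
    TensorProduct.curry_apply, LinearMap.restrictScalars_apply, LinearMap.comp_apply,
    TensorProduct.map_tmul, LinearMap.id_apply, X.coact_eq, LinearMap.neg_apply]
  induction C.coact w with
  | zero => simp
  | add s t hs ht => simp only [map_add, TensorProduct.tmul_add, neg_add, hs, ht]
  | tmul a b => simp [C'.act_mul, X.act_incl, X.act_Γ, TensorProduct.tmul_neg]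

/-! ### The group algebra of the signs with coefficients in `A`. -/

namespace SuperExtension

open MonoidAlgebra Convolution RightCrossedModule

variable (k A : Type*) [CommRing k] [Ring A] [HopfAlgebra k A]

/-- The extension of a Hopf algebra by the group of signs. -/
abbrev SignAlgebra (A : Type*) [Ring A] : Type _ := MonoidAlgebra A ℤˣ

/-- The inclusion of `A`. -/
def incl : A →ₐ[k] SignAlgebra A := singleOneAlgHom

/-- The projection sending the signs to one. -/
def proj : SignAlgebra A →ₐ[k] A := liftNCAlgHom (AlgHom.id k A) 1 (fun _ _ => Commute.one_right _)

/-- The projection sending the signs to signs. -/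
def sign : SignAlgebra A →ₐ[k] A :=
  liftNCAlgHom (AlgHom.id k A) (((Int.castRingHom A : ℤ →+* A) : ℤ →* A).comp (Units.coeHom ℤ))
    (fun x _ => (Int.cast_commute _ x).symm)

/-- The nontrivial sign. -/
def negSign : SignAlgebra A := single (-1) 1

variable {k A}

theorem proj_single (g : ℤˣ) (a : A) : proj k A (single g a) = a := by simp [proj]

theorem sign_single (g : ℤˣ) (a : A) : sign k A (single g a) = (g : ℤ) • a := by
  refine (liftNC_single _ _ _ _).trans ?_
  simp [(Int.cast_commute (g : ℤ) a).eq]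

variable {V : Type*} [AddCommGroup V] [Module k V] (C : RightCrossedModule k A V)

/-- The action on the extension by signs. -/
def act : SignAlgebra A →ₗ[k] Module.End k V := C.act ∘ₗ (sign k A).toLinearMap

theorem act_single (g : ℤˣ) (a : A) (v : V) : act C (single g a) v = (g : ℤ) • C.act a v := by
  rw [act, LinearMap.comp_apply, AlgHom.toLinearMap_apply, sign_single, map_zsmul,
    LinearMap.smul_apply]

/-- The coaction of the extension by signs. -/
def coact : V →ₗ[k] V ⊗[k] SignAlgebra A :=
  TensorProduct.map LinearMap.id (lsingle (R := k) (-1)) ∘ₗ C.coact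

/-- At an element of `A` placed at the sign `g`, both sides are `g` times those of the condition
over `A`, placed at the sign `-g`. -/
theorem endAct_eq_diagAct (v : V) : endAct (leftMul k (SignAlgebra A) V).toLinearMap
    (coact C ∘ₗ (act C).flip v) = diagAct (act C) (coact C v) := by
  refine MonoidAlgebra.lhom_ext' fun g => LinearMap.ext fun a => ?_
  have h := congrArg (TensorProduct.map LinearMap.id (lsingle (R := k) (-g)))
    (congrArg (fun x => (g : ℤ) • x) (LinearMap.congr_fun (C.leftMul_endAct v) a))
  simp only [endAct, diagAct, LinearMap.comp_apply, lsingle_apply, comul_single] at h ⊢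
  refine Eq.trans ?_ (h.trans ?_)
  · clear h
    induction (comul a : A ⊗[k] A) with
    | zero => simp
    | add s t hs ht => simp only [map_add, smul_add, hs, ht]
    | tmul a b =>
      simp only [TensorProduct.map_tmul, TensorProduct.lift.tmul, LinearMap.id_apply,
        LinearMap.comp_apply, LinearMap.flip_apply, lsingle_apply, act_single, coact, map_zsmul]
      congr 1
      induction C.coact (C.act b v) with
      | zero => simp
      | add s t hs ht => simp only [map_add, hs, ht]
      | tmul x y => simp [leftMul, single_mul_single]
  · clear h
    induction (comul a : A ⊗[k] A) with
    | zero => simp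
    | add s t hs ht => simp only [map_add, smul_add, hs, ht]
    | tmul a b =>
      rw [coact, LinearMap.comp_apply]
      induction C.coact v with
      | zero => simp
      | add s t hs ht => simp only [map_add, LinearMap.add_apply, smul_add, hs, ht]
      | tmul x y =>
        simp [act_single, single_mul_single, TensorProduct.smul_tmul']

/-- The crossed module over the extension by signs. -/
def crossed : RightCrossedModule k (SignAlgebra A) V where
  act := act C
  coact := coact C
  act_one v := by simp [act, C.act_one]
  act_mul a b v := by simp [act, C.act_mul]
  coact_coassoc v := by
    have h := congrArg (TensorProduct.map LinearMap.id (TensorProduct.map (lsingle (R := k) (-1 : ℤˣ))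
      (lsingle (R := k) (-1 : ℤˣ)))) (C.coact_coassoc v)
    refine Eq.trans ?_ (h.trans ?_)
    · rw [coact, LinearMap.comp_apply]
      induction C.coact v with
      | zero => simp
      | add s t hs ht => simp only [map_add, hs, ht]
      | tmul x y =>
        simp only [TensorProduct.map_tmul, LinearMap.comp_apply, LinearMap.id_apply]
        induction C.coact x with
        | zero => simp
        | add s t hs ht => simp only [map_add, TensorProduct.add_tmul, hs, ht]
        | tmul x y => simp
    · rw [coact, LinearMap.comp_apply]
      induction C.coact v with
      | zero => simp
      | add s t hs ht => simp only [map_add, hs, ht]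
      | tmul x y => simp
  coact_counit v := by
    refine Eq.trans ?_ (C.coact_counit v)
    rw [coact, LinearMap.comp_apply]
    induction C.coact v with
    | zero => simp
    | add s t hs ht => simp only [map_add, hs, ht]
    | tmul x y => simp
  coact_act a v := (crossed_iff _ _ v).2 (endAct_eq_diagAct C v) a

theorem isSuperExtension :
    IsSuperExtension C (crossed C) (incl k A) (proj k A) (negSign A) where
  comul_incl a := comul_single (R := k) 1 a
  counit_incl a := counit_single (R := k) 1 a
  proj_incl a := proj_single 1 a
  proj_Γ := proj_single (-1) 1
  comul_Γ := by simp [negSign]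
  counit_Γ := by simp [negSign]
  Γ_mul_Γ := by simp [negSign, single_mul_single, one_def]
  incl_mul_Γ a := by simp [negSign, incl, single_mul_single]
  span h := by
    induction h using MonoidAlgebra.induction_linear with
    | zero => exact ⟨0, 0, by simp⟩
    | add s t hs ht =>
      obtain ⟨a, b, rfl⟩ := hs
      obtain ⟨c, d, rfl⟩ := ht
      exact ⟨a + c, b + d, by simp only [map_add, mul_add]; abel⟩
    | single g a =>
      rcases Int.units_eq_one_or g with rfl | rfl
      · exact ⟨a, 0, by simp [incl]⟩
      · exact ⟨0, a, by simp [negSign, incl, single_mul_single]⟩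
  act_incl a v := by
    change act C (single 1 a) v = _
    rw [act_single]
    simp
  act_Γ v := by
    change act C (single (-1) 1) v = _
    rw [act_single, C.act_one]
    simp
  coact_eq v := by
    change coact C v = _
    rw [coact, LinearMap.comp_apply]
    congr 2
    refine LinearMap.ext fun a => ?_
    simp [negSign, incl, single_mul_single]

end SuperExtension

/-! ### Restriction along coalgebra maps, and gradings of smash products. -/

namespace Convolution

variable {k A H E : Type*} [CommRing k] [Ring A] [HopfAlgebra k A] [Ring H] [HopfAlgebra k H]
  [Ring E] [Algebra k E]

/-- Precomposition with a coalgebra map, as a map of convolution algebras. -/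
def precomp (f : A →ₗ[k] H) (hΔ : ∀ a, comul (R := k) (f a) = TensorProduct.map f f (comul a))
    (hε : ∀ a, counit (R := k) (f a) = counit (R := k) a) :
    WithConv (H →ₗ[k] E) →ₐ[k] WithConv (A →ₗ[k] E) :=
  AlgHom.ofLinearMap
    { toFun := fun g => toConv (g.ofConv ∘ₗ f)
      map_add' := fun x y => by ext; simp
      map_smul' := fun c x => by ext; simp }
    (by ext; simp [hε])
    (fun x y => by
      ext a
      simp only [LinearMap.coe_mk, AddHom.coe_mk, LinearMap.comp_apply, mul_apply, hΔ]
      rw [← LinearMap.comp_apply (TensorProduct.map x.ofConv y.ofConv), ← TensorProduct.map_comp])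

end Convolution

namespace Smash

variable {k H B : Type*} [CommRing k] [Ring H] [HopfAlgebra k H] [Ring B]
    [Algebra k B] {CB : RightCrossedModule k H B} (hB : IsCrossedAlg CB) (ℬ : ℕ → Submodule k B)

/-- The degree `n` part of the smash product with a graded algebra. -/
def deg (n : ℕ) : Submodule k (Smash hB) :=
  (LinearMap.range (LinearMap.lTensor H (ℬ n).subtype)).map (of hB).toLinearMap

variable {ℬ}

theorem of_mem_deg (a : H) {n : ℕ} {x : B} (hx : x ∈ ℬ n) : of hB (a ⊗ₜ x) ∈ deg hB ℬ n :=
  ⟨_, ⟨a ⊗ₜ ⟨x, hx⟩, rfl⟩, rfl⟩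

theorem inB_mem_deg {n : ℕ} {x : B} (hx : x ∈ ℬ n) : inB hB x ∈ deg hB ℬ n :=
  of_mem_deg hB 1 hx

theorem deg_le {n : ℕ} {L : Submodule k (Smash hB)}
    (h : ∀ a, ∀ x ∈ ℬ n, of hB (a ⊗ₜ x) ∈ L) : deg hB ℬ n ≤ L := by
  rintro _ ⟨_, ⟨z, rfl⟩, rfl⟩
  induction z with
  | zero => simp
  | add s t hs ht => rw [map_add, map_add]; exact add_mem hs ht
  | tmul a x => exact h a x x.2

theorem inH_mem_deg [SetLike.GradedOne ℬ] (a : H) : inH hB a ∈ deg hB ℬ 0 :=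
  of_mem_deg hB a SetLike.GradedOne.one_mem

variable [GradedAlgebra ℬ] (hact : ∀ a n, ∀ x ∈ ℬ n, CB.act a x ∈ ℬ n)

include hact in
theorem gradedMonoid_deg : SetLike.GradedMonoid (deg hB ℬ) where
  one_mem := inB_mem_deg hB SetLike.GradedOne.one_mem
  mul_mem := by
    intro i j x y hx hy
    refine deg_le (L := (deg hB ℬ (i + j)).comap (LinearMap.mulRight k y)) hB ?_ hx
    intro a x hx
    refine deg_le (L := (deg hB ℬ (i + j)).comap (LinearMap.mulLeft k (of hB (a ⊗ₜ x)))) hB ?_ hy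
    intro b y hy
    rw [Submodule.mem_comap, LinearMap.mulLeft_apply, tmul_mul_tmul]
    induction (comul b : H ⊗[k] H) with
    | zero => simp
    | add s t hs ht => rw [map_add, map_add]; exact add_mem hs ht
    | tmul c d =>
      exact of_mem_deg hB _ (SetLike.GradedMul.mul_mem (hact d i x hx) hy)

omit [GradedAlgebra ℬ] in
/-- The component `x ↦ (a ↦ a ⊗ x)` of the decomposition of the smash product into degrees. -/
def decomposePart (n : ℕ) : ℬ n →ₗ[k] H →ₗ[k] ⨁ n, deg hB ℬ n :=
  LinearMap.mk₂ k (fun x a => DirectSum.lof k ℕ (fun n => deg hB ℬ n) n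
      ⟨of hB (a ⊗ₜ (x : B)), of_mem_deg hB a x.2⟩)
    (fun x y a => by
      rw [← map_add]
      exact congrArg _ <| Subtype.ext (by simp [TensorProduct.tmul_add]))
    (fun c x a => by
      rw [← map_smul]
      exact congrArg _ <| Subtype.ext (by simp))
    (fun x a b => by
      rw [← map_add]
      exact congrArg _ <| Subtype.ext (by simp [TensorProduct.add_tmul]))
    (fun c x a => by
      rw [← map_smul]
      exact congrArg _ <| Subtype.ext (by simp [← TensorProduct.smul_tmul']))

/-- The decomposition of the smash product into degrees. -/
def decomposeSmash : Smash hB →ₗ[k] ⨁ n, deg hB ℬ n :=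
  TensorProduct.lift (LinearMap.flip (DirectSum.toModule k ℕ (H →ₗ[k] ⨁ n, deg hB ℬ n)
    (decomposePart hB) ∘ₗ (DirectSum.decomposeLinearEquiv ℬ).toLinearMap))
    ∘ₗ (of hB).symm.toLinearMap

theorem decomposeSmash_of_mem {n : ℕ} {w : Smash hB} (hw : w ∈ deg hB ℬ n) :
    decomposeSmash hB w = DirectSum.lof k ℕ (fun n => deg hB ℬ n) n ⟨w, hw⟩ := by
  obtain ⟨_, ⟨z, rfl⟩, rfl⟩ := hw
  let r : H ⊗[k] ℬ n →ₗ[k] deg hB ℬ n := ((of hB).toLinearMap ∘ₗ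
    LinearMap.lTensor H (ℬ n).subtype).codRestrict (deg hB ℬ n) fun z => ⟨_, ⟨z, rfl⟩, rfl⟩
  change _ = DirectSum.lof k ℕ (fun n => deg hB ℬ n) n (r z)
  induction z with
  | zero => simp
  | add s t hs ht => simp only [map_add, hs, ht]
  | tmul a x =>
    have h := LinearMap.congr_fun
      (DirectSum.toModule_decompose_of_mem (M := H →ₗ[k] ⨁ n, deg hB ℬ n) ℬ (decomposePart hB)
        x.2) a
    rw [decomposePart, LinearMap.mk₂_apply] at h
    exact h

/-- The grading of the smash product with a graded algebra. -/
@[reducible]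
def gradedAlgebra : GradedAlgebra (deg hB ℬ) :=
  { gradedMonoid_deg hB hact,
    DirectSum.Decomposition.ofLinearMap (deg hB ℬ) (decomposeSmash hB)
      (by
        refine LinearMap.ext fun w => ?_
        obtain ⟨w, rfl⟩ := (of hB).surjective w
        induction w with
        | zero => simp
        | add s t hs ht => simp only [map_add, hs, ht]
        | tmul a x =>
          induction x using DirectSum.Decomposition.inductionOn ℬ with
          | zero => simp
          | add s t hs ht => simp only [TensorProduct.tmul_add, map_add, hs, ht]
          | homogeneous x =>
            rw [LinearMap.comp_apply, decomposeSmash_of_mem hB (of_mem_deg hB a x.2),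
              DirectSum.lof_eq_of, DirectSum.coeLinearMap_of]
            rfl)
      (by
        refine DirectSum.linearMap_ext k fun n => LinearMap.ext fun w => ?_
        rw [LinearMap.comp_apply, LinearMap.comp_apply, DirectSum.lof_eq_of,
          DirectSum.coeLinearMap_of, decomposeSmash_of_mem hB w.2]
        rfl) with }

end Smash

/-! ### The super-bosonisation inside the ordinary bosonisation. -/

namespace IsSuperExtension

open Smash RightCrossedModule Nichols

variable {k A H V B : Type*} [Field k] [Ring A] [HopfAlgebra k A] [Ring H]
    [HopfAlgebra k H] [AddCommGroup V] [Module k V] [Ring B] [Algebra k B]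
    {C : RightCrossedModule k A V}
    {C' : RightCrossedModule k H V} {i : A →ₐ[k] H} {p : H →ₐ[k] A} {Γ : H}
    (X : IsSuperExtension C C' i p Γ) (q : TensorAlgebra k V →ₐ[k] B)
    (hq : Function.Surjective q) (hker : ∀ x, q x = 0 ↔ x ∈ tensorRadical C')

local notation "hQ" => isCrossedAlg_quot C' q hq hker
local notation "jV" => AlgHom.toLinearMap q ∘ₗ TensorAlgebra.ι k

include X in
theorem map_proj_coact (v : V) :
    TensorProduct.map LinearMap.id p.toLinearMap (C'.coact v) = C.coact v := by
  rw [X.coact_eq]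
  induction C.coact v with
  | zero => simp
  | add s t hs ht => simp only [map_add, hs, ht]
  | tmul a b => simp [X.proj_Γ, X.proj_incl]

/-- The crossed module structure over `A` on the quotient of the tensor algebra. -/
def restrict : RightCrossedModule k A B :=
  ofGenerators C jV (adjoin_range_comp_ι q hq)
    ((Convolution.precomp i.toLinearMap X.comul_incl X.counit_incl).comp (quotConv C' q hq hker))
    (fun v a => by
      rw [AlgHom.comp_apply]
      change quotConv C' q hq hker (q (TensorAlgebra.ι k v)) (i a) = _
      rw [quotConv_apply, tensor_act_ι, X.act_incl]
      rfl)
    ((Algebra.TensorProduct.map (AlgHom.id k B) p).comp (quotCoact C' q hq hker)) (fun v => by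
      have h := quotCrossed_coact_ι q C' hq hker v
      rw [AlgHom.comp_apply]
      change Algebra.TensorProduct.map (AlgHom.id k B) p ((quotCrossed C' q hq hker).coact _) = _
      rw [LinearMap.comp_apply, AlgHom.toLinearMap_apply, h, ← X.map_proj_coact]
      induction C'.coact v with
      | zero => simp
      | add s t hs ht => simp only [map_add, hs, ht]
      | tmul a b => simp)

theorem restrict_act (a : A) (x : B) :
    (X.restrict q hq hker).act a x = (quotCrossed C' q hq hker).act (i a) x := rfl

theorem restrict_coact (x : B) : (X.restrict q hq hker).coact x
    = TensorProduct.map LinearMap.id p.toLinearMap ((quotCrossed C' q hq hker).coact x) := rfl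

theorem isCrossedAlg_restrict : IsCrossedAlg (X.restrict q hq hker) := isCrossedAlg_ofGenerators ..

local notation "hR" => isCrossedAlg_restrict X q hq hker

theorem restrict_act_ι (a : A) (v : V) :
    (X.restrict q hq hker).act a (jV v) = jV (C.act a v) := by
  rw [restrict_act, LinearMap.comp_apply, AlgHom.toLinearMap_apply, quotCrossed_act_ι, X.act_incl]
  rfl

theorem restrict_coact_ι (v : V) : (X.restrict q hq hker).coact (jV v)
    = TensorProduct.map jV LinearMap.id (C.coact v) := by
  rw [restrict_coact, LinearMap.comp_apply, AlgHom.toLinearMap_apply, quotCrossed_coact_ι,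
    ← X.map_proj_coact]
  induction C'.coact v with
  | zero => simp
  | add s t hs ht => simp only [map_add, hs, ht]
  | tmul a b => simp

theorem restrict_coact_mem {n : ℕ} {x : B} (hx : x ∈ quotDeg q n) :
    (X.restrict q hq hker).coact x ∈
      LinearMap.range (TensorProduct.map (quotDeg q n).subtype (LinearMap.id : A →ₗ[k] A)) := by
  obtain ⟨z, hz⟩ := coact_mem_quotDeg q C' hq hker hx
  refine ⟨TensorProduct.map LinearMap.id p.toLinearMap z, ?_⟩
  rw [restrict_coact, ← hz, ← LinearMap.comp_apply, ← LinearMap.comp_apply,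
    ← TensorProduct.map_comp, ← TensorProduct.map_comp]
  rfl

/-- The inclusion of the super-bosonisation over `A` into the bosonisation over `H`. -/
def smashIncl : Smash hR →ₐ[k] Smash hQ :=
  Smash.lift _ ((inH hQ).comp i) (inB hQ) (fun x a => by
    have h := crossRel_inB hQ x (i a)
    simp only [AlgHom.toLinearMap_apply, AlgHom.comp_apply] at h ⊢
    rw [h, X.comul_incl, ← LinearMap.comp_apply (TensorProduct.map _ _), ← TensorProduct.map_comp]
    rfl)

theorem smashIncl_inH (a : A) : X.smashIncl q hq hker (inH _ a) = inH hQ (i a) := lift_inH ..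
theorem smashIncl_inB (x : B) : X.smashIncl q hq hker (inB _ x) = inB hQ x := lift_inB ..

/-- The projection of the bosonisation over `H` onto the super-bosonisation over `A`. -/
def smashProj : Smash hQ →ₗ[k] Smash hR :=
  (of hR).toLinearMap ∘ₗ TensorProduct.map p.toLinearMap LinearMap.id ∘ₗ (of hQ).symm.toLinearMap

theorem smashProj_of (h : H) (x : B) :
    X.smashProj q hq hker (of hQ (h ⊗ₜ x)) = of hR (p h ⊗ₜ x) := rfl

theorem smashProj_inH_mul (h : H) (w : Smash hQ) :
    X.smashProj q hq hker (inH hQ h * w) = inH hR (p h) * X.smashProj q hq hker w := by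
  obtain ⟨w, rfl⟩ := (of hQ).surjective w
  induction w with
  | zero => simp
  | add s t hs ht => simp only [map_add, mul_add, hs, ht]
  | tmul b x => simp [inH_mul_of, smashProj]

theorem smashProj_inB (x : B) : X.smashProj q hq hker (inB hQ x) = inB hR x := by
  simp [smashProj, inB_apply]

/-- The grading of the super-bosonisation. -/
instance gradedAlgebra : GradedAlgebra (Smash.deg hR (quotDeg q)) :=
  letI := quotGraded q C' hq hker
  Smash.gradedAlgebra hR fun a _ _ hx => act_mem_quotDeg q C' hq hker (i a) hx

/-- `Γ` is central over `A` and crosses an element of degree `n` of the braided algebra with the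
sign `(-1)^n`; `H = A + ΓA` gives the decomposition of the larger algebra. -/
theorem isSuperCover :
    IsSuperCover (Smash.deg hR (quotDeg q)) (X.smashIncl q hq hker) (X.smashProj q hq hker)
      (inH hQ Γ) := by
  refine ⟨fun w => ?_, ?_, fun w => ?_, fun n w hw => ?_, fun w => ?_⟩
  · obtain ⟨w, rfl⟩ := (of hR).surjective w
    induction w with
    | zero => simp
    | add s t hs ht => simp only [map_add, hs, ht]
    | tmul a x =>
      rw [← inH_mul_inB, map_mul, smashIncl_inH, smashIncl_inB, smashProj_inH_mul, smashProj_inB,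
        X.proj_incl]
  · rw [← map_mul, X.Γ_mul_Γ, map_one]
  · rw [smashProj_inH_mul, X.proj_Γ, map_one, one_mul]
  · refine deg_le (L := LinearMap.eqLocus (LinearMap.mulRight k (inH hQ Γ) ∘ₗ
      (X.smashIncl q hq hker).toLinearMap) ((-1 : k) ^ n • (LinearMap.mulLeft k (inH hQ Γ) ∘ₗ
      (X.smashIncl q hq hker).toLinearMap))) hR ?_ hw
    intro a x hx
    simp only [LinearMap.mem_eqLocus, LinearMap.comp_apply, LinearMap.smul_apply,
      LinearMap.mulLeft_apply, LinearMap.mulRight_apply, AlgHom.toLinearMap_apply]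
    -- At a group-like element the cross relation is `x Γ = Γ (x ◁ Γ)`.
    have h := crossRel_inB hQ x Γ
    rw [X.comul_Γ, TensorProduct.map_tmul, LinearMap.mul'_apply, LinearMap.comp_apply,
      LinearMap.flip_apply,
      act_groupLike_quotDeg q C' hq hker X.comul_Γ X.counit_Γ X.act_Γ hx, map_smul] at h
    simp only [AlgHom.toLinearMap_apply] at h
    rw [← inH_mul_inB, map_mul, smashIncl_inH, smashIncl_inB, mul_assoc, h, mul_smul_comm,
      mul_smul_comm, ← mul_assoc, ← mul_assoc, ← map_mul, ← map_mul, X.incl_mul_Γ]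
  · obtain ⟨w, rfl⟩ := (of hQ).surjective w
    induction w with
    | zero => exact ⟨0, 0, by simp⟩
    | add s t hs ht =>
      obtain ⟨a, b, h⟩ := hs
      obtain ⟨c, d, h'⟩ := ht
      exact ⟨a + c, b + d, by rw [map_add, h, h']; simp only [map_add, mul_add]; abel⟩
    | tmul h x =>
      obtain ⟨a, b, rfl⟩ := X.span h
      refine ⟨inH hR a * inB hR x, inH hR b * inB hR x, ?_⟩
      rw [← inH_mul_inB, map_mul, map_mul, smashIncl_inH, smashIncl_inB, smashIncl_inH, map_add,
        map_mul, add_mul, mul_assoc]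

end IsSuperExtension

/-! ### The coproduct of the super-bosonisation. -/

namespace IsSuperExtension

open Smash RightCrossedModule Nichols

variable {k A H V B : Type*} [Field k] [Ring A] [HopfAlgebra k A] [Ring H]
    [HopfAlgebra k H] [AddCommGroup V] [Module k V] [Ring B] [Algebra k B]
    {C : RightCrossedModule k A V}
    {C' : RightCrossedModule k H V} {i : A →ₐ[k] H} {p : H →ₐ[k] A} {Γ : H}
    (X : IsSuperExtension C C' i p Γ) (q : TensorAlgebra k V →ₐ[k] B)
    (hq : Function.Surjective q) (hker : ∀ x, q x = 0 ↔ x ∈ tensorRadical C')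

local notation "hQ" => isCrossedAlg_quot C' q hq hker
local notation "hR" => isCrossedAlg_restrict X q hq hker
local notation "jV" => AlgHom.toLinearMap q ∘ₗ TensorAlgebra.ι k
local notation "PG" => quotPrimGen C' q hq hker
local notation "sI" => smashIncl X q hq hker
local notation "sP" => smashProj X q hq hker
local notation "sC" => isSuperCover X q hq hker
local notation "sD" => PrimGen.comulHom (quotPrimGen C' q hq hker)

include X in
theorem comulHom_Γ : sD (inH hQ Γ) = inH hQ Γ ⊗ₜ inH hQ Γ := by
  rw [PrimGen.comulHom_inH, comulH, AlgHom.comp_apply, Bialgebra.comulAlgHom_apply, X.comul_Γ,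
    Algebra.TensorProduct.map_tmul]

theorem comulHom_smashIncl_inH (a : A) : sD (sI (inH hR a))
    = TensorProduct.map (AlgHom.toLinearMap sI ∘ₗ (inH hR).toLinearMap)
      (AlgHom.toLinearMap sI ∘ₗ (inH hR).toLinearMap) (comul a) := by
  rw [smashIncl_inH, PrimGen.comulHom_inH, comulH, AlgHom.comp_apply,
    Bialgebra.comulAlgHom_apply, X.comul_incl]
  induction (comul a : A ⊗[k] A) with
  | zero => simp
  | add s t hs ht => simp only [map_add, hs, ht]
  | tmul a b => simp [smashIncl_inH]

theorem comulHom_smashIncl_ι (v : V) : sD (sI (inB hR (jV v)))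
    = TensorProduct.map (AlgHom.toLinearMap sI ∘ₗ (inB hR).toLinearMap ∘ₗ jV)
      (LinearMap.mulLeft k (inH hQ Γ) ∘ₗ AlgHom.toLinearMap sI ∘ₗ (inH hR).toLinearMap) (C.coact v)
      + 1 ⊗ₜ sI (inB hR (jV v)) := by
  rw [smashIncl_inB, PrimGen.comulHom_inB, PrimGen.g_ι' PG, X.coact_eq]
  congr 1
  induction C.coact v with
  | zero => simp
  | add s t hs ht => simp only [map_add, hs, ht]
  | tmul a b => simp [smashIncl_inH, smashIncl_inB]

/-- The image of the twist is a subalgebra, so generators suffice. The terms `a₁ ⊗ a₂` and `1 ⊗ v`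
have first leg of degree zero and no `Γ`; in `v₀ ⊗ Γv₁` the first leg has degree one and the
coaction over `H` supplies the one `Γ` required. -/
theorem comulHom_smashIncl_mem (w : Smash hR) : sD (sI w) ∈ ((sC).tensorTwist).range := by
  obtain ⟨w, rfl⟩ := (of hR).surjective w
  induction w with
  | zero => rw [map_zero, map_zero, map_zero]; exact Subalgebra.zero_mem _
  | add s t hs ht => rw [map_add, map_add, map_add]; exact Subalgebra.add_mem _ hs ht
  | tmul a x =>
    rw [← inH_mul_inB, map_mul, map_mul]
    refine Subalgebra.mul_mem _ ?_ ?_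
    · rw [comulHom_smashIncl_inH]
      induction (comul a : A ⊗[k] A) with
      | zero => rw [map_zero]; exact Subalgebra.zero_mem _
      | add s t hs ht => rw [map_add]; exact Subalgebra.add_mem _ hs ht
      | tmul a b =>
        refine ⟨GradedTensorProduct.of k _ _ (inH hR a ⊗ₜ inH hR b), ?_⟩
        refine ((sC).tensorTwist_of_mem (inH_mem_deg hR a) _).trans ?_
        rw [pow_zero, one_mul]
        rfl
    · have hx : x ∈ Algebra.adjoin k (Set.range jV) := by
        rw [adjoin_range_comp_ι q hq]; trivial
      induction hx using Algebra.adjoin_induction with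
      | algebraMap r =>
        rw [AlgHom.commutes, AlgHom.commutes, AlgHom.commutes]
        exact Subalgebra.algebraMap_mem _ r
      | add x y _ _ hx hy => rw [map_add, map_add, map_add]; exact Subalgebra.add_mem _ hx hy
      | mul x y _ _ hx hy => rw [map_mul, map_mul, map_mul]; exact Subalgebra.mul_mem _ hx hy
      | mem x hx =>
        obtain ⟨v, rfl⟩ := hx
        rw [comulHom_smashIncl_ι]
        refine Subalgebra.add_mem _ ?_ ?_
        · induction C.coact v with
          | zero => rw [map_zero]; exact Subalgebra.zero_mem _
          | add s t hs ht => rw [map_add]; exact Subalgebra.add_mem _ hs ht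
          | tmul v b =>
            refine ⟨GradedTensorProduct.of k _ _ (inB hR (jV v) ⊗ₜ inH hR b), ?_⟩
            refine ((sC).tensorTwist_of_mem (inB_mem_deg hR (ι_mem_quotDeg q v)) _).trans ?_
            rw [pow_one]
            rfl
        · refine ⟨GradedTensorProduct.of k _ _ (1 ⊗ₜ inB hR (jV v)), ?_⟩
          refine ((sC).tensorTwist_of_mem (SetLike.GradedOne.one_mem) _).trans ?_
          rw [pow_zero, one_mul, map_one]

/-- The coalgebra structure of the super-bosonisation. -/
instance coalgebra : Coalgebra k (Smash hR) where
  comul := IsSuperCover.comul sI sP sD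
  counit := ((PrimGen.counitHom PG).comp sI).toLinearMap
  coassoc := by
    refine LinearMap.ext fun w => ?_
    exact (sC).comul_coassoc (comulHom_Γ X q hq hker)
      (fun w => AlgHom.congr_fun (PrimGen.coassoc PG) w) w
  rTensor_counit_comp_comul := by
    refine LinearMap.ext fun w => (TensorProduct.lid k _).injective ?_
    refine ((sC).counit_comul_left (PrimGen.counitHom PG) ?_
      (fun w => AlgHom.congr_fun (PrimGen.counit_left PG) w) w).trans ?_
    · rw [PrimGen.counitHom_inH, X.counit_Γ]
    · simp
  lTensor_counit_comp_comul := by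
    refine LinearMap.ext fun w => (TensorProduct.rid k _).injective ?_
    refine ((sC).counit_comul_right (PrimGen.counitHom PG) ?_
      (fun w => AlgHom.congr_fun (PrimGen.counit_right PG) w) w).trans ?_
    · rw [PrimGen.counitHom_inH, X.counit_Γ]
    · simp

theorem comul_def (w : Smash hR) : comul (R := k) w = IsSuperCover.comul sI sP sD w := rfl

theorem counit_def (w : Smash hR) : counit (R := k) w = PrimGen.counitHom PG (sI w) := rfl

theorem counit_of (a : A) (x : B) : counit (R := k) (of hR (a ⊗ₜ x))
    = counit (R := k) a * quotCounit C' q hq hker x := by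
  rw [counit_def, ← inH_mul_inB, map_mul, map_mul, smashIncl_inH, smashIncl_inB,
    PrimGen.counitHom_inH, PrimGen.counitHom_inB, X.counit_incl]

local notation "ΔB" => PrimGen.bcomul (quotG C' q hq hker)

/-- By `untwist_bcomul` the coproduct over `H` is `a₁(x¹)₀ ⊗ a₂(x¹)₁x²`. Projecting to `A` discards
the powers of `Γ` and turns the coaction over `H` into that over `A`. -/
theorem comul_of (z : A ⊗[k] B) : comul (of hR z)
    = TensorProduct.map (of hR).toLinearMap (of hR).toLinearMap
      (bosonisationComul (X.restrict q hq hker) ΔB z) := by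
  induction z with
  | zero => simp
  | add s t hs ht => simp only [map_add, hs, ht]
  | tmul a x =>
    rw [comul_def, IsSuperCover.comul, LinearMap.comp_apply, LinearMap.comp_apply,
      AlgHom.toLinearMap_apply, AlgHom.toLinearMap_apply, ← inH_mul_inB, map_mul, map_mul,
      comulHom_smashIncl_inH, smashIncl_inB, PrimGen.comulHom_inB,
      ← PrimGen.untwist_bcomul PG, bosonisationComul, LinearMap.comp_apply, LinearMap.comp_apply,
      TensorProduct.map_tmul, LinearMap.comp_apply, LinearMap.comp_apply]
    generalize ΔB x = y
    induction (comul a : A ⊗[k] A) with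
    | zero => simp
    | add s t hs ht => simp only [map_add, add_mul, TensorProduct.add_tmul, hs, ht]
    | tmul a b =>
      induction y with
      | zero => simp
      | add s t hs ht => simp only [map_add, mul_add, TensorProduct.tmul_add, hs, ht]
      | tmul y z =>
        simp only [PrimGen.untwist, LinearMap.comp_apply, TensorProduct.map_tmul, LinearMap.id_apply,
          restrict_coact, LinearEquiv.coe_coe]
        induction (quotCrossed C' q hq hker).coact y with
        | zero => simp
        | add s t hs ht =>
          simp only [map_add, mul_add, TensorProduct.tmul_add, TensorProduct.add_tmul, hs, ht]
        | tmul y c =>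
          simp [smashIncl_inH, smashProj_of, inH_mul_of, inB_apply, X.proj_incl]

theorem isSuperBosonisation : IsSuperBosonisation (X.restrict q hq hker) ΔB
    (quotCounit C' q hq hker).toLinearMap (quotDeg q) (of hR) (Smash.deg hR (quotDeg q)) where
  one_eq := rfl
  mul_eq a x b y := tmul_mul_tmul hR a b x y
  comul_eq := comul_of X q hq hker
  counit_eq := counit_of X q hq hker
  deg_eq _ := rfl

end IsSuperExtension

/-! ### The super-Hopf algebra structure. -/

namespace IsSuperExtension

open Smash RightCrossedModule Nichols GradedCoalgebra

variable {k A H V B : Type*} [Field k] [Ring A] [HopfAlgebra k A] [Ring H]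
    [HopfAlgebra k H] [AddCommGroup V] [Module k V] [Ring B] [Algebra k B]
    {C : RightCrossedModule k A V}
    {C' : RightCrossedModule k H V} {i : A →ₐ[k] H} {p : H →ₐ[k] A} {Γ : H}
    (X : IsSuperExtension C C' i p Γ) (q : TensorAlgebra k V →ₐ[k] B)
    (hq : Function.Surjective q) (hker : ∀ x, q x = 0 ↔ x ∈ tensorRadical C')

local notation "hQ" => isCrossedAlg_quot C' q hq hker
local notation "hR" => isCrossedAlg_restrict X q hq hker
local notation "jV" => AlgHom.toLinearMap q ∘ₗ TensorAlgebra.ι k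
local notation "PG" => quotPrimGen C' q hq hker
local notation "sI" => smashIncl X q hq hker
local notation "sP" => smashProj X q hq hker
local notation "sC" => isSuperCover X q hq hker
local notation "sD" => PrimGen.comulHom (quotPrimGen C' q hq hker)
local notation "ΔB" => PrimGen.bcomul (quotG C' q hq hker)
local notation "degR" => Smash.deg (isCrossedAlg_restrict X q hq hker) (quotDeg q)

theorem quotCounit_of_mem {n : ℕ} (hn : n ≠ 0) {x : B} (hx : x ∈ quotDeg q n) :
    quotCounit C' q hq hker x = 0 := by
  obtain ⟨t, rfl⟩ := hx
  obtain ⟨n, rfl⟩ := Nat.exists_eq_succ_of_ne_zero hn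
  rw [LinearMap.comp_apply, AlgHom.toLinearMap_apply, quotCounit_apply, ε_toTensorAlgebra]

theorem comul_mem_tensorDeg {n : ℕ} {w : Smash hR} (hw : w ∈ degR n) :
    (comul w : Smash hR ⊗[k] Smash hR) ∈ tensorDeg degR degR n := by
  refine deg_le (L := (tensorDeg degR degR n).comap (comul : Smash hR →ₗ[k] _)) hR ?_ hw
  intro a x hx
  have h := bcomul_quotG_mem q C' hq hker hx
  rw [Submodule.mem_comap, comul_of, bosonisationComul, LinearMap.comp_apply, LinearMap.comp_apply,
    TensorProduct.map_tmul, LinearMap.comp_apply, LinearMap.comp_apply]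
  induction (comul a : A ⊗[k] A) with
  | zero => simp
  | add s t hs ht => simp only [TensorProduct.add_tmul, map_add]; exact add_mem hs ht
  | tmul a b =>
    refine tensorDeg_le (L := (tensorDeg degR degR n).comap
      (TensorProduct.map (of hR).toLinearMap (of hR).toLinearMap
      ∘ₗ TensorProduct.map LinearMap.id
      (TensorProduct.map (LinearMap.mul' k A) LinearMap.id
        ∘ₗ (TensorProduct.assoc k A A B).symm.toLinearMap)
      ∘ₗ (TensorProduct.tensorTensorTensorComm k A A B (A ⊗[k] B)).toLinearMap
      ∘ₗ TensorProduct.mk k _ _ (a ⊗ₜ[k] b) ∘ₗ (TensorProduct.assoc k B A B).toLinearMap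
      ∘ₗ TensorProduct.map (X.restrict q hq hker).coact LinearMap.id)) ?_ h
    intro i j hij x hx y hy
    obtain ⟨z, hz⟩ := X.restrict_coact_mem q hq hker hx
    simp only [Submodule.mem_comap, LinearMap.comp_apply, TensorProduct.map_tmul, ← hz]
    clear hz
    induction z with
    | zero => simp
    | add s t hs ht =>
      simp only [map_add, TensorProduct.add_tmul]
      exact add_mem hs ht
    | tmul x c => exact tmul_mem_tensorDeg hij (of_mem_deg hR _ x.2) (of_mem_deg hR _ hy)

theorem comul_inH (a : A) : comul (R := k) (inH hR a)
    = TensorProduct.map (inH hR).toLinearMap (inH hR).toLinearMap (comul a) := by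
  rw [comul_def, IsSuperCover.comul, LinearMap.comp_apply, LinearMap.comp_apply,
    AlgHom.toLinearMap_apply, AlgHom.toLinearMap_apply, comulHom_smashIncl_inH]
  induction (comul a : A ⊗[k] A) with
  | zero => simp
  | add s t hs ht => simp only [map_add, hs, ht]
  | tmul a b => simp [(sC).proj_incl]

theorem counit_inH (a : A) : counit (R := k) (inH hR a) = counit (R := k) a := by
  rw [inH_apply, counit_of, map_one, mul_one]

theorem deg_zero_le : degR 0 ≤ LinearMap.range (inH hR).toLinearMap := by
  refine deg_le hR fun a x hx => ?_
  obtain ⟨t, rfl⟩ := hx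
  obtain ⟨c, rfl⟩ := BraidedPower.exists_eq_smul_one t
  refine ⟨c • a, ?_⟩
  rw [map_smul, LinearMap.comp_apply, map_smul TensorPower.toTensorAlgebra,
    BraidedPower.toTensorAlgebra_gOne', AlgHom.toLinearMap_apply,
    AlgHom.toLinearMap_apply, map_smul q, map_one, TensorProduct.tmul_smul, map_smul]
  rfl

/-- The antipode of `A`, extended by zero to the super-bosonisation. -/
def degZeroAntipode : Smash hR →ₗ[k] Smash hR :=
  (inH hR).toLinearMap ∘ₗ HopfAlgebra.antipode k ∘ₗ (TensorProduct.rid k A).toLinearMap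
    ∘ₗ TensorProduct.map LinearMap.id (quotCounit C' q hq hker).toLinearMap
    ∘ₗ (of hR).symm.toLinearMap

theorem degZeroAntipode_of (a : A) (x : B) : X.degZeroAntipode q hq hker (of hR (a ⊗ₜ x))
    = inH hR (HopfAlgebra.antipode k (quotCounit C' q hq hker x • a)) := by
  simp [degZeroAntipode]

theorem degZeroAntipode_inH (a : A) : X.degZeroAntipode q hq hker (inH hR a)
    = inH hR (HopfAlgebra.antipode k a) := by
  rw [inH_apply, degZeroAntipode_of, map_one, one_smul]

theorem isGradedSuperHopf : IsGradedSuperHopf degR where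
  comul_deg n w hw := X.comul_mem_tensorDeg q hq hker hw
  counit_deg n hn w hw := by
    refine deg_le (L := LinearMap.ker (counit : Smash hR →ₗ[k] k)) hR ?_ hw
    intro a x hx
    rw [LinearMap.mem_ker, counit_of, quotCounit_of_mem q hq hker hn hx, mul_zero]
  comul_one := by
    rw [← map_one (inH hR), comul_inH, Bialgebra.comul_one, Algebra.TensorProduct.one_def]
    rfl
  comul_mul := (sC).comul_mul (comulHom_smashIncl_mem X q hq hker)
  counit_one := by rw [counit_def, map_one, map_one]
  counit_mul x y := by rw [counit_def, map_mul, map_mul]; rfl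
  exists_antipode := by
    -- The degree zero part is `A`; its antipode, extended by zero, is the initial approximation
    -- that the geometric series corrects in higher degrees.
    refine exists_antipode (fun n w hw => X.comul_mem_tensorDeg q hq hker hw) ?_
      (toConv (X.degZeroAntipode q hq hker)) ?_ ?_ ?_
    · intro n hn w hw
      refine deg_le (L := LinearMap.ker (counit : Smash hR →ₗ[k] k)) hR ?_ hw
      intro a x hx
      rw [LinearMap.mem_ker, counit_of, quotCounit_of_mem q hq hker hn hx, mul_zero]
    · intro n w hw
      refine deg_le (L := (degR n).comap (X.degZeroAntipode q hq hker)) hR ?_ hw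
      intro a x hx
      rw [Submodule.mem_comap, degZeroAntipode_of]
      by_cases hn : n = 0
      · subst hn
        exact inH_mem_deg hR _
      · rw [quotCounit_of_mem q hq hker hn hx, zero_smul, map_zero, map_zero]
        exact Submodule.zero_mem _
    · intro w hw
      obtain ⟨a, rfl⟩ := X.deg_zero_le q hq hker hw
      rw [AlgHom.toLinearMap_apply, convMul_apply, comul_inH, counit_inH,
        ← AlgHom.commutes (inH hR), ← HopfAlgebra.mul_antipode_rTensor_comul_apply]
      induction (comul a : A ⊗[k] A) with
      | zero => simp
      | add s t hs ht => simp only [map_add, hs, ht]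
      | tmul a b => simp [degZeroAntipode_inH]
    · intro w hw
      obtain ⟨a, rfl⟩ := X.deg_zero_le q hq hker hw
      rw [AlgHom.toLinearMap_apply, convMul_apply, comul_inH, counit_inH,
        ← AlgHom.commutes (inH hR), ← HopfAlgebra.mul_antipode_lTensor_comul_apply]
      induction (comul a : A ⊗[k] A) with
      | zero => simp
      | add s t hs ht => simp only [map_add, hs, ht]
      | tmul a b => simp [degZeroAntipode_inH]

end IsSuperExtension

/-! ### The space `V □ A` and the morphism `ω`. -/

namespace RightCrossedModule

open Convolution

variable {k A V : Type*} [CommRing k] [Ring A] [HopfAlgebra k A] [AddCommGroup V] [Module k V]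
  {C : RightCrossedModule k A V}

/-- Right multiplication of `A` on `V ⊗ A`. -/
def rightMul (k A V : Type*) [CommRing k] [Ring A] [HopfAlgebra k A] [AddCommGroup V] [Module k V] :
    A →ₗ[k] Module.End k (V ⊗[k] A) :=
  LinearMap.lTensorHom V ∘ₗ (LinearMap.mul k A).flip

theorem rightMul_mul (a b : A) (x : V ⊗[k] A) :
    rightMul k A V (a * b) x = rightMul k A V b (rightMul k A V a x) := by
  induction x with
  | zero => simp
  | add s t hs ht => simp only [map_add, hs, ht]
  | tmul v c => simp [rightMul, mul_assoc]

theorem rightMul_one (x : V ⊗[k] A) : rightMul k A V 1 x = x := by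
  induction x with
  | zero => simp
  | add s t hs ht => simp only [map_add, hs, ht]
  | tmul v c => simp [rightMul]

theorem rightMul_leftMul (a b : A) (x : V ⊗[k] A) :
    rightMul k A V a (leftMul k A V b x) = leftMul k A V b (rightMul k A V a x) := by
  induction x with
  | zero => simp
  | add s t hs ht => simp only [map_add, hs, ht]
  | tmul v c => simp [rightMul, leftMul, mul_assoc]

theorem map_leftAd (a : A) (x : V ⊗[k] A) : TensorProduct.map LinearMap.id (leftAd k A a) x
    = endAct (leftMul k A V).toLinearMap
      (LinearMap.applyₗ x ∘ₗ rightMul k A V ∘ₗ HopfAlgebra.antipode k) a := by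
  simp only [leftAd, conv, endAct, LinearMap.comp_apply]
  induction (comul a : A ⊗[k] A) with
  | zero => simp
  | add s t hs ht =>
    rw [map_add, map_add, TensorProduct.map_add_right, LinearMap.add_apply, hs, ht, map_add,
      map_add]
  | tmul c d =>
    induction x with
    | zero => simp
    | add s t hs ht => simp only [map_add, LinearMap.add_comp, TensorProduct.map_add_right,
      LinearMap.add_apply, hs, ht]
    | tmul v b => simp [leftMul, rightMul]

/-- On `V □ A` the diagonal right action is left multiplication. -/
theorem diagAct_of_mem_box {x : V ⊗[k] A} (hx : x ∈ C.box) (a : A) :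
    diagAct C.act x a = leftMul k A V a x := by
  -- `F` is `a ⊗ b ⊗ c ↦ ∑ vᵢ ⊗ a bᵢ S(b) c` for `x = ∑ vᵢ ⊗ bᵢ`. Membership in `V □ A` rewrites `vᵢ
  -- ◁ a₁ ⊗ bᵢa₂` as `vᵢ ⊗ a₁bᵢS(a₂)a₃`, and the antipode axiom leaves `vᵢ ⊗ a bᵢ`.
  let F : A ⊗[k] (A ⊗[k] A) →ₗ[k] V ⊗[k] A := TensorProduct.lift LinearMap.id ∘ₗ
    TensorProduct.map (leftMul k A V).toLinearMap (LinearMap.applyₗ x ∘ₗ rightMul k A V ∘ₗ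
      LinearMap.mul' k A ∘ₗ TensorProduct.map (HopfAlgebra.antipode k) LinearMap.id)
  have h1 : ∀ t : A ⊗[k] A, TensorProduct.map₂ C.act.flip (LinearMap.mul k A) x t
      = F (TensorProduct.assoc k A A A (TensorProduct.map comul LinearMap.id t)) := by
    intro t
    induction t with
    | zero => simp
    | add s t hs ht => simp only [map_add, hs, ht]
    | tmul c d =>
      have e : TensorProduct.map₂ C.act.flip (LinearMap.mul k A) x (c ⊗ₜ d)
          = rightMul k A V d (TensorProduct.map (C.act c) LinearMap.id x) := by
        clear hx
        induction x with
        | zero => simp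
        | add s t hs ht => simp only [map_add, LinearMap.add_apply, hs, ht]
        | tmul v b => simp [rightMul]
      rw [e, hx c, map_leftAd, endAct, LinearMap.comp_apply, LinearMap.comp_apply,
        TensorProduct.map_tmul]
      induction (comul c : A ⊗[k] A) with
      | zero => simp
      | add s t hs ht => simp only [map_add, TensorProduct.add_tmul, hs, ht]
      | tmul c c' => simp [F, rightMul_leftMul, rightMul_mul]
  have h2 : ∀ t : A ⊗[k] A, F (TensorProduct.map LinearMap.id comul t)
      = leftMul k A V (TensorProduct.rid k A (TensorProduct.map LinearMap.id counit t)) x := by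
    intro t
    induction t with
    | zero => simp
    | add s t hs ht => simp only [map_add, LinearMap.add_apply, hs, ht]
    | tmul c d =>
      have e := HopfAlgebra.mul_antipode_rTensor_comul_apply (R := k) d
      rw [LinearMap.rTensor] at e
      simp [F, e, Algebra.algebraMap_eq_smul_one, rightMul_one]
  have h3 := lTensor_counit_comul (R := k) a
  rw [LinearMap.lTensor] at h3
  rw [diagAct, LinearMap.comp_apply, h1]
  refine (congrArg F (coassoc_apply a)).trans ?_
  rw [LinearMap.lTensor, h2, h3, TensorProduct.rid_tmul, one_smul]

theorem coact_act_eq (C : RightCrossedModule k A V) (a : A) (v : V) : C.coact (C.act a v)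
    = endAct ((leftMul k A V).toLinearMap ∘ₗ HopfAlgebra.antipode k)
      (diagAct C.act (C.coact v)) a := by
  rw [C.coact_act, conv_apply_eq_endAct]
  congr 2
  ext b
  exact conv_tensorHom_apply C.act b (C.coact v)

theorem diagAct_add (act : A →ₗ[k] Module.End k V) (x y : V ⊗[k] A) :
    diagAct act (x + y) = diagAct act x + diagAct act y := by
  ext a
  simp [diagAct]

theorem map_act_adCoact (C : RightCrossedModule k A V) (a : A) (v : V) :
    TensorProduct.map (C.act.flip v) LinearMap.id (adCoact k A a)
      = endAct ((leftMul k A V).toLinearMap ∘ₗ HopfAlgebra.antipode k)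
        (diagAct C.act (v ⊗ₜ 1)) a := by
  simp only [adCoact, conv, endAct, LinearMap.comp_apply]
  induction (comul a : A ⊗[k] A) with
  | zero => simp
  | add s t hs ht => simp only [map_add, hs, ht]
  | tmul c d =>
    simp only [TensorProduct.map_tmul, LinearMap.comp_apply, diagAct, LinearMap.mul'_apply,
      TensorProduct.lift.tmul, LinearMap.id_apply]
    induction (comul d : A ⊗[k] A) with
    | zero => simp
    | add s t hs ht => simp only [map_add, mul_add, hs, ht]
    | tmul d e => simp [leftMul]

/-- The counit on the middle leg of `a₂ ⊗ S(a₁)a₃` leaves `S(a₁)a₂ = ε(a)`. Multiplicativity of this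
contraction `A ⊗ A → A` lets it pass through the convolution products. -/
theorem map_counit_adCoact (a : A) (v : V) :
    TensorProduct.map ((counit : A →ₗ[k] k).smulRight v) LinearMap.id (adCoact k A a)
      = counit (R := k) a • v ⊗ₜ[k] (1 : A) := by
  let φ : A ⊗[k] A →ₐ[k] A := Algebra.TensorProduct.lift
    ((Algebra.ofId k A).comp (Bialgebra.counitAlgHom k A)) (AlgHom.id k A)
    (fun x y => Algebra.commutes _ _)
  have hφ : ∀ c d, φ (c ⊗ₜ d) = algebraMap k A (counit (R := k) c) * d :=
    fun c d => Algebra.TensorProduct.lift_tmul ..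
  have h1 : ∀ z : A ⊗[k] A,
      TensorProduct.map ((counit : A →ₗ[k] k).smulRight v) LinearMap.id z = v ⊗ₜ φ z := by
    intro z
    induction z with
    | zero => simp
    | add s t hs ht => simp only [map_add, TensorProduct.tmul_add, hs, ht]
    | tmul c d => simp [hφ, ← Algebra.smul_def, TensorProduct.smul_tmul]
  have h2 : postcomp A φ (toConv (adCoact k A)) = 1 := by
    rw [adCoact, conv_eq, conv_eq, toConv_ofConv, toConv_ofConv, map_mul, map_mul]
    have e1 : postcomp A φ (toConv ((TensorProduct.mk k A A).flip 1)) = 1 := by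
      ext b
      simp [postcomp_apply, hφ]
    have e2 : ∀ f : A →ₗ[k] A, postcomp A φ (toConv (TensorProduct.mk k A A 1 ∘ₗ f)) = toConv f := by
      intro f
      ext b
      simp [postcomp_apply, hφ]
    have e3 := e2 LinearMap.id
    rw [LinearMap.comp_id] at e3
    rw [e1, e2, e3, one_mul]
    exact antipode_mul_algHom (AlgHom.id k A)
  have h3 := congrArg (fun f : WithConv (A →ₗ[k] A) => f a) h2
  rw [h1]
  change v ⊗ₜ (postcomp A φ (toConv (adCoact k A)) a) = _
  rw [h3, LinearMap.convOne_apply, Algebra.algebraMap_eq_smul_one, TensorProduct.tmul_smul]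

theorem omega_comp_counitProj (C : RightCrossedModule k A V) (θ : V) :
    C.omega θ ∘ₗ counitProj k A = C.act.flip θ - (counit : A →ₗ[k] k).smulRight θ := by
  ext b
  change C.act (b - algebraMap k A (counit (R := k) b)) θ = _
  simp [Algebra.algebraMap_eq_smul_one, C.act_one]

/-- A vector `θ` with `Δ θ - θ ⊗ 1 ∈ V □ A` defines a morphism of crossed modules `a ↦ θ ◁ a`. -/
theorem isCrossedMorphism_omega (C : RightCrossedModule k A V) (θ : V)
    (hθ : C.coact θ - θ ⊗ₜ[k] (1 : A) ∈ C.box) : C.IsCrossedMorphism (C.omega θ) where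
  map_act a b := by
    have h : counit (R := k) (a : A) = 0 := a.2
    change C.act (a * b - algebraMap k A (counit (R := k) (a * b : A))) θ = C.act b (C.act a θ)
    rw [Bialgebra.counit_mul, h, zero_mul, map_zero, sub_zero, C.act_mul]
  map_coact a := by
    have h : counit (R := k) (a : A) = 0 := a.2
    -- The coaction on `θ` is split into its part in `V □ A` and `θ ⊗ 1`. On the first, the diagonal
    -- action is left multiplication, which `S(a₁)` cancels to `ε(a) = 0`; the second produces the
    -- adjoint coaction.
    have h2 : diagAct C.act (C.coact θ) = LinearMap.applyₗ (C.coact θ - θ ⊗ₜ[k] (1 : A))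
        ∘ₗ (leftMul k A V).toLinearMap + diagAct C.act (θ ⊗ₜ 1) := by
      conv_lhs => rw [← sub_add_cancel (C.coact θ) (θ ⊗ₜ[k] (1 : A)), diagAct_add]
      congr 1
      ext b
      exact diagAct_of_mem_box hθ b
    change C.coact (C.act a θ) = _
    rw [omega_comp_counitProj, sub_eq_add_neg, TensorProduct.map_add_left, LinearMap.add_apply,
      map_act_adCoact,
      ← neg_one_smul k, TensorProduct.map_smul_left, LinearMap.smul_apply, map_counit_adCoact, h,
      zero_smul, smul_zero, add_zero, coact_act_eq, h2]
    have h3 : ∀ f g g' : A →ₗ[k] V ⊗[k] A, ∀ s : A →ₗ[k] Module.End k (V ⊗[k] A),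
        endAct s (g + g') (a : A) = endAct s g a + endAct s g' a := by
      intro f g g' s
      simp [endAct, TensorProduct.map_add_right]
    rw [h3 0, ← conv_apply_eq_endAct, conv_eq, antipode_mul_algHom, LinearMap.convOne_apply, h,
      map_zero, LinearMap.zero_apply, zero_add]

end RightCrossedModule

/-! ### Consequences of the hypotheses on `θ`. -/

/-- Moving `g t` past `y` produces two signs, one from `t` and one from `g`, and they cancel. In the
application `t` is the defect `θ₀ ⊗ θ₁ - θ ⊗ 1`, `y` is `η₀ ⊗ η₁`, `e` is `1 ⊗ η`, and `g`, `g'` are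
`Γ` in the first and second leg. -/
theorem mul_comm_of_anticomm {R : Type*} [Ring R] {t y e g g' : R} (h1 : t * y + y * t = 0)
    (h2 : t * e = e * t) (h3 : t * g' = g' * t) (h4 : y * g = -(g * y)) (h5 : e * g = g * e)
    (h6 : g' * g = g * g') : g * t * (g' * y + e) = (g' * y + e) * (g * t) := by
  have h7 : t * y = -(y * t) := eq_neg_of_add_eq_zero_left h1
  have h8 : g' * y * (g * t) = g * t * (g' * y) :=
    calc g' * y * (g * t) = g' * (y * g) * t := by simp only [mul_assoc]
      _ = -(g' * g * (y * t)) := by rw [h4]; simp only [mul_neg, neg_mul, mul_assoc]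
      _ = g * (g' * (t * y)) := by rw [h6, h7]; simp only [mul_neg, mul_assoc]
      _ = g * (g' * t) * y := by simp only [mul_assoc]
      _ = g * t * (g' * y) := by rw [← h3]; simp only [mul_assoc]
  rw [mul_add, add_mul, h8, mul_assoc g t e, h2, ← mul_assoc e, h5, mul_assoc g e t]

namespace Nichols

open TensorPower BraidedPower

variable {k H V : Type*} [Field k] [Ring H] [HopfAlgebra k H] [AddCommGroup V] [Module k V]

/-- If `Ψ(θ ⊗ θ) = -θ ⊗ θ` then `θ²` lies in the radical. -/
theorem ι_mul_ι_mem_radical (C : RightCrossedModule k H V) (θ : V)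
    (h : C.braiding (θ ⊗ₜ θ) = -(θ ⊗ₜ θ)) :
    TensorAlgebra.ι k θ * TensorAlgebra.ι k θ ∈ tensorRadical C := by
  let s : ⨂[k]^0 V := PiTensorProduct.tprod k Fin.elim0
  have hs : toTensorAlgebra s = 1 := toTensorAlgebra_gOne'
  have ht : toTensorAlgebra (snoc (snoc s θ) θ)
      = TensorAlgebra.ι k θ * TensorAlgebra.ι k θ := by
    rw [toTensorAlgebra_snoc, toTensorAlgebra_snoc, hs, _root_.one_mul]
  have h1 : braidAt C.braiding 2 1 (snoc (snoc s θ) θ) = -(snoc (snoc s θ) θ) := by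
    apply toTensorAlgebra_injective
    refine (toTensorAlgebra_braidAt C.braiding s θ θ).trans ?_
    rw [h, map_neg, map_neg, map_neg, ht, hs, _root_.one_mul, toTensorAlgebra_squareEquiv]
    simp
  -- In degree two the braided integer is `Ψ₁ + id`, which vanishes on a vector of eigenvalue `-1`.
  have h2 : binom C.braiding 2 1 (snoc (snoc s θ) θ) = 0 := by
    have e0 : binom C.braiding 0 1 = 0 := rfl
    have e1 : binom C.braiding 1 1 = 1 := by
      refine LinearMap.ext fun t => ?_
      change (braidChain C.braiding 1 1 * tensId 1 + tensId (binom C.braiding 0 1) :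
        Module.End k (⨂[k]^1 V)) t = t
      rw [e0, braidChain_self, tensId_one]
      induction t using snoc_induction with
      | zero => simp
      | add s t hs ht => rw [map_add, hs, ht]
      | snoc s v => rw [LinearMap.add_apply, tensId_snoc]; simp [snoc]
    change (braidChain C.braiding 2 1 * tensId 1 + tensId (binom C.braiding 1 1) :
      Module.End k (⨂[k]^2 V)) _ = 0
    rw [e1, tensId_one, braidChain_succ _ 0 0 le_rfl, braidChain_self, tensId_one, _root_.one_mul,
      _root_.mul_one, LinearMap.add_apply, h1]
    simp
  rw [← ht]
  refine (toTensorAlgebra_mem_radical C 2 _).2 ?_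
  rw [factorial, Module.End.mul_apply, h2, map_zero]

end Nichols

namespace RightCrossedModule

variable {k A V : Type*} [CommRing k] [Ring A] [HopfAlgebra k A] [AddCommGroup V] [Module k V]

theorem map_act_coact (C : RightCrossedModule k A V) (η v : V) :
    TensorProduct.map LinearMap.id (C.act.flip η) (C.coact v) = C.braiding (η ⊗ₜ v) := by
  simp only [braiding, LinearMap.comp_apply, TensorProduct.map_tmul, LinearMap.id_apply]
  induction C.coact v with
  | zero => simp
  | add s t hs ht => simp only [map_add, TensorProduct.tmul_add, hs, ht]
  | tmul a b => simp

/-- If `Ψ(η ⊗ θ) = θ ⊗ η` then `θ₀ ⊗ θ₁ ⊗ η ◁ θ₂ = θ₀ ⊗ θ₁ ⊗ η`. -/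
theorem map_comul_coact_of_braiding (C : RightCrossedModule k A V) {θ η : V}
    (h : C.braiding (η ⊗ₜ θ) = θ ⊗ₜ η) :
    TensorProduct.map LinearMap.id (TensorProduct.map LinearMap.id (C.act.flip η) ∘ₗ comul)
      (C.coact θ) = TensorProduct.map LinearMap.id ((TensorProduct.mk k A V).flip η)
      (C.coact θ) := by
  have h1 : ∀ t : V ⊗[k] A, TensorProduct.map LinearMap.id
      (TensorProduct.map LinearMap.id (C.act.flip η))
      (TensorProduct.assoc k V A A (TensorProduct.map C.coact LinearMap.id t))
      = TensorProduct.assoc k V A V (TensorProduct.map C.coact LinearMap.id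
        (TensorProduct.map LinearMap.id (C.act.flip η) t)) := by
    intro t
    induction t with
    | zero => simp
    | add s t hs ht => simp only [map_add, hs, ht]
    | tmul v b =>
      simp only [TensorProduct.map_tmul, LinearMap.id_apply]
      induction C.coact v with
      | zero => simp
      | add s t hs ht => simp only [map_add, TensorProduct.add_tmul, hs, ht]
      | tmul v c => simp
  have h2 := h1 (C.coact θ)
  rw [C.coact_coassoc, map_act_coact, h, ← LinearMap.comp_apply, ← TensorProduct.map_comp,
    LinearMap.comp_id, TensorProduct.map_tmul, LinearMap.id_apply] at h2
  rw [h2]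
  induction C.coact θ with
  | zero => simp
  | add s t hs ht => simp only [map_add, TensorProduct.add_tmul, hs, ht]
  | tmul a b => simp

end RightCrossedModule

/-! ### The defect of `θ` commutes with the coproduct. -/

namespace IsSuperExtension

open Smash RightCrossedModule Nichols

variable {k A H V B : Type*} [Field k] [Ring A] [HopfAlgebra k A] [Ring H]
    [HopfAlgebra k H] [AddCommGroup V] [Module k V] [Ring B] [Algebra k B]
    {C : RightCrossedModule k A V}
    {C' : RightCrossedModule k H V} {i : A →ₐ[k] H} {p : H →ₐ[k] A} {Γ : H}
    (X : IsSuperExtension C C' i p Γ) (q : TensorAlgebra k V →ₐ[k] B)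
    (hq : Function.Surjective q) (hker : ∀ x, q x = 0 ↔ x ∈ tensorRadical C')

local notation "hQ" => isCrossedAlg_quot C' q hq hker
local notation "hR" => isCrossedAlg_restrict X q hq hker
local notation "jV" => AlgHom.toLinearMap q ∘ₗ TensorAlgebra.ι k
local notation "PG" => quotPrimGen C' q hq hker
local notation "sI" => smashIncl X q hq hker
local notation "sC" => isSuperCover X q hq hker
local notation "sD" => PrimGen.comulHom (quotPrimGen C' q hq hker)
local notation "Ω₂" => Smash hQ ⊗[k] Smash hQ
local notation "G₁" => (inH hQ Γ ⊗ₜ[k] (1 : Smash hQ) : Ω₂)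
local notation "G₂" => ((1 : Smash hQ) ⊗ₜ[k] inH hQ Γ : Ω₂)

variable (i) in
/-- The inclusion of `B ⊗ A` into the tensor square of the bosonisation. -/
def tensorIncl : B ⊗[k] A →ₐ[k] Ω₂ :=
  Algebra.TensorProduct.map (inB hQ) ((inH hQ).comp i)

local notation "κ" => tensorIncl i q hq hker

variable (i) in
theorem tensorIncl_tmul (x : B) (a : A) : κ (x ⊗ₜ a) = inB hQ x ⊗ₜ inH hQ (i a) := rfl

include X

theorem inB_ι_mul_Γ (v : V) : inB hQ (jV v) * inH hQ Γ = -(inH hQ Γ * inB hQ (jV v)) := by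
  have h := (sC).incl_mul_G 1 _ (inB_mem_deg hR (ι_mem_quotDeg q v))
  rw [smashIncl_inB, pow_one, neg_one_smul] at h
  exact h

theorem tensorIncl_mul_G₁ (z : V ⊗[k] A) :
    κ (TensorProduct.map jV LinearMap.id z) * G₁
      = -(G₁ * κ (TensorProduct.map jV LinearMap.id z)) := by
  induction z with
  | zero => simp
  | add s t hs ht => simp only [map_add, add_mul, mul_add, hs, ht]; abel
  | tmul v b =>
    rw [TensorProduct.map_tmul, tensorIncl_tmul, Algebra.TensorProduct.tmul_mul_tmul,
      Algebra.TensorProduct.tmul_mul_tmul, X.inB_ι_mul_Γ, mul_one, one_mul, TensorProduct.neg_tmul]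

theorem tensorIncl_mul_G₂ (z : B ⊗[k] A) : κ z * G₂ = G₂ * κ z := by
  induction z with
  | zero => simp
  | add s t hs ht => simp only [map_add, add_mul, mul_add, hs, ht]
  | tmul v b =>
    rw [tensorIncl_tmul, Algebra.TensorProduct.tmul_mul_tmul,
      Algebra.TensorProduct.tmul_mul_tmul, ← map_mul, ← map_mul, X.incl_mul_Γ, mul_one, one_mul]

theorem comulHom_smashIncl_ι' (v : V) : sD (sI (inB hR (jV v)))
    = G₂ * κ (TensorProduct.map jV LinearMap.id (C.coact v)) + 1 ⊗ₜ inB hQ (jV v) := by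
  rw [comulHom_smashIncl_ι, smashIncl_inB]
  congr 1
  induction C.coact v with
  | zero => simp
  | add s t hs ht => simp only [map_add, mul_add, hs, ht]
  | tmul v b => simp [tensorIncl_tmul, smashIncl_inH, smashIncl_inB]

/-- By `const_coact_mul`, moving `Δa` to the left of `x` leaves `a₁ ⊗ 1` in front and the diagonal
action of `a₂` on `x`. On `V □ A` the latter is left multiplication by `a₂` in the second leg, which
restores `Δa`. -/
theorem tensorIncl_mul_comulHom_inH {x : V ⊗[k] A} (hx : x ∈ C.box) (a : A) :
    κ (TensorProduct.map jV LinearMap.id x) * sD (sI (inH hR a))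
      = sD (sI (inH hR a)) * κ (TensorProduct.map jV LinearMap.id x) := by
  have h1 : TensorProduct.map (inB hQ).toLinearMap (inH hQ).toLinearMap
      (TensorProduct.map jV i.toLinearMap x) = κ (TensorProduct.map jV LinearMap.id x) := by
    clear hx
    induction x with
    | zero => simp
    | add s t hs ht => simp only [map_add, hs, ht]
    | tmul v b => simp [tensorIncl_tmul]
  have h2 : ∀ b, diagAct (quotCrossed C' q hq hker).act (TensorProduct.map jV i.toLinearMap x) (i b)
      = TensorProduct.map jV i.toLinearMap (diagAct C.act x b) := by
    intro b
    clear hx h1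
    simp only [diagAct, LinearMap.comp_apply, X.comul_incl]
    induction (comul b : A ⊗[k] A) with
    | zero => simp
    | add s t hs ht => simp only [map_add, hs, ht]
    | tmul b c =>
      induction x with
      | zero => simp
      | add s t hs ht => simp only [map_add, LinearMap.add_apply, hs, ht]
      | tmul v d => simp [quotCrossed_act_ι, X.act_incl]
  have h3 : ∀ b, TensorProduct.map (inB hQ).toLinearMap (inH hQ).toLinearMap
      (TensorProduct.map jV i.toLinearMap (leftMul k A V b x))
      = (1 ⊗ₜ inH hQ (i b)) * κ (TensorProduct.map jV LinearMap.id x) := by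
    intro b
    clear hx h1 h2
    induction x with
    | zero => simp
    | add s t hs ht => simp only [map_add, mul_add, hs, ht]
    | tmul v d => simp [leftMul, tensorIncl_tmul]
  have h4 := congrArg (fun f : WithConv (H →ₗ[k] Ω₂) => f (i a))
    (const_coact_mul hQ (TensorProduct.map jV i.toLinearMap x))
  simp only [Convolution.const_mul_apply] at h4
  rw [h1, Convolution.mul_apply, X.comul_incl] at h4
  rw [smashIncl_inH, PrimGen.comulHom_inH]
  refine h4.trans ?_
  rw [comulH, AlgHom.comp_apply, Bialgebra.comulAlgHom_apply, X.comul_incl]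
  induction (comul a : A ⊗[k] A) with
  | zero => simp
  | add s t hs ht => simp only [map_add, add_mul, hs, ht]
  | tmul a b => simp [h2, h3, diagAct_of_mem_box hx, ← mul_assoc]

/-- The cross relation gives `(1 ⊗ η)(θ₀ ⊗ θ₁) = θ₀ ⊗ θ₁(η ◁ θ₂)`, and the condition on the braiding
makes the action of `θ₂` trivial. -/
theorem tensorIncl_mul_inB {θ η : V} (h : C.braiding (η ⊗ₜ θ) = θ ⊗ₜ η) :
    κ (TensorProduct.map jV LinearMap.id (C.coact θ - θ ⊗ₜ[k] (1 : A))) * (1 ⊗ₜ inB hQ (jV η))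
      = (1 ⊗ₜ inB hQ (jV η))
        * κ (TensorProduct.map jV LinearMap.id (C.coact θ - θ ⊗ₜ[k] (1 : A))) := by
  let K : V ⊗[k] (A ⊗[k] V) →ₗ[k] Ω₂ := TensorProduct.map ((inB hQ).toLinearMap ∘ₗ jV)
    (LinearMap.mul' k _ ∘ₗ TensorProduct.map ((inH hQ).toLinearMap ∘ₗ i.toLinearMap)
      ((inB hQ).toLinearMap ∘ₗ jV))
  have h1 : ∀ t : V ⊗[k] A, κ (TensorProduct.map jV LinearMap.id t) * (1 ⊗ₜ inB hQ (jV η))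
      = K (TensorProduct.map LinearMap.id ((TensorProduct.mk k A V).flip η) t) := by
    intro t
    induction t with
    | zero => simp
    | add s t hs ht => simp only [map_add, add_mul, hs, ht]
    | tmul v b => simp [K, tensorIncl_tmul]
  have h2 : ∀ t : V ⊗[k] A, (1 ⊗ₜ inB hQ (jV η)) * κ (TensorProduct.map jV LinearMap.id t)
      = K (TensorProduct.map LinearMap.id
        (TensorProduct.map LinearMap.id (C.act.flip η) ∘ₗ comul) t) := by
    intro t
    induction t with
    | zero => simp
    | add s t hs ht => simp only [map_add, mul_add, hs, ht]
    | tmul v b =>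
      have e := crossRel_inB hQ (jV η) (i b)
      rw [AlgHom.toLinearMap_apply (inB hQ), AlgHom.toLinearMap_apply (inH hQ), X.comul_incl] at e
      rw [TensorProduct.map_tmul, tensorIncl_tmul, Algebra.TensorProduct.tmul_mul_tmul, one_mul,
        LinearMap.id_apply, e]
      simp only [TensorProduct.map_tmul, LinearMap.comp_apply, LinearMap.id_apply, K,
        AlgHom.toLinearMap_apply]
      congr 1
      induction (comul b : A ⊗[k] A) with
      | zero => simp
      | add s t hs ht => simp only [map_add, hs, ht]
      | tmul b c => simp [quotCrossed_act_ι, X.act_incl]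
  rw [h1, h2]
  simp only [map_sub]
  rw [C.map_comul_coact_of_braiding h]
  simp [Algebra.TensorProduct.one_def, C.act_one]

/-- The element controlling the failure of `θ` to be super-primitive. -/
def supercentral (_X : IsSuperExtension C C' i p Γ) (θ : V) : Ω₂ :=
  G₁ * κ (TensorProduct.map jV LinearMap.id (C.coact θ - θ ⊗ₜ[k] (1 : A)))

/-- The coproduct of `θ` is `θ₀ ⊗ Γθ₁ + 1 ⊗ θ`. Splitting `θ₀ ⊗ θ₁` into `θ ⊗ 1` and the defect
isolates the super-primitive part; the factor `Γ` in the first leg of the remainder is inserted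
twice, as `Γ² = 1`. -/
theorem comulHom_θ (θ : V) : sD (sI (inB hR (jV θ)))
    = inH hQ Γ ⊗ₜ inH hQ Γ * X.supercentral q hq hker θ
      + (sI (inB hR (jV θ)) ⊗ₜ inH hQ Γ + 1 ⊗ₜ sI (inB hR (jV θ))) := by
  have h : (inH hQ Γ ⊗ₜ[k] inH hQ Γ : Ω₂) * G₁ = G₂ := by
    rw [Algebra.TensorProduct.tmul_mul_tmul, ← map_mul, X.Γ_mul_Γ, map_one, mul_one]
  have h' : κ (TensorProduct.map jV LinearMap.id (C.coact θ))
      = κ (TensorProduct.map jV LinearMap.id (C.coact θ - θ ⊗ₜ[k] (1 : A)))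
        + inB hQ (jV θ) ⊗ₜ 1 := by
    have e : κ (TensorProduct.map jV LinearMap.id (θ ⊗ₜ[k] (1 : A))) = inB hQ (jV θ) ⊗ₜ 1 := by
      rw [TensorProduct.map_tmul, tensorIncl_tmul, LinearMap.id_apply, map_one, map_one]
    rw [← e, ← map_add, ← map_add, sub_add_cancel]
  rw [comulHom_smashIncl_ι', supercentral, ← mul_assoc, h, h', mul_add, smashIncl_inB,
    Algebra.TensorProduct.tmul_mul_tmul, one_mul, mul_one, add_assoc]

theorem supercentral_mul_inH {θ : V} (hθ : C.coact θ - θ ⊗ₜ[k] (1 : A) ∈ C.box)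
    (a : A) : X.supercentral q hq hker θ * sD (sI (inH hR a))
    = sD (sI (inH hR a)) * X.supercentral q hq hker θ := by
  have h : G₁ * sD (sI (inH hR a)) = sD (sI (inH hR a)) * G₁ := by
    rw [comulHom_smashIncl_inH]
    induction (comul a : A ⊗[k] A) with
    | zero => simp
    | add s t hs ht => simp only [map_add, add_mul, mul_add, hs, ht]
    | tmul a b =>
      simp only [TensorProduct.map_tmul, LinearMap.comp_apply, AlgHom.toLinearMap_apply,
        smashIncl_inH, Algebra.TensorProduct.tmul_mul_tmul, ← map_mul, X.incl_mul_Γ, one_mul,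
        mul_one]
  rw [supercentral, mul_assoc, X.tensorIncl_mul_comulHom_inH q hq hker hθ, ← mul_assoc, h,
    mul_assoc]

theorem supercentral_mul_inB {θ : V}
    (hΨ : ∀ η : V, C.braiding (η ⊗ₜ[k] θ) = θ ⊗ₜ[k] η)
    (hanti : ∀ η : V,
      TensorProduct.map jV LinearMap.id (C.coact θ - θ ⊗ₜ[k] (1 : A))
          * TensorProduct.map jV LinearMap.id (C.coact η)
        + TensorProduct.map jV LinearMap.id (C.coact η)
          * TensorProduct.map jV LinearMap.id (C.coact θ - θ ⊗ₜ[k] (1 : A)) = 0)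
    (η : V) : X.supercentral q hq hker θ * sD (sI (inB hR (jV η)))
    = sD (sI (inB hR (jV η))) * X.supercentral q hq hker θ := by
  rw [comulHom_smashIncl_ι', supercentral]
  have h1 := congrArg κ (hanti η)
  rw [map_zero, map_add, map_mul, map_mul] at h1
  have h2 := X.tensorIncl_mul_inB q hq hker (hΨ η)
  have h3 := X.tensorIncl_mul_G₂ q hq hker
    (TensorProduct.map jV LinearMap.id (C.coact θ - θ ⊗ₜ[k] (1 : A)))
  have h4 := X.tensorIncl_mul_G₁ q hq hker (C.coact η)
  have h5 : (1 ⊗ₜ inB hQ (jV η)) * G₁ = G₁ * (1 ⊗ₜ inB hQ (jV η)) := by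
    simp
  have h6 : G₂ * G₁ = G₁ * G₂ := by simp
  exact mul_comm_of_anticomm h1 h2 h3 h4 h5 h6

theorem supercentral_mul {θ : V} (hθ : C.coact θ - θ ⊗ₜ[k] (1 : A) ∈ C.box)
    (hΨ : ∀ η : V, C.braiding (η ⊗ₜ[k] θ) = θ ⊗ₜ[k] η)
    (hanti : ∀ η : V,
      TensorProduct.map jV LinearMap.id (C.coact θ - θ ⊗ₜ[k] (1 : A))
          * TensorProduct.map jV LinearMap.id (C.coact η)
        + TensorProduct.map jV LinearMap.id (C.coact η)
          * TensorProduct.map jV LinearMap.id (C.coact θ - θ ⊗ₜ[k] (1 : A)) = 0)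
    (w : Smash hR) : X.supercentral q hq hker θ * sD (sI w)
    = sD (sI w) * X.supercentral q hq hker θ := by
  -- The elements whose coproduct commutes with the defect form a subalgebra, so `A` and the
  -- generators `V` suffice.
  let S : Subalgebra k (Smash hR) :=
    (Subalgebra.centralizer k {X.supercentral q hq hker θ}).comap ((sD).comp sI)
  have hS : ∀ w, w ∈ S ↔ X.supercentral q hq hker θ * sD (sI w)
      = sD (sI w) * X.supercentral q hq hker θ := fun w => by
    simp [S, Subalgebra.mem_centralizer_iff]
  rw [← hS]
  obtain ⟨w, rfl⟩ := (of hR).surjective w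
  induction w with
  | zero => rw [map_zero]; exact Subalgebra.zero_mem _
  | add s t hs ht => rw [map_add]; exact Subalgebra.add_mem _ hs ht
  | tmul a x =>
    rw [← inH_mul_inB]
    refine Subalgebra.mul_mem _ ((hS _).2 (X.supercentral_mul_inH q hq hker hθ a)) ?_
    have h : (⊤ : Subalgebra k B) ≤ S.comap (inB hR) := by
      rw [← adjoin_range_comp_ι q hq]
      refine Algebra.adjoin_le ?_
      rintro _ ⟨v, rfl⟩
      exact (hS _).2 (X.supercentral_mul_inB q hq hker hΨ hanti v)
    exact h (Algebra.mem_top (x := x))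

end IsSuperExtension

/-! ### The inner differential of the super-bosonisation. -/

namespace IsSuperExtension

open Smash RightCrossedModule Nichols IsSuperCover

variable {k A H V B : Type*} [Field k] [Ring A] [HopfAlgebra k A] [Ring H]
    [HopfAlgebra k H] [AddCommGroup V] [Module k V] [Ring B] [Algebra k B]
    {C : RightCrossedModule k A V}
    {C' : RightCrossedModule k H V} {i : A →ₐ[k] H} {p : H →ₐ[k] A} {Γ : H}
    (X : IsSuperExtension C C' i p Γ) (q : TensorAlgebra k V →ₐ[k] B)
    (hq : Function.Surjective q) (hker : ∀ x, q x = 0 ↔ x ∈ tensorRadical C')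

local notation "hR" => isCrossedAlg_restrict X q hq hker
local notation "jV" => AlgHom.toLinearMap q ∘ₗ TensorAlgebra.ι k
local notation "sI" => smashIncl X q hq hker
local notation "sC" => isSuperCover X q hq hker
local notation "degR" => Smash.deg (isCrossedAlg_restrict X q hq hker) (quotDeg q)

theorem inH_injective : Function.Injective (inH hR) := by
  have h : Function.LeftInverse ((TensorProduct.rid k A).toLinearMap
      ∘ₗ TensorProduct.map LinearMap.id (quotCounit C' q hq hker).toLinearMap
      ∘ₗ (of hR).symm.toLinearMap) (inH hR) := fun a => by
    simp [inH_apply]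
  exact h.injective

theorem range_inH : LinearMap.range (inH hR).toLinearMap = degR 0 := by
  refine le_antisymm ?_ (X.deg_zero_le q hq hker)
  rintro _ ⟨a, rfl⟩
  exact inH_mem_deg hR a

/-- The inner derivation `[θ, ·}` of the super-bosonisation. -/
def superDiff (θ : V) : Smash hR →ₗ[k] Smash hR := innerDiff degR (inB hR (jV θ))

theorem superDiff_of_mem (θ : V) {n : ℕ} {w : Smash hR} (hw : w ∈ degR n) :
    X.superDiff q hq hker θ w = inB hR (jV θ) * w - (-1) ^ n * (w * inB hR (jV θ)) :=
  innerDiff_of_mem _ hw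

include X in
theorem inB_ι_mul_self {θ : V} (hΨ : C.braiding (θ ⊗ₜ[k] θ) = θ ⊗ₜ[k] θ) :
    inB hR (jV θ) * inB hR (jV θ) = 0 := by
  have h : q (TensorAlgebra.ι k θ * TensorAlgebra.ι k θ) = 0 :=
    (hker _).2 (ι_mul_ι_mem_radical C' θ (by rw [X.braiding, LinearMap.neg_apply, hΨ]))
  rw [← map_mul]
  change inB hR (q _ * q _) = 0
  rw [← map_mul, h, map_zero]

theorem isStronglyBicovariant {θ : V} (hθ : C.coact θ - θ ⊗ₜ[k] (1 : A) ∈ C.box)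
    (hΨ : ∀ η : V, C.braiding (η ⊗ₜ[k] θ) = θ ⊗ₜ[k] η)
    (hanti : ∀ η : V,
      TensorProduct.map jV LinearMap.id (C.coact θ - θ ⊗ₜ[k] (1 : A))
          * TensorProduct.map jV LinearMap.id (C.coact η)
        + TensorProduct.map jV LinearMap.id (C.coact η)
          * TensorProduct.map jV LinearMap.id (C.coact θ - θ ⊗ₜ[k] (1 : A)) = 0) :
    IsStronglyBicovariant (inH hR) degR (X.superDiff q hq hker θ) where
  superHopf := X.isGradedSuperHopf q hq hker
  differential := isDifferentialExterior_innerDiff _ (inB_mem_deg hR (ι_mem_quotDeg q θ))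
    (X.inB_ι_mul_self q hq hker (hΨ θ))
  j_injective := X.inH_injective q hq hker
  range_j := X.range_inH q hq hker
  j_comul := X.comul_inH q hq hker
  j_counit := X.counit_inH q hq hker
  comul_d := (sC).comul_innerDiff (X.comulHom_smashIncl_mem q hq hker) (X.comulHom_Γ q hq hker)
    (inB_mem_deg hR (ι_mem_quotDeg q θ)) _ (X.comulHom_θ q hq hker θ)
    (X.supercentral_mul q hq hker hθ hΨ hanti)

/-- The inner derivation `[θ, ·}` of the braided exterior algebra. -/
def braidedDiff (_X : IsSuperExtension C C' i p Γ) (θ : V) : B →ₗ[k] B :=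
  letI := quotGraded q C' hq hker
  innerDiff (quotDeg q) (jV θ)

theorem braidedDiff_of_mem (θ : V) {n : ℕ} {x : B} (hx : x ∈ quotDeg q n) :
    X.braidedDiff q hq hker θ x = jV θ * x - (-1) ^ n * (x * jV θ) :=
  letI := quotGraded q C' hq hker
  innerDiff_of_mem _ hx

/-- Here `ω(π(a₂)) = θ ◁ a₂ - ε(a₂)θ`, and the counit axiom collapses the second term to `a ⊗ θ x`.
-/
theorem map_omega_comul (θ : V) (a : A) (x : B) :
    TensorProduct.map LinearMap.id
        (LinearMap.mulRight k x ∘ₗ jV ∘ₗ C.omega θ ∘ₗ counitProj k A) (comul a)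
      = TensorProduct.map LinearMap.id
        (LinearMap.mulRight k x ∘ₗ (X.restrict q hq hker).act.flip (jV θ)) (comul a)
        - a ⊗ₜ (jV θ * x) := by
  have h1 : LinearMap.mulRight k x ∘ₗ (X.restrict q hq hker).act.flip (jV θ)
      = LinearMap.mulRight k x ∘ₗ jV ∘ₗ C.omega θ ∘ₗ counitProj k A
        + LinearMap.toSpanSingleton k B (jV θ * x) ∘ₗ counit := by
    rw [omega_comp_counitProj]
    refine LinearMap.ext fun b => ?_
    have h := X.restrict_act_ι q hq hker b θ
    rw [LinearMap.add_apply, LinearMap.comp_apply, LinearMap.flip_apply, h]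
    simp only [LinearMap.comp_apply, LinearMap.sub_apply, LinearMap.flip_apply,
      LinearMap.smulRight_apply, LinearMap.mulRight_apply, LinearMap.toSpanSingleton_apply, map_sub,
      map_smul, sub_add_cancel]
  rw [h1, TensorProduct.map_add_right, LinearMap.add_apply, eq_sub_iff_add_eq]
  congr 1
  have h2 := Coalgebra.lTensor_counit_comul (R := k) a
  rw [LinearMap.lTensor] at h2
  rw [← LinearMap.id_comp (LinearMap.id : A →ₗ[k] A), TensorProduct.map_comp,
    LinearMap.comp_apply (TensorProduct.map _ _), h2]
  simp

/-- The product `θ · (a ⊗ x)` is `a₁ ⊗ (θ ◁ a₂)x`. Subtracting and adding `a ⊗ θ x` separates the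
term with `ω` from `a ⊗ δx`. -/
theorem superDiff_of (θ : V) (a : A) (x : B) : X.superDiff q hq hker θ (of hR (a ⊗ₜ x))
    = of hR (TensorProduct.map LinearMap.id
        (LinearMap.mulRight k x ∘ₗ jV ∘ₗ C.omega θ ∘ₗ counitProj k A) (comul a))
      + of hR (a ⊗ₜ X.braidedDiff q hq hker θ x) := by
  let _ := quotGraded q C' hq hker
  induction x using DirectSum.Decomposition.inductionOn (quotDeg q) with
  | zero => simp
  | add x y hx hy =>
    have h : LinearMap.mulRight k (x + y) = LinearMap.mulRight k x + LinearMap.mulRight k y := by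
      ext; simp [mul_add]
    rw [TensorProduct.tmul_add, map_add, map_add, hx, hy, h, LinearMap.add_comp,
      TensorProduct.map_add_right, LinearMap.add_apply, map_add, map_add, TensorProduct.tmul_add,
      map_add]
    abel
  | @homogeneous n x =>
    have h1 : ∀ y, of hR (a ⊗ₜ x) * of hR (1 ⊗ₜ y) = of hR (a ⊗ₜ (x * y)) := fun y => by
      rw [tmul_mul_tmul, Bialgebra.comul_one, Algebra.TensorProduct.one_def, TensorProduct.map_tmul]
      simp [(X.restrict q hq hker).act_one]
    have h2 : ∀ y, (-1) ^ n * of hR (a ⊗ₜ y) = of hR (a ⊗ₜ ((-1) ^ n * y)) := fun y => by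
      rcases n.even_or_odd with h | h <;> simp [h.neg_one_pow, TensorProduct.tmul_neg]
    rw [X.superDiff_of_mem q hq hker θ (of_mem_deg hR a x.2), X.braidedDiff_of_mem q hq hker θ x.2,
      X.map_omega_comul q hq hker, inB_apply, tmul_mul_tmul hR, h1, h2, LinearMap.mulLeft_one,
      TensorProduct.tmul_sub, map_sub, map_sub]
    exact (sub_add_sub_cancel _ _ _).symm

end IsSuperExtension

/-! ### Specialisation to the braided-antisymmetric algebra. -/

namespace BMinus

open Nichols SuperExtension Smash

variable {k A V : Type*} [Field k] [Ring A] [HopfAlgebra k A] [AddCommGroup V] [Module k V]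
  (C : RightCrossedModule k A V)

theorem mk_surjective : Function.Surjective (mk C) := RingQuot.mkAlgHom_surjective k _

/-- The kernel of the quotient map is the radical of the crossed module twisted by signs. -/
theorem mk_eq_zero_iff (x : TensorAlgebra k V) : mk C x = 0 ↔ x ∈ tensorRadical (crossed C) := by
  have hΨ := (isSuperExtension C).braiding
  constructor
  · refine RingQuot.mkAlgHom_eq_zero_iff (BMinusRel C) _
      (fun x hx t => (tensorPrimGen _).mul_mem_radical_left isLinearPart_ιInv hx t)
      (fun x hx t => (tensorPrimGen _).mul_mem_radical_right isLinearPart_ιInv hx t) ?_ x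
    rintro _ _ ⟨n, t, ht, rfl, rfl⟩
    rw [sub_zero, toTensorAlgebra_mem_radical, hΨ, ht]
  · intro hx
    have h : tensorRadical (crossed C) ≤ LinearMap.ker (mk C).toLinearMap := by
      rw [tensorRadical_eq, hΨ]
      refine iSup_le fun n => ?_
      rintro _ ⟨t, ht, rfl⟩
      have h := RingQuot.mkAlgHom_rel k (s := BMinusRel C) ⟨n, t, ht, rfl, rfl⟩
      rw [map_zero] at h
      exact h
    exact h hx

theorem ker_mk : LinearMap.ker (mk C).toLinearMap
    = ⨆ n, (LinearMap.ker (BraidedPower.factorial (-C.braiding) n)).map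
        TensorPower.toTensorAlgebra := by
  rw [← (isSuperExtension C).braiding, ← tensorRadical_eq]
  exact Submodule.ext fun x => mk_eq_zero_iff C x

/-- The crossed module structure of the braided exterior algebra. -/
def crossedModule : RightCrossedModule k A (BMinus C) :=
  (isSuperExtension C).restrict (mk C) (mk_surjective C) (mk_eq_zero_iff C)

theorem isCrossedAlgebra_crossedModule : IsCrossedAlgebra C (crossedModule C) where
  act_ι := (isSuperExtension C).restrict_act_ι _ _ _
  coact_ι := (isSuperExtension C).restrict_coact_ι _ _ _
  act_one := ((isSuperExtension C).isCrossedAlg_restrict _ _ _).act_one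
  act_mul := ((isSuperExtension C).isCrossedAlg_restrict _ _ _).act_mul
  coact_one := ((isSuperExtension C).isCrossedAlg_restrict _ _ _).coact_one
  coact_mul := ((isSuperExtension C).isCrossedAlg_restrict _ _ _).coact_mul

theorem isBraidedCoproduct_bcomul : IsBraidedCoproduct C
    (PrimGen.bcomul (quotG (crossed C) (mk C) (mk_surjective C) (mk_eq_zero_iff C)))
    (quotCounit (crossed C) (mk C) (mk_surjective C) (mk_eq_zero_iff C)).toLinearMap where
  comul_ofPower n t := by
    rw [← (isSuperExtension C).braiding]
    exact bcomul_quotG_toTensorAlgebra (mk C) (crossed C) (mk_surjective C) (mk_eq_zero_iff C) n t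
  counit_one := map_one (quotCounit (crossed C) (mk C) (mk_surjective C) (mk_eq_zero_iff C))
  counit_ofPower n t hn := IsSuperExtension.quotCounit_of_mem (mk C) (mk_surjective C)
    (mk_eq_zero_iff C) hn ⟨t, rfl⟩

end BMinus

end

theorem proposition3p8 {k : Type u} {A : Type v} {V : Type w} [Field k] (hk : (2 : k) ≠ 0)
    [Ring A] [HopfAlgebra k A] (hS : Function.Bijective (HopfAlgebra.antipode k (A := A)))
    [AddCommGroup V] [Module k V] (C : RightCrossedModule k A V) (θ : V)
    (hθ : C.coact θ - θ ⊗ₜ[k] (1 : A) ∈ C.box)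
    (hΨ : ∀ η : V, C.braiding (η ⊗ₜ[k] θ) = θ ⊗ₜ[k] η)
    -- the anticommutator, in the algebra `B₋(V) ⊗ A`
    (hanti : ∀ η : V,
      TensorProduct.map (BMinus.ι C) LinearMap.id (C.coact θ - θ ⊗ₜ[k] (1 : A))
          * TensorProduct.map (BMinus.ι C) LinearMap.id (C.coact η)
        + TensorProduct.map (BMinus.ι C) LinearMap.id (C.coact η)
          * TensorProduct.map (BMinus.ι C) LinearMap.id (C.coact θ - θ ⊗ₜ[k] (1 : A)) = 0) :
    -- `ω` defines a first order bicovariant calculus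
    C.IsCrossedMorphism (C.omega θ) ∧
    -- `B₋(V)` is `T(V) / ⊕ₙ ker [n, -Ψ]!`
    LinearMap.ker (BMinus.mk C).toLinearMap
      = ⨆ n, (LinearMap.ker (BraidedPower.factorial (-C.braiding) n)).map
          TensorPower.toTensorAlgebra ∧
    -- the crossed module structure and braided coproduct of `B₋(V)`
    ∃ (CB : RightCrossedModule k A (BMinus C))
      (ΔB : BMinus C →ₗ[k] BMinus C ⊗[k] BMinus C) (εB : BMinus C →ₗ[k] k)
      (δ : BMinus C →ₗ[k] BMinus C),
      BMinus.IsCrossedAlgebra C CB ∧ BMinus.IsBraidedCoproduct C ΔB εB ∧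
      (∀ n, ∀ η ∈ BMinus.deg C n,
        δ η = BMinus.ι C θ * η - (-1) ^ n * (η * BMinus.ι C θ)) ∧
      -- the super-bosonisation `Ω` of `B₋(V)` by `A`, with its differential
      ∃ (Ω : Type (max u v w)) (_ : Ring Ω) (_ : Algebra k Ω) (_ : Coalgebra k Ω)
        (𝒜 : ℕ → Submodule k Ω) (_ : GradedAlgebra 𝒜)
        (e : A ⊗[k] BMinus C ≃ₗ[k] Ω) (j : A →ₐ[k] Ω) (d : Ω →ₗ[k] Ω),
        IsSuperBosonisation CB ΔB εB (BMinus.deg C) e 𝒜 ∧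
        (∀ a, j a = e (a ⊗ₜ[k] 1)) ∧
        IsStronglyBicovariant j 𝒜 d ∧
        -- `d (a ⊗ η) = a₁ ⊗ ω(π a₂) η + a ⊗ δ η`
        (∀ a η, d (e (a ⊗ₜ[k] η))
          = e (TensorProduct.map LinearMap.id
                (LinearMap.mulRight k η ∘ₗ BMinus.ι C ∘ₗ C.omega θ ∘ₗ counitProj k A)
                (Coalgebra.comul a))
            + e (a ⊗ₜ[k] δ η)) ∧
        -- the calculus is inner: `d = [θ, ·}`
        (∀ n, ∀ w ∈ 𝒜 n, d w = e (1 ⊗ₜ[k] BMinus.ι C θ) * w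
          - (-1) ^ n * (w * e (1 ⊗ₜ[k] BMinus.ι C θ))) := by
  -- All structures are obtained from the extension `A[±1]` and the quotient map `T(V) → B₋(V)`,
  -- whose kernel is the radical for the braiding `-Ψ`.
  have X := SuperExtension.isSuperExtension C
  have hq := BMinus.mk_surjective C
  have hker := BMinus.mk_eq_zero_iff C
  exact ⟨C.isCrossedMorphism_omega θ hθ, BMinus.ker_mk C, BMinus.crossedModule C, _, _,
    X.braidedDiff (BMinus.mk C) hq hker θ,
    BMinus.isCrossedAlgebra_crossedModule C, BMinus.isBraidedCoproduct_bcomul C,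
    fun _ _ hη => X.braidedDiff_of_mem _ hq hker θ hη,
    Smash (X.isCrossedAlg_restrict (BMinus.mk C) hq hker),
    inferInstance, inferInstance, X.coalgebra _ _ _, _, X.gradedAlgebra _ _ _,
    Smash.of _, Smash.inH _, X.superDiff _ _ _ θ,
    X.isSuperBosonisation (BMinus.mk C) hq hker, fun _ => rfl,
    X.isStronglyBicovariant (BMinus.mk C) hq hker hθ hΨ hanti,
    X.superDiff_of (BMinus.mk C) hq hker θ,
    fun _ _ => X.superDiff_of_mem (BMinus.mk C) hq hker θ⟩
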